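/- Let $\mathbb{K}$ be a field of characteristic $0$. Let $\mathbf{C}$ be the category with four objects $M, M_+, M_h, M_-$ and exactly four non-identity morphisms $i_\pm : M_\pm\to M$, $j_\pm : M_\pm\to M_h$, let $\mathbf{B}\mathbb{Z}$ be the one-object category of the group $\mathbb{Z}$, and let $L:\mathbf{C}\to\mathbf{B}\mathbb{Z}$ be the functor with $L(i_-)=1$, $L(i_+)=L(j_+)=L(j_-)=0$. A Poisson chain complex $(V,\tau)$ is an (unbounded) chain complex $V$ of $\mathbb{K}$-vector spaces with a graded antisymmetric chain map $\tau:V\otimes V\to\mathbb{K}$; morphisms of the category $\mathbf{PoCh}_{\mathbb{K}}$ are chain maps preserving $\tau$. The functor $\mathfrak{CCR}:\mathbf{PoCh}_{\mathbb{K}}\to\mathbf{dgAlg}_{\mathbb{K}}$ sends $(V,\tau)$ to the tensor algebra of $V$ modulo the relations $v w-(-1)^{|v||w|}w v=\tau(v\otimes w)\,1$, with the induced grading and differential. A weak equivalence in $\mathbf{Fun}(\mathbf{C},\mathbf{dgAlg}_{\mathbb{K}})$ is a natural transformation all of whose components are quasi-isomorphisms. For $X:\mathbf{C}\to\mathbf{Ch}_{\mathbb{K}}$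 let $\mathbb{L}L_!(X):\mathbf{B}\mathbb{Z}\to\mathbf{Ch}_{\mathbb{K}}$ be the bar-construction model of the left derived functor of the left Kan extension along $L$: its degree $m$ part is spanned by elements $(n,N,x)$ with $n\in\mathbb{Z}$, $N\in\mathbf{C}$, $x\in X(N)_m$, and $(n,f,x)$ with $n\in\mathbb{Z}$, $f: s f\to t f$ a non-identity morphism of $\mathbf{C}$, $x\in X(s f)_{m-1}$ (both linear in $x$); its differential is $(n,N,x)\mapsto (n,N,dx)$, $(n,f,x)\mapsto (n,f,dx)+(-1)^{|x|}\big((n+L(f),s f,x)-(n,t f,X(f)x)\big)$; and $k\in\mathbb{Z}$ acts by $n\mapsto n+k$. Let $(\mathfrak{L},\tau):\mathbf{C}\to\mathbf{PoCh}_{\mathbb{K}}$ be a functor such that $\mathfrak{L}(f)$ is a quasi-isomorphism for every morphism $f$ of $\mathbf{C}$. Homotopy coherence data for $\mathfrak{L}$ consist, for every non-identity morphism $f$, of a chain map $\mathfrak{L}(f)^{-1}:\mathfrak{L}(t f)\to\mathfrak{L}(s f)$, chain homotopies $\lambda_f,\gamma_f$ and a chain $2$-homotopy $\xi_f$ with $$\mathfrak{L}(f)\mathfrak{L}(f)^{-1}-\mathrm{id}=\partial\lambda_f,\quad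 \mathfrak{L}(f)^{-1}\mathfrak{L}(f)-\mathrm{id}=\partial\gamma_f,\quad \mathfrak{L}(f)\gamma_f-\lambda_f\mathfrak{L}(f)=\partial\xi_f .$$ Consider the line of arrows $$\cdots (n-1,M)\xleftarrow{i_-}(n,M_-)\xrightarrow{j_-}(n,M_h)\xleftarrow{j_+}(n,M_+)\xrightarrow{i_+}(n,M)\xleftarrow{i_-}(n+1,M_-)\cdots,$$ in which $(n,f)$ denotes the arrow from $(n+L(f),s f)$ to $(n,t f)$. Let $Z_{v'}^{v}$ be the composite of the maps $\mathfrak{L}(f)$ and $\mathfrak{L}(f)^{-1}$ along the shortest path from the vertex $v'$ to the vertex $v$. For an arrow $a=(n,f)$ with source $s a$ and target $t a$ and a vertex $v$, put $\Lambda^{a}_{v}=0$ if $s a$ is nearer to $v$ than $t a$, and $\Lambda^a_v=\lambda_f Z^{t a}_{v}$ otherwise; put $\Gamma^{v}_{a}=0$ if $t a$ is nearer to $v$ than $s a$, and $\Gamma^v_a=Z^{v}_{s a}\gamma_f$ otherwise. For arrows $a=(n,f)$, $a'=(n',f')$ put $\Xi^a_{a'}=\xi_f$ if $a=a'$, $\Xi^a_{a'}=\lambda_f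 Z^{t a}_{s a'}\gamma_{f'}$ if $a\neq a'$ and the ends of $a$ and $a'$ that face each other are $t a$ and $s a'$, and $\Xi^a_{a'}=0$ otherwise. Define $\tau_{\mathbb{L}}$ on $\mathbb{L}L_!(\mathfrak{L})$ by $$\tau_{\mathbb{L}}\big((v,x)\otimes(v',x')\big)=\tfrac12\big(\tau_N(x\otimes Z^{v}_{v'}x')+\tau_{N'}(Z^{v'}_{v}x\otimes x')\big),$$ $$\tau_{\mathbb{L}}\big((a,x)\otimes(v',x')\big)=\tfrac12\big(\tau_{t f}(\mathfrak{L}(f)x\otimes\Lambda^a_{v'}x')+(-1)^{|x'|}\tau_{N'}(\Gamma^{v'}_a x\otimes x')\big),$$ $$\tau_{\mathbb{L}}\big((v,x)\otimes(a',x')\big)=\tfrac{(-1)^{|x|}}2\big(\tau_N(x\otimes\Gamma^v_{a'}x')+(-1)^{|x'|}\tau_{t f'}(\Lambda^{a'}_v x\otimes\mathfrak{L}(f')x')\big),$$ $$\tau_{\mathbb{L}}\big((a,x)\otimes(a',x')\big)=\tfrac{(-1)^{|x|+1}}2\big(\tau_{t f}(\mathfrak{L}(f)x\otimes\Xi^a_{a'}x')-\tau_{t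 f'}(\Xi^{a'}_a x\otimes\mathfrak{L}(f')x')\big),$$ where $v=(n,N)$, $v'=(n',N')$, $a=(n,f)$, $a'=(n',f')$ and $|x|,|x'|$ are the degrees in the values of $\mathfrak{L}$. Theorem. Homotopy coherence data for $\mathfrak{L}$ exist, and for every choice of them $\tau_{\mathbb{L}}$ is a $\mathbb{Z}$-invariant Poisson structure, so that $(\mathbb{L}L_!(\mathfrak{L}),\tau_{\mathbb{L}}):\mathbf{B}\mathbb{Z}\to\mathbf{PoCh}_{\mathbb{K}}$ is a functor. The theory $\mathfrak{A}=\mathfrak{CCR}(\mathfrak{L},\tau):\mathbf{C}\to\mathbf{dgAlg}_{\mathbb{K}}$ sends every morphism of $\mathbf{C}$ to a quasi-isomorphism, and it is connected by a finite zig-zag of weak equivalences in $\mathbf{Fun}(\mathbf{C},\mathbf{dgAlg}_{\mathbb{K}})$ to the theory $\mathfrak{A}^{\mathrm{st}}=L^*\,\mathfrak{CCR}(\mathbb{L}L_!(\mathfrak{L}),\tau_{\mathbb{L}})$, which sends every morphism of $\mathbf{C}$ to an isomorphism. Consequently $\mathfrak{A}^{\mathrm{st}}$ has the relative Cauchy evolution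 automorphism $\mathfrak{A}^{\mathrm{st}}(i_-)\,\mathfrak{A}^{\mathrm{st}}(j_-)^{-1}\,\mathfrak{A}^{\mathrm{st}}(j_+)\,\mathfrak{A}^{\mathrm{st}}(i_+)^{-1}$ of the dg-algebra $\mathfrak{A}^{\mathrm{st}}(M)$, and it is the action of $1\in\mathbb{Z}$, that is, $\mathfrak{CCR}$ of the map $(n,N,x)\mapsto(n+1,N,x)$, $(n,f,x)\mapsto(n+1,f,x)$. -/

import Mathlib

open CategoryTheory DirectSum

universe u

noncomputable section

namespace RCE

/-! ### The four-object category `C` and the functor `L : C ⥤ Bℤ` -/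

/-- The objects `M`, `M₊`, `M_h`, `M₋` of the category `C`. -/
inductive Obj : Type
  | M
  | Mplus
  | Mh
  | Mminus
  deriving DecidableEq

/-- The morphisms of `C`: identities and `i₊ : M₊ → M`, `j₊ : M₊ → M_h`, `i₋ : M₋ → M`,
`j₋ : M₋ → M_h`. -/
inductive Hom : Obj → Obj → Type
  | id (N : Obj) : Hom N N
  | iplus : Hom .Mplus .M
  | jplus : Hom .Mplus .Mh
  | iminus : Hom .Mminus .M
  | jminus : Hom .Mminus .Mh

/-- Composition in `C` (in diagrammatic order); one of the two factors is always an identity. -/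
def Hom.comp : {A B D : Obj} → Hom A B → Hom B D → Hom A D
  | _, _, _, .id _, g => g
  | _, _, _, .iplus, .id _ => .iplus
  | _, _, _, .jplus, .id _ => .jplus
  | _, _, _, .iminus, .id _ => .iminus
  | _, _, _, .jminus, .id _ => .jminus

instance : SmallCategory Obj where
  Hom := Hom
  id := Hom.id
  comp := Hom.comp
  id_comp _ := rfl
  comp_id f := by cases f <;> rfl
  assoc f g h := by cases f <;> cases g <;> cases h <;> rfl

/-- `i₊ : M₊ → M`. -/
def iplus : Obj.Mplus ⟶ Obj.M := Hom.iplus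

/-- `j₊ : M₊ → M_h`. -/
def jplus : Obj.Mplus ⟶ Obj.Mh := Hom.jplus

/-- `i₋ : M₋ → M`. -/
def iminus : Obj.Mminus ⟶ Obj.M := Hom.iminus

/-- `j₋ : M₋ → M_h`. -/
def jminus : Obj.Mminus ⟶ Obj.Mh := Hom.jminus

/-- The integer that `L` assigns to a morphism: `L(i₋) = 1` and all others go to `0`. -/
def Hom.winding : {A B : Obj} → Hom A B → ℤ
  | _, _, .iminus => 1
  | _, _, _ => 0

/-- The one-object category `Bℤ`. -/
abbrev BZ : Type := SingleObj (Multiplicative ℤ)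

/-- The morphism of `Bℤ` given by the integer `k`. -/
def BZ.mor (k : ℤ) : SingleObj.star (Multiplicative ℤ) ⟶ SingleObj.star (Multiplicative ℤ) :=
  Multiplicative.ofAdd k

/-- The localization functor `L : C ⥤ Bℤ`. -/
def locFunctor : Obj ⥤ BZ where
  obj _ := SingleObj.star _
  map f := BZ.mor (Hom.winding f)
  map_id _ := rfl
  map_comp {A B D} f g := by
    change Hom A B at f
    change Hom B D at g
    cases f <;> cases g <;> rfl

/-- The non-identity morphisms of `C`. -/
inductive Arr : Type
  | iplus
  | jplus
  | iminus
  | jminus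
  deriving DecidableEq

/-- Source of a non-identity morphism. -/
def Arr.src : Arr → Obj
  | .iplus => .Mplus
  | .jplus => .Mplus
  | .iminus => .Mminus
  | .jminus => .Mminus

/-- Target of a non-identity morphism. -/
def Arr.tgt : Arr → Obj
  | .iplus => .M
  | .jplus => .Mh
  | .iminus => .M
  | .jminus => .Mh

/-- A non-identity morphism, as a morphism of `C`. -/
def Arr.hom : (f : Arr) → (f.src ⟶ f.tgt)
  | .iplus => RCE.iplus
  | .jplus => RCE.jplus
  | .iminus => RCE.iminus
  | .jminus => RCE.jminus

/-- `L(f)` for a non-identity morphism `f`. -/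
def Arr.winding (f : Arr) : ℤ := Hom.winding f.hom

/-! ### The spiral `L/∗`

Its vertices are the pairs `(n, N)`; the pair `(n, f)` is the edge from `(n + L(f), s f)` to
`(n, t f)`. In linear order the vertices are
`… (n-1, M), (n, M₋), (n, M_h), (n, M₊), (n, M), (n+1, M₋), …`. -/

/-- Vertices of the spiral. -/
abbrev Vert : Type := ℤ × Obj

/-- Edges of the spiral (non-identity morphisms of `L/∗`). -/
abbrev Edge : Type := ℤ × Arr

/-- The source `(n + L(f), s f)` of the edge `(n, f)`. -/
def Edge.src (a : Edge) : Vert := (a.1 + a.2.winding, a.2.src)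

/-- The target `(n, t f)` of the edge `(n, f)`. -/
def Edge.tgt (a : Edge) : Vert := (a.1, a.2.tgt)

/-- Position of a vertex on the line obtained by straightening the spiral. -/
def Vert.pos : Vert → ℤ
  | (n, .Mminus) => 4 * n
  | (n, .Mh) => 4 * n + 1
  | (n, .Mplus) => 4 * n + 2
  | (n, .M) => 4 * n + 3

/-- The right neighbour of a vertex. -/
def Vert.next : Vert → Vert
  | (n, .Mminus) => (n, .Mh)
  | (n, .Mh) => (n, .Mplus)
  | (n, .Mplus) => (n, .M)
  | (n, .M) => (n + 1, .Mminus)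

/-- The left neighbour of a vertex. -/
def Vert.prev : Vert → Vert
  | (n, .Mminus) => (n - 1, .M)
  | (n, .Mh) => (n, .Mminus)
  | (n, .Mplus) => (n, .Mh)
  | (n, .M) => (n, .Mplus)

/-- The length of the shortest zig-zag between two vertices. -/
def Vert.dist (v w : Vert) : ℕ := (w.pos - v.pos).natAbs

/-! ### Chain complexes and Poisson chain complexes -/

/-- (Unbounded) chain complexes of `K`-vector spaces. -/
abbrev Ch (K : Type u) [Field K] : Type (u + 1) := ChainComplex (ModuleCat.{u} K) ℤ

variable {K : Type u} [Field K]

/-- A family of bilinear forms `V_i × V_j → K`, i.e. a linear map `V ⊗ V → K`, by components. -/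
abbrev Pairing (V : Ch K) : Type u := ∀ i j : ℤ, V.X i →ₗ[K] V.X j →ₗ[K] K

/-- The linear map `τ : V ⊗ V → K` is a chain map, with `K` in degree `0`, that factors through the
(graded) antisymmetrized tensor product `V ∧ V`. -/
structure IsPoisson {V : Ch K} (τ : Pairing V) : Prop where
  degree_zero : ∀ i j : ℤ, i + j ≠ 0 → τ i j = 0
  antisymm : ∀ (i j : ℤ) (x : V.X i) (y : V.X j),
    τ i j x y = -((-1 : K) ^ (i * j) * τ j i y x)
  chain_map : ∀ (i j : ℤ) (x : V.X i) (y : V.X j),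
    τ (i - 1) j ((V.d i (i - 1)).hom x) y + (-1 : K) ^ i * τ i (j - 1) x ((V.d j (j - 1)).hom y) = 0

variable (K) in
/-- Poisson chain complexes `(V, τ)`. -/
structure PoCh : Type (u + 1) where
  V : Ch K
  τ : Pairing V
  isPoisson : IsPoisson τ

/-- Morphisms `f : (V, τ) → (W, σ)` are chain maps with `σ ∘ (f ∧ f) = τ`. -/
@[ext]
structure PoCh.Hom (P Q : PoCh K) : Type u where
  f : P.V ⟶ Q.V
  compat : ∀ (i j : ℤ) (x : P.V.X i) (y : P.V.X j),
    Q.τ i j ((f.f i).hom x) ((f.f j).hom y) = P.τ i j x y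

instance : Category (PoCh K) where
  Hom := PoCh.Hom
  id P := ⟨𝟙 P.V, fun _ _ _ _ => rfl⟩
  comp f g := ⟨f.f ≫ g.f, fun i j x y => (g.compat i j _ _).trans (f.compat i j x y)⟩
  id_comp f := PoCh.Hom.ext (Category.id_comp f.f)
  comp_id f := PoCh.Hom.ext (Category.comp_id f.f)
  assoc f g h := PoCh.Hom.ext (Category.assoc f.f g.f h.f)

variable (K) in
/-- The functor forgetting the Poisson structure. -/
def PoCh.forget : PoCh K ⥤ Ch K where
  obj P := P.V
  map f := f.f

/-- A family of pairings on the values of a functor `Y : J ⥤ Ch K` lifts `Y` to a functor to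
Poisson chain complexes. -/
structure IsPoissonOn {J : Type*} [Category J] (Y : J ⥤ Ch K) (τ : ∀ j, Pairing (Y.obj j)) :
    Prop where
  isPoisson : ∀ j, IsPoisson (τ j)
  natural : ∀ {j j' : J} (f : j ⟶ j') (p q : ℤ) (x : (Y.obj j).X p) (y : (Y.obj j).X q),
    τ j' p q (((Y.map f).f p).hom x) (((Y.map f).f q).hom y) = τ j p q x y

/-- The functor `(Y, τ) : J ⥤ PoCh K`. -/
def IsPoissonOn.toPoCh {J : Type*} [Category J] {Y : J ⥤ Ch K} {τ : ∀ j, Pairing (Y.obj j)}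
    (h : IsPoissonOn Y τ) : J ⥤ PoCh K where
  obj j := ⟨Y.obj j, τ j, h.isPoisson j⟩
  map f := ⟨Y.map f, h.natural f⟩
  map_id j := PoCh.Hom.ext (Y.map_id j)
  map_comp f g := PoCh.Hom.ext (Y.map_comp f g)

/-! ### The left derived functor `𝕃L_!`, by the bar construction -/

section LeftDerived

variable (X : Obj ⥤ Ch K)

/-- Degree `m` of `𝕃L_!(X)`: the direct sum of all `X(N)_m`, over the vertices `(n, N)`, and of all
`X(s f)_{m-1}`, over the edges `(n, f)`. -/
abbrev LLX (m : ℤ) : Type u :=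
  (⨁ v : Vert, (X.obj v.2).X m) × (⨁ a : Edge, (X.obj a.2.src).X (m - 1))

/-- `x ↦ (n, N, x)`. -/
def inVert (m n : ℤ) (N : Obj) : (X.obj N).X m →ₗ[K] LLX X m :=
  LinearMap.inl K _ _ ∘ₗ DirectSum.lof K Vert (fun v => (X.obj v.2).X m) (n, N)

/-- `x ↦ (n, f, x)`. -/
def inEdge (m n : ℤ) (f : Arr) : (X.obj f.src).X (m - 1) →ₗ[K] LLX X m :=
  LinearMap.inr K _ _ ∘ₗ DirectSum.lof K Edge (fun a => (X.obj a.2.src).X (m - 1)) (n, f)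

variable {X} in
/-- The linear map on `𝕃L_!(X)_m` with prescribed values on the elements `(n, N, x)` and
`(n, f, x)`. -/
def descLL {m : ℤ} {W : Type*} [AddCommGroup W] [Module K W]
    (φ : ∀ v : Vert, (X.obj v.2).X m →ₗ[K] W)
    (ψ : ∀ a : Edge, (X.obj a.2.src).X (m - 1) →ₗ[K] W) : LLX X m →ₗ[K] W :=
  LinearMap.coprod (DirectSum.toModule K Vert W φ) (DirectSum.toModule K Edge W ψ)

@[simp]
theorem descLL_inVert {m : ℤ} {W : Type*} [AddCommGroup W] [Module K W]
    (φ : ∀ v : Vert, (X.obj v.2).X m →ₗ[K] W)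
    (ψ : ∀ a : Edge, (X.obj a.2.src).X (m - 1) →ₗ[K] W) (n : ℤ) (N : Obj)
    (x : (X.obj N).X m) :
    descLL φ ψ (inVert X m n N x) = φ (n, N) x := by
  rw [descLL, inVert, LinearMap.comp_apply, LinearMap.inl_apply, LinearMap.coprod_apply, map_zero,
    add_zero]
  exact DirectSum.toModule_lof (M := fun v : Vert => (X.obj v.2).X m) K (n, N) x

@[simp]
theorem descLL_inEdge {m : ℤ} {W : Type*} [AddCommGroup W] [Module K W]
    (φ : ∀ v : Vert, (X.obj v.2).X m →ₗ[K] W)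
    (ψ : ∀ a : Edge, (X.obj a.2.src).X (m - 1) →ₗ[K] W) (n : ℤ) (f : Arr)
    (x : (X.obj f.src).X (m - 1)) :
    descLL φ ψ (inEdge X m n f x) = ψ (n, f) x := by
  rw [descLL, inEdge, LinearMap.comp_apply, LinearMap.inr_apply, LinearMap.coprod_apply, map_zero,
    zero_add]
  exact DirectSum.toModule_lof (M := fun a : Edge => (X.obj a.2.src).X (m - 1)) K (n, f) x

theorem LLX_hom_ext {m : ℤ} {W : Type*} [AddCommGroup W] [Module K W] {f g : LLX X m →ₗ[K] W}
    (h₀ : ∀ n N x, f (inVert X m n N x) = g (inVert X m n N x))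
    (h₁ : ∀ n a x, f (inEdge X m n a x) = g (inEdge X m n a x)) : f = g := by
  apply LinearMap.prod_ext
  · apply DirectSum.linearMap_ext
    intro v
    ext x
    exact h₀ v.1 v.2 x
  · apply DirectSum.linearMap_ext
    intro a
    ext x
    exact h₁ a.1 a.2 x

/-- The identity `V_i → V_j` for `i = j` (and zero otherwise). -/
def idOfEq (V : Ch K) (i j : ℤ) : V.X i ⟶ V.X j :=
  if h : i = j then (V.XIsoOfEq h).hom else 0

/-- The vertical differential
`δ (n, f, x) = (-1)^|x| ((n + L(f), s f, x) - (n, t f, X(f) x))`, from total degree `i` to total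
degree `j = i - 1`. -/
def deltaLL (i j n : ℤ) (f : Arr) : (X.obj f.src).X (i - 1) →ₗ[K] LLX X j :=
  (-1 : K) ^ (i - 1) •
    (inVert X j (n + f.winding) f.src ∘ₗ (idOfEq (X.obj f.src) (i - 1) j).hom -
      inVert X j n f.tgt ∘ₗ
        ((X.map f.hom).f j).hom ∘ₗ (idOfEq (X.obj f.src) (i - 1) j).hom)

/-- The total differential `δ + d`. -/
def dLL (i j : ℤ) : LLX X i →ₗ[K] LLX X j :=
  descLL (fun v => inVert X j v.1 v.2 ∘ₗ ((X.obj v.2).d i j).hom)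
    (fun a => deltaLL X i j a.1 a.2 +
      inEdge X j a.1 a.2 ∘ₗ ((X.obj a.2.src).d (i - 1) (j - 1)).hom)

theorem dLL_shape (i j : ℤ) (h : j + 1 ≠ i) : dLL X i j = 0 := by
  apply LLX_hom_ext
  · intro n N x
    have : (X.obj N).d i j = 0 := (X.obj N).shape _ _ h
    simp [dLL, this]
  · intro n f x
    have h1 : (X.obj f.src).d (i - 1) (j - 1) = 0 :=
      (X.obj f.src).shape _ _ (fun h' => h (by simp at h'; omega))
    have h2 : ¬ (i - 1 = j) := by omega
    simp [dLL, h1, deltaLL, idOfEq, h2]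

theorem dLL_comp (m : ℤ) : dLL X (m - 1) (m - 1 - 1) ∘ₗ dLL X m (m - 1) = 0 := by
  apply LLX_hom_ext
  · intro n N x
    have := congrArg (fun f => f.hom x) ((X.obj N).d_comp_d m (m - 1) (m - 1 - 1))
    simp only [ModuleCat.hom_comp, LinearMap.comp_apply, ModuleCat.hom_zero,
      LinearMap.zero_apply] at this
    simp [dLL, this]
  · intro n f x
    have h1 := congrArg (fun g => g.hom x)
      ((X.obj f.src).d_comp_d (m - 1) (m - 1 - 1) (m - 1 - 1 - 1))
    have h2 := congrArg (fun g => g.hom x)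
      ((X.map f.hom).comm (m - 1) (m - 1 - 1))
    simp only [ModuleCat.hom_comp, LinearMap.comp_apply, ModuleCat.hom_zero,
      LinearMap.zero_apply] at h1 h2
    have h3 : (-1 : K) ^ (m - 1) = -(-1 : K) ^ (m - 1 - 1) := by
      rw [zpow_sub_one₀ (by simp) (m - 1)]; simp
    simp [dLL, deltaLL, idOfEq, h1, h3, h2]

/-- The complex `𝕃L_!(X)(∗)`. -/
def LLobj : Ch K where
  X m := ModuleCat.of K (LLX X m)
  d i j := ModuleCat.ofHom (dLL X i j)
  shape i j h := by
    rw [dLL_shape X i j h]; rfl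
  d_comp_d' i j k hij hjk := by
    obtain rfl : j = i - 1 := by simp at hij; omega
    obtain rfl : k = i - 1 - 1 := by simp at hjk; omega
    rw [← ModuleCat.ofHom_comp, dLL_comp]; rfl

/-- Translation by `k` levels, `(n, N, x) ↦ (n + k, N, x)` and `(n, f, x) ↦ (n + k, f, x)`. -/
def shiftLL (k m : ℤ) : LLX X m →ₗ[K] LLX X m :=
  descLL (fun v => inVert X m (v.1 + k) v.2) (fun a => inEdge X m (a.1 + k) a.2)

/-- The action of `k ∈ ℤ` on `𝕃L_!(X)(∗)`. -/
def LLmap (k : ℤ) : LLobj X ⟶ LLobj X where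
  f m := ModuleCat.ofHom (shiftLL X k m)
  comm' i j _ := by
    change ModuleCat.ofHom _ ≫ ModuleCat.ofHom _ = ModuleCat.ofHom _ ≫ ModuleCat.ofHom _
    rw [← ModuleCat.ofHom_comp, ← ModuleCat.ofHom_comp]
    congr 1
    apply LLX_hom_ext
    · intro n N x
      simp [dLL, shiftLL]
    · intro n f x
      have e : n + k + f.winding = n + f.winding + k := by ring
      simp [dLL, shiftLL, deltaLL, e]

/-- The left derived functor `𝕃L_!(X) : Bℤ ⥤ Ch K` of the left Kan extension along `L`. -/
def LL : BZ ⥤ Ch K where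
  obj _ := LLobj X
  map k := LLmap X (Multiplicative.toAdd (k : Multiplicative ℤ))
  map_id _ := by
    ext m : 1
    change ModuleCat.ofHom (shiftLL X 0 m) = 𝟙 _
    rw [← ModuleCat.ofHom_id]
    congr 1
    apply LLX_hom_ext <;> · intros; simp [shiftLL]
  map_comp k l := by
    ext m : 1
    change ModuleCat.ofHom (shiftLL X (Multiplicative.toAdd (l : Multiplicative ℤ) +
      Multiplicative.toAdd (k : Multiplicative ℤ)) m) = ModuleCat.ofHom _ ≫ ModuleCat.ofHom _
    rw [← ModuleCat.ofHom_comp]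
    congr 1
    have e : ∀ n a b : ℤ, n + (a + b) = n + b + a := fun n a b => by ring
    apply LLX_hom_ext <;> · intros; simp [shiftLL, e]

end LeftDerived

/-! ### Homotopy coherence data and the Poisson structure `τ_𝕃` -/

/-- A quasi-inverse of a chain map `φ : V → W`, with chain homotopies `φ φ⁻¹ - id = ∂λ`,
`φ⁻¹ φ - id = ∂γ` and a chain 2-homotopy `φ γ - λ φ = ∂ξ` (where `∂ξ = d ξ - ξ d`). -/
structure QuasiInverse {V W : Ch K} (φ : V ⟶ W) : Type u where
  inv : W ⟶ V
  lam : Homotopy (inv ≫ φ) (𝟙 W)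
  gam : Homotopy (φ ≫ inv) (𝟙 V)
  xi : ∀ i j : ℤ, V.X i ⟶ W.X j
  xi_zero : ∀ i j : ℤ, i + 2 ≠ j → xi i j = 0
  xi_comm : ∀ i : ℤ,
    gam.hom i (i + 1) ≫ φ.f (i + 1) - φ.f i ≫ lam.hom i (i + 1) =
      xi i (i + 2) ≫ W.d (i + 2) (i + 1) - V.d i (i - 1) ≫ xi (i - 1) (i + 1)

/-- A choice of homotopy coherence data for every non-identity morphism of `C`. -/
abbrev CoherenceData (X : Obj ⥤ Ch K) : Type u := ∀ f : Arr, QuasiInverse (X.map f.hom)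

section Poisson

variable {X : Obj ⥤ Ch K} (D : CoherenceData X)

/-- The chain map along one step of the spiral to the right, using the quasi-inverse if the arrow
points to the left. -/
def stepRight : (v : Vert) → (X.obj v.2 ⟶ X.obj v.next.2)
  | (_, .Mminus) => X.map jminus
  | (_, .Mh) => (D .jplus).inv
  | (_, .Mplus) => X.map iplus
  | (_, .M) => (D .iminus).inv

/-- The chain map along one step of the spiral to the left, using the quasi-inverse if the arrow
points to the right. -/
def stepLeft : (v : Vert) → (X.obj v.2 ⟶ X.obj v.prev.2)
  | (_, .Mminus) => X.map iminus
  | (_, .Mh) => (D .jminus).inv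
  | (_, .Mplus) => X.map jplus
  | (_, .M) => (D .iplus).inv

/-- The composite of `k` steps from `v` towards `w`, if this ends in `w` (and zero otherwise). -/
def zigzagAux : ℕ → (v w : Vert) → (X.obj v.2 ⟶ X.obj w.2)
  | 0, v, w => if h : v = w then eqToHom (by rw [h]) else 0
  | k + 1, v, w =>
      if v.pos < w.pos then stepRight D v ≫ zigzagAux k v.next w
      else stepLeft D v ≫ zigzagAux k v.prev w

/-- The zig-zagging chain map `Z` from `v` to `w`, along the shortest zig-zag. -/
def zigzag (v w : Vert) : X.obj v.2 ⟶ X.obj w.2 := zigzagAux D (v.dist w) v w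

/-- The zig-zagging homotopy `Λ` (for left composition), of degree 1, from `X(N')` to `X(t f)`,
for a vertex `v = (n', N')` and an edge `a = (n, f)`: zero if `f` points along the zig-zag from `v`,
and `λ_f Z` if it points against it. -/
def Lam (a : Edge) (v : Vert) (i j : ℤ) : (X.obj v.2).X i ⟶ (X.obj a.2.tgt).X j :=
  if v.dist a.src < v.dist a.tgt then 0
  else (zigzag D v a.tgt).f i ≫ (D a.2).lam.hom i j

/-- The zig-zagging homotopy `Γ` (for right composition), of degree 1, from `X(s f')` to `X(N)`,
for a vertex `v = (n, N)` and an edge `a = (n', f')`: zero if `f'` points along the zig-zag to `v`,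
and `Z γ_{f'}` if it points against it. -/
def Gam (v : Vert) (a : Edge) (i j : ℤ) : (X.obj a.2.src).X i ⟶ (X.obj v.2).X j :=
  if a.tgt.dist v < a.src.dist v then 0
  else (D a.2).gam.hom i j ≫ (zigzag D a.src v).f j

/-- The zig-zagging 2-homotopy `Ξ`, of degree 2, from `X(s f')` to `X(t f)`, for two edges
`a = (n, f)` and `a' = (n', f')`: it is `ξ_f` if `a = a'`, it is `λ_f Z γ_{f'}` if `s f'` and `t f`
are the ends of the two edges that face each other, and zero otherwise. -/
def Xi (a a' : Edge) (i j : ℤ) : (X.obj a'.2.src).X i ⟶ (X.obj a.2.tgt).X j :=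
  if h : a' = a then
    eqToHom (by rw [h]) ≫ (D a.2).xi i j
  else if a'.src.dist a.tgt < a'.tgt.dist a.tgt ∧ a'.src.dist a.tgt < a'.src.dist a.src then
    (D a'.2).gam.hom i (i + 1) ≫ (zigzag D a'.src a.tgt).f (i + 1) ≫ (D a.2).lam.hom (i + 1) j
  else 0

variable (τ : ∀ N, Pairing (X.obj N))

/-- `τ_𝕃` on `(n, N, x) ⊗ (n', N', x')`, where `|x| = i` and `|x'| = j`:
`½ (τ_N (x ⊗ Z x') + τ_N' (Z x ⊗ x'))`. -/
def tauVV (i j : ℤ) (v v' : Vert) : (X.obj v.2).X i →ₗ[K] (X.obj v'.2).X j →ₗ[K] K :=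
  (1 / 2 : K) •
    ((τ v.2 i j).compl₂ ((zigzag D v' v).f j).hom + (τ v'.2 i j) ∘ₗ ((zigzag D v v').f i).hom)

/-- `τ_𝕃` on `(n, f, x) ⊗ (n', N', x')`, where `|x| = i - 1` and `|x'| = j`:
`½ (τ_{t f} (X(f) x ⊗ Λ x') + (-1)^|x'| τ_N' (Γ x ⊗ x'))`. -/
def tauEV (i j : ℤ) (a : Edge) (v' : Vert) :
    (X.obj a.2.src).X (i - 1) →ₗ[K] (X.obj v'.2).X j →ₗ[K] K :=
  (1 / 2 : K) •
    ((τ a.2.tgt (i - 1) (j + 1)).compl₁₂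
        ((X.map a.2.hom).f (i - 1)).hom (Lam D a v' j (j + 1)).hom +
      (-1 : K) ^ j • (τ v'.2 i j) ∘ₗ (Gam D v' a (i - 1) i).hom)

/-- `τ_𝕃` on `(n, N, x) ⊗ (n', f', x')`, where `|x| = i` and `|x'| = j - 1`:
`½ (-1)^|x| (τ_N (x ⊗ Γ x') + (-1)^|x'| τ_{t f'} (Λ x ⊗ X(f') x'))`. -/
def tauVE (i j : ℤ) (v : Vert) (a' : Edge) :
    (X.obj v.2).X i →ₗ[K] (X.obj a'.2.src).X (j - 1) →ₗ[K] K :=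
  ((-1 : K) ^ i / 2) •
    ((τ v.2 i j).compl₂ (Gam D v a' (j - 1) j).hom +
      (-1 : K) ^ (j - 1) • (τ a'.2.tgt (i + 1) (j - 1)).compl₁₂
        (Lam D a' v i (i + 1)).hom ((X.map a'.2.hom).f (j - 1)).hom)

/-- `τ_𝕃` on `(n, f, x) ⊗ (n', f', x')`, where `|x| = i - 1` and `|x'| = j - 1`:
`½ (-1)^(|x|+1) (τ_{t f} (X(f) x ⊗ Ξ x') - τ_{t f'} (Ξ x ⊗ X(f') x'))`. -/
def tauEE (i j : ℤ) (a a' : Edge) :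
    (X.obj a.2.src).X (i - 1) →ₗ[K] (X.obj a'.2.src).X (j - 1) →ₗ[K] K :=
  ((-1 : K) ^ ((i - 1) + 1) / 2) •
    ((τ a.2.tgt (i - 1) (j + 1)).compl₁₂
        ((X.map a.2.hom).f (i - 1)).hom (Xi D a a' (j - 1) (j + 1)).hom -
      (τ a'.2.tgt (i + 1) (j - 1)).compl₁₂
        (Xi D a' a (i - 1) (i + 1)).hom ((X.map a'.2.hom).f (j - 1)).hom)

/-- The pairing `τ_𝕃` in degrees `i` and `j`. -/
def tauLLX (i j : ℤ) : LLX X i →ₗ[K] LLX X j →ₗ[K] K :=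
  descLL
    (fun v => (descLL (fun v' => (tauVV D τ i j v v').flip)
      (fun a' => (tauVE D τ i j v a').flip) : LLX X j →ₗ[K] _).flip)
    (fun a => (descLL (fun v' => (tauEV D τ i j a v').flip)
      (fun a' => (tauEE D τ i j a a').flip) : LLX X j →ₗ[K] _).flip)

/-- The pairing `τ_𝕃` on `𝕃L_!(X)`. -/
def tauLL : Pairing (LLobj X) := tauLLX D τ

end Poisson

/-! ### Differential graded algebras -/

variable (K) in
/-- An associative unital differential graded `K`-algebra: a `ℤ`-graded `K`-algebra `A = ⨁ A_n`
with a differential of degree `-1` satisfying the graded Leibniz rule. -/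
structure DGAlg : Type (u + 1) where
  A : Type u
  [ring : Ring A]
  [algebra : Algebra K A]
  deg : ℤ → Submodule K A
  [grading : GradedAlgebra deg]
  d : A →ₗ[K] A
  d_mem : ∀ (n : ℤ) (a : A), a ∈ deg n → d a ∈ deg (n - 1)
  d_d : ∀ a : A, d (d a) = 0
  leibniz : ∀ (n : ℤ) (a b : A), a ∈ deg n → d (a * b) = d a * b + (-1 : K) ^ n • (a * d b)

attribute [instance] DGAlg.ring DGAlg.algebra DGAlg.grading

/-- Morphisms of dg-algebras: degree preserving algebra homomorphisms commuting with `d`. -/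
@[ext]
structure DGAlg.Hom (A B : DGAlg K) : Type u where
  f : A.A →ₐ[K] B.A
  map_mem : ∀ (n : ℤ) (a : A.A), a ∈ A.deg n → f a ∈ B.deg n
  map_d : ∀ a : A.A, f (A.d a) = B.d (f a)

instance : Category (DGAlg K) where
  Hom := DGAlg.Hom
  id A := ⟨AlgHom.id K A.A, fun _ _ h => h, fun _ => rfl⟩
  comp f g := ⟨g.f.comp f.f, fun n a h => g.map_mem n _ (f.map_mem n a h),
    fun a => (congrArg g.f (f.map_d a)).trans (g.map_d _)⟩
  id_comp _ := rfl
  comp_id _ := rfl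
  assoc _ _ _ := rfl

/-- The differential from degree `i` to degree `j`. -/
def DGAlg.dHom (A : DGAlg K) (i j : ℤ) : A.deg i →ₗ[K] A.deg j :=
  if h : j + 1 = i then
    (A.d ∘ₗ (A.deg i).subtype).codRestrict (A.deg j)
      (fun a => (show j = i - 1 by omega) ▸ A.d_mem i a a.2)
  else 0

theorem DGAlg.dHom_coe (A : DGAlg K) {i j : ℤ} (h : j + 1 = i) (a : A.deg i) :
    (A.dHom i j a : A.A) = A.d a := by
  simp [DGAlg.dHom, h]

variable (K) in
/-- The underlying chain complex of a dg-algebra. -/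
def DGAlg.toCh : DGAlg K ⥤ Ch K where
  obj A :=
    { X := fun n => ModuleCat.of K (A.deg n)
      d := fun i j => ModuleCat.ofHom (A.dHom i j)
      shape := fun i j h => by
        have h' : ¬ (j + 1 = i) := h
        simp only [DGAlg.dHom, dif_neg h']
        rfl
      d_comp_d' := fun i j k hij hjk => by
        ext a
        change (A.dHom j k (A.dHom i j a) : A.A) = 0
        rw [A.dHom_coe hjk, A.dHom_coe hij, A.d_d] }
  map {A B} f :=
    { f := fun n => ModuleCat.ofHom
        ((f.f.toLinearMap ∘ₗ (A.deg n).subtype).codRestrict (B.deg n)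
          (fun a => f.map_mem n a a.2))
      comm' := fun i j hij => by
        ext a
        change (B.dHom i j _ : B.A) = f.f (A.dHom i j a : A.A)
        rw [B.dHom_coe hij, A.dHom_coe hij, f.map_d]
        rfl }

/-! ### Canonical commutation relations -/

section CCR

variable {V : Ch K} (τ : Pairing V)

/-- The canonical commutation relations `v w = (-1)^(|v| |w|) w v + τ(v ⊗ w) 1` in the tensor
algebra of `V`. -/
inductive CCRRel : TensorAlgebra K (⨁ n, V.X n) → TensorAlgebra K (⨁ n, V.X n) → Prop
  | comm (i j : ℤ) (x : V.X i) (y : V.X j) :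
    CCRRel
      (TensorAlgebra.ι K (DirectSum.lof K ℤ (fun n => V.X n) i x) *
        TensorAlgebra.ι K (DirectSum.lof K ℤ (fun n => V.X n) j y))
      ((-1 : K) ^ (i * j) •
          (TensorAlgebra.ι K (DirectSum.lof K ℤ (fun n => V.X n) j y) *
            TensorAlgebra.ι K (DirectSum.lof K ℤ (fun n => V.X n) i x)) +
        algebraMap K _ (τ i j x y))

/-- The algebra underlying `CCR(V, τ)`: the tensor algebra of `V` modulo the two-sided ideal of the
canonical commutation relations. -/
def CCRAlg : Type u := RingQuot (CCRRel τ)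

namespace CCRAlg

instance : Ring (CCRAlg τ) := inferInstanceAs (Ring (RingQuot (CCRRel τ)))

instance : Algebra K (CCRAlg τ) := inferInstanceAs (Algebra K (RingQuot (CCRRel τ)))

/-- The generator given by a homogeneous element of `V`. -/
def gen (i : ℤ) : V.X i →ₗ[K] CCRAlg τ :=
  (RingQuot.mkAlgHom K (CCRRel τ)).toLinearMap ∘ₗ TensorAlgebra.ι K ∘ₗ
    DirectSum.lof K ℤ (fun n => V.X n) i

theorem gen_mul_gen (i j : ℤ) (x : V.X i) (y : V.X j) :
    gen τ i x * gen τ j y =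
      (-1 : K) ^ (i * j) • (gen τ j y * gen τ i x) + algebraMap K _ (τ i j x y) := by
  have := RingQuot.mkAlgHom_rel K (CCRRel.comm (τ := τ) i j x y)
  rw [map_mul, map_add, map_smul, map_mul, AlgHom.commutes] at this
  exact this

variable {τ}

/-- Algebra homomorphisms out of the CCR-algebra. -/
def lift {B : Type*} [Semiring B] [Algebra K B] (g : ∀ i, V.X i →ₗ[K] B)
    (hg : ∀ (i j : ℤ) (x : V.X i) (y : V.X j),
      g i x * g j y = (-1 : K) ^ (i * j) • (g j y * g i x) + algebraMap K B (τ i j x y)) :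
    CCRAlg τ →ₐ[K] B :=
  RingQuot.liftAlgHom K ⟨TensorAlgebra.lift K (DirectSum.toModule K ℤ B g), by
    rintro _ _ ⟨i, j, x, y⟩
    rw [map_mul, map_add, map_smul, map_mul, AlgHom.commutes]
    simpa using hg i j x y⟩

theorem lift_gen {B : Type*} [Semiring B] [Algebra K B] (g : ∀ i, V.X i →ₗ[K] B)
    (hg : ∀ (i j : ℤ) (x : V.X i) (y : V.X j),
      g i x * g j y = (-1 : K) ^ (i * j) • (g j y * g i x) + algebraMap K B (τ i j x y))
    (i : ℤ) (x : V.X i) : lift g hg (gen τ i x) = g i x := by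
  change RingQuot.liftAlgHom K _ (RingQuot.mkAlgHom K (CCRRel τ) _) = _
  rw [RingQuot.liftAlgHom_mkAlgHom_apply]
  simp

theorem hom_ext {B : Type*} [Semiring B] [Algebra K B] {f g : CCRAlg τ →ₐ[K] B}
    (h : ∀ i x, f (gen τ i x) = g (gen τ i x)) : f = g := by
  apply RingQuot.ringQuot_ext'
  apply TensorAlgebra.hom_ext
  apply DirectSum.linearMap_ext
  intro i
  ext x
  exact h i x

variable (τ) in
/-- The product of a list of generators. -/
def mono (l : List (Σ i, V.X i)) : CCRAlg τ := (l.map fun p => gen τ p.1 p.2).prod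

variable (τ) in
/-- The degree `n` part: the span of the products `v₁ ⋯ v_k` of homogeneous elements with
`|v₁| + ⋯ + |v_k| = n`. -/
def deg (n : ℤ) : Submodule K (CCRAlg τ) :=
  Submodule.span K {a | ∃ l : List (Σ i, V.X i), (l.map fun p => p.1).sum = n ∧ mono τ l = a}

theorem mono_mem (l : List (Σ i, V.X i)) : mono τ l ∈ deg τ (l.map fun p => p.1).sum :=
  Submodule.subset_span ⟨l, rfl, rfl⟩

theorem mono_cons (p : Σ i, V.X i) (l : List (Σ i, V.X i)) :
    mono τ (p :: l) = gen τ p.1 p.2 * mono τ l := by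
  simp [mono]

theorem gen_mem (i : ℤ) (x : V.X i) : gen τ i x ∈ deg τ i := by
  simpa [mono] using mono_mem (τ := τ) [⟨i, x⟩]

instance : SetLike.GradedMonoid (deg τ) where
  one_mem := by simpa [mono] using mono_mem (τ := τ) []
  mul_mem i j a b ha hb := by
    have h := Submodule.mul_mem_mul ha hb
    rw [deg, deg, Submodule.span_mul_span] at h
    refine Submodule.span_mono ?_ h
    rintro _ ⟨_, ⟨l, hl, rfl⟩, _, ⟨l', hl', rfl⟩, rfl⟩
    exact ⟨l ++ l', by simp [hl, hl'], by simp [mono]⟩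

/-- The inclusion of generators into the direct sum of the homogeneous parts. -/
def genDeg (i : ℤ) : V.X i →ₗ[K] ⨁ n, deg τ n :=
  DirectSum.lof K ℤ (fun n => deg τ n) i ∘ₗ (gen τ i).codRestrict (deg τ i) (gen_mem i)

theorem of_deg_congr {m n : ℤ} {a b : CCRAlg τ} (ha : a ∈ deg τ m) (hb : b ∈ deg τ n)
    (hmn : m = n) (hab : a = b) :
    DirectSum.of (fun n => deg τ n) m ⟨a, ha⟩ = DirectSum.of (fun n => deg τ n) n ⟨b, hb⟩ := by
  subst hmn hab
  rfl

theorem genDeg_rel (hτ : IsPoisson τ) (i j : ℤ) (x : V.X i) (y : V.X j) :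
    (genDeg i x * genDeg j y : ⨁ n, deg τ n) =
      (-1 : K) ^ (i * j) • (genDeg j y * genDeg i x) + algebraMap K _ (τ i j x y) := by
  have key : ∀ (i j : ℤ) (x : V.X i) (y : V.X j),
      (genDeg i x * genDeg j y : ⨁ n, deg τ n) = DirectSum.of (fun n => deg τ n) (i + j)
        ⟨gen τ i x * gen τ j y, SetLike.mul_mem_graded (gen_mem i x) (gen_mem j y)⟩ :=
    fun i j x y => DirectSum.of_mul_of (A := fun n => deg τ n) _ _
  have key2 : (-1 : K) ^ (i * j) • (genDeg j y * genDeg i x : ⨁ n, deg τ n) =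
      DirectSum.of (fun n => deg τ n) (i + j) ⟨(-1 : K) ^ (i * j) • (gen τ j y * gen τ i x),
        (deg τ (i + j)).smul_mem _
          (add_comm j i ▸ SetLike.mul_mem_graded (gen_mem j y) (gen_mem i x))⟩ := by
    rw [key, ← DirectSum.lof_eq_of K, ← map_smul, DirectSum.lof_eq_of]
    exact of_deg_congr _ _ (add_comm j i) rfl
  rw [key, key2]
  by_cases h : i + j = 0
  · have key3 : algebraMap K (⨁ n, deg τ n) (τ i j x y) =
        DirectSum.of (fun n => deg τ n) (i + j)
          ⟨algebraMap K _ (τ i j x y), h ▸ SetLike.algebraMap_mem_graded _ _⟩ := by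
      rw [DirectSum.algebraMap_apply]
      exact of_deg_congr _ _ h.symm rfl
    rw [key3, ← map_add]
    exact of_deg_congr _ _ rfl (gen_mul_gen τ i j x y)
  · have h0 : τ i j x y = 0 := by rw [hτ.degree_zero i j h]; rfl
    rw [h0, map_zero, add_zero]
    refine of_deg_congr _ _ rfl ?_
    rw [gen_mul_gen, h0, map_zero, add_zero]

/-- The decomposition of the CCR-algebra into its homogeneous parts. -/
def decomp (hτ : IsPoisson τ) : CCRAlg τ →ₐ[K] ⨁ n, deg τ n := lift genDeg (genDeg_rel hτ)

theorem decomp_mono (hτ : IsPoisson τ) (l : List (Σ i, V.X i)) : decomp hτ (mono τ l) =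
    DirectSum.of (fun n => deg τ n) (l.map fun p => p.1).sum ⟨mono τ l, mono_mem l⟩ := by
  induction l with
  | nil => exact map_one (decomp hτ)
  | cons p l ih =>
    refine (congrArg (decomp hτ) (mono_cons p l)).trans ?_
    rw [map_mul, ih, decomp, lift_gen]
    refine (DirectSum.of_mul_of (A := fun n => deg τ n) _ _).trans ?_
    exact of_deg_congr _ _ (by simp) (mono_cons p l).symm

/-- The grading of the CCR-algebra. -/
abbrev gradedAlgebra (hτ : IsPoisson τ) : GradedAlgebra (deg τ) :=
  GradedAlgebra.ofAlgHom (deg τ) (decomp hτ)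
    (by
      apply hom_ext
      intro i x
      rw [AlgHom.comp_apply, decomp, lift_gen, genDeg, LinearMap.comp_apply, DirectSum.lof_eq_of,
        DirectSum.coeAlgHom_of]
      rfl)
    (by
      rintro n ⟨a, ha⟩
      refine Submodule.span_induction (p := fun a ha => decomp hτ a =
        DirectSum.of (fun n => deg τ n) n ⟨a, ha⟩) ?_ ?_ ?_ ?_ ha
      · rintro _ ⟨l, rfl, rfl⟩
        exact decomp_mono hτ l
      · rw [map_zero]
        exact (map_zero (DirectSum.of (fun n => deg τ n) n)).symm
      · intro a b _ _ h1 h2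
        rw [map_add, h1, h2, ← map_add]
        rfl
      · intro c a _ h1
        rw [map_smul, h1, ← DirectSum.lof_eq_of K, ← map_smul]
        rfl)

theorem induction_mono {p : CCRAlg τ → Prop} (hτ : IsPoisson τ) (hm : ∀ l, p (mono τ l))
    (h0 : p 0) (ha : ∀ a b, p a → p b → p (a + b)) (hs : ∀ (c : K) a, p a → p (c • a))
    (a : CCRAlg τ) : p a := by
  let _ := gradedAlgebra hτ
  refine DirectSum.Decomposition.inductionOn (deg τ) h0 ?_ (fun a b => ha a b) a
  rintro n ⟨a, h⟩
  refine Submodule.span_induction (p := fun a _ => p a) ?_ h0 (fun a b _ _ => ha a b)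
    (fun c a _ => hs c a) h
  rintro _ ⟨l, -, rfl⟩
  exact hm l

/-- The matrix `!![(-1)^|v| v, d v; 0, v]` of a generator `v`. -/
def genMat (i : ℤ) : V.X i →ₗ[K] Matrix (Fin 2) (Fin 2) (CCRAlg τ) where
  toFun x := !![(-1 : K) ^ i • gen τ i x, gen τ (i - 1) ((V.d i (i - 1)).hom x); 0, gen τ i x]
  map_add' x y := by
    ext a b
    fin_cases a <;> fin_cases b <;> simp
  map_smul' c x := by
    ext a b
    fin_cases a <;> fin_cases b <;> simp [smul_comm c]

theorem neg_one_zpow_mul_self (i : ℤ) : (-1 : K) ^ i * (-1 : K) ^ i = 1 := by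
  rw [← mul_zpow]; simp

theorem genMat_rel (hτ : IsPoisson τ) (i j : ℤ) (x : V.X i) (y : V.X j) :
    (genMat i x * genMat j y : Matrix (Fin 2) (Fin 2) (CCRAlg τ)) =
      (-1 : K) ^ (i * j) • (genMat j y * genMat i x) + algebraMap K _ (τ i j x y) := by
  have hn : (-1 : K) ≠ 0 := by simp
  have h00 : ((-1 : K) ^ i • gen τ i x) * ((-1 : K) ^ j • gen τ j y) =
      (-1 : K) ^ (i * j) • (((-1 : K) ^ j • gen τ j y) * ((-1 : K) ^ i • gen τ i x)) +
        algebraMap K _ (τ i j x y) := by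
    by_cases h : i + j = 0
    · have h1 : (-1 : K) ^ i * (-1 : K) ^ j = 1 := by rw [← zpow_add₀ hn, h, zpow_zero]
      rw [smul_mul_smul_comm, smul_mul_smul_comm, mul_comm ((-1 : K) ^ j), h1, one_smul, one_smul,
        gen_mul_gen]
    · have h0 : τ i j x y = 0 := by rw [hτ.degree_zero i j h]; rfl
      rw [smul_mul_smul_comm, smul_mul_smul_comm, gen_mul_gen τ i j, h0, map_zero, add_zero,
        add_zero, smul_comm, mul_comm ((-1 : K) ^ j)]
  have h01 : ((-1 : K) ^ i • gen τ i x) * gen τ (j - 1) ((V.d j (j - 1)).hom y) +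
        gen τ (i - 1) ((V.d i (i - 1)).hom x) * gen τ j y =
      (-1 : K) ^ (i * j) •
        (((-1 : K) ^ j • gen τ j y) * gen τ (i - 1) ((V.d i (i - 1)).hom x) +
          gen τ (j - 1) ((V.d j (j - 1)).hom y) * gen τ i x) := by
    have hc := congrArg (algebraMap K (CCRAlg τ)) (hτ.chain_map i j x y)
    rw [map_add, map_mul, map_zero, ← Algebra.smul_def] at hc
    have e1 : (-1 : K) ^ ((i - 1) * j) = (-1 : K) ^ (i * j) * (-1 : K) ^ j := by
      rw [sub_mul, one_mul, zpow_sub₀ hn, div_eq_mul_inv, ← inv_zpow, inv_neg_one]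
    have e2 : (-1 : K) ^ i * (-1 : K) ^ (i * (j - 1)) = (-1 : K) ^ (i * j) := by
      rw [← zpow_add₀ hn]
      congr 1
      ring
    rw [smul_mul_assoc, gen_mul_gen τ i (j - 1), gen_mul_gen τ (i - 1) j, smul_add, smul_smul, e2,
      e1, smul_add, smul_mul_assoc, smul_smul]
    rw [add_add_add_comm, add_comm (_ • algebraMap K _ _), hc, add_zero, add_comm]
  ext a b
  rw [Algebra.algebraMap_eq_smul_one]
  fin_cases a <;> fin_cases b
  · rw [Algebra.algebraMap_eq_smul_one, smul_mul_assoc ((-1 : K) ^ j)] at h00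
    simpa [genMat, Matrix.mul_apply, -Algebra.mul_smul_comm, -Algebra.smul_mul_assoc] using h00
  · simpa [genMat, Matrix.mul_apply] using h01
  · simp [genMat, Matrix.mul_apply]
  · simpa [genMat, Matrix.mul_apply, Algebra.algebraMap_eq_smul_one] using gen_mul_gen τ i j x y

/-- The algebra homomorphism `a ↦ !![(-1)^|a| a, d a; 0, a]` encoding the differential. -/
def dMat (hτ : IsPoisson τ) : CCRAlg τ →ₐ[K] Matrix (Fin 2) (Fin 2) (CCRAlg τ) :=
  lift genMat (genMat_rel hτ)

/-- The differential of the CCR-algebra: the graded derivation that extends the differential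
of `V`. -/
def d (hτ : IsPoisson τ) : CCRAlg τ →ₗ[K] CCRAlg τ where
  toFun a := dMat hτ a 0 1
  map_add' a b := by simp
  map_smul' c a := by simp

theorem dMat_gen (hτ : IsPoisson τ) (i : ℤ) (x : V.X i) :
    dMat hτ (gen τ i x) =
      !![(-1 : K) ^ i • gen τ i x, gen τ (i - 1) ((V.d i (i - 1)).hom x); 0, gen τ i x] :=
  lift_gen _ _ i x

theorem d_gen (hτ : IsPoisson τ) (i : ℤ) (x : V.X i) :
    d hτ (gen τ i x) = gen τ (i - 1) ((V.d i (i - 1)).hom x) := by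
  change dMat hτ _ 0 1 = _
  rw [dMat_gen]
  rfl

theorem dMat_mono (hτ : IsPoisson τ) (l : List (Σ i, V.X i)) :
    dMat hτ (mono τ l) 0 0 = (-1 : K) ^ (l.map fun p => p.1).sum • mono τ l ∧
      dMat hτ (mono τ l) 1 0 = 0 ∧ dMat hτ (mono τ l) 1 1 = mono τ l := by
  induction l with
  | nil =>
    rw [show mono τ ([] : List (Σ i, V.X i)) = 1 from rfl, map_one]
    simp
  | cons p l ih =>
    obtain ⟨h1, h2, h3⟩ := ih
    rw [mono_cons, map_mul, dMat_gen]
    simp [Matrix.mul_apply, h1, h2, h3, zpow_add₀ (show (-1 : K) ≠ 0 by simp), smul_smul, mul_comm]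

theorem dMat_one_one (hτ : IsPoisson τ) (a : CCRAlg τ) : dMat hτ a 1 1 = a := by
  refine induction_mono (p := fun a => dMat hτ a 1 1 = a) hτ (fun l => (dMat_mono hτ l).2.2)
    (by simp) ?_ ?_ a
  · intro a b ha hb
    simp [ha, hb]
  · intro c a ha
    simp [ha]

theorem dMat_zero_zero (hτ : IsPoisson τ) (n : ℤ) (a : CCRAlg τ) (ha : a ∈ deg τ n) :
    dMat hτ a 0 0 = (-1 : K) ^ n • a := by
  refine Submodule.span_induction (p := fun a _ => dMat hτ a 0 0 = (-1 : K) ^ n • a)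
    ?_ (by simp) ?_ ?_ ha
  · rintro _ ⟨l, rfl, rfl⟩
    exact (dMat_mono hτ l).1
  · intro a b _ _ h1 h2
    simp [h1, h2]
  · intro c a _ h1
    simp [h1, smul_comm c]

theorem d_mul (hτ : IsPoisson τ) (n : ℤ) (a b : CCRAlg τ) (ha : a ∈ deg τ n) :
    d hτ (a * b) = d hτ a * b + (-1 : K) ^ n • (a * d hτ b) := by
  change dMat hτ _ 0 1 = dMat hτ a 0 1 * b + (-1 : K) ^ n • (a * dMat hτ b 0 1)
  rw [map_mul, Matrix.mul_apply, Fin.sum_univ_two, dMat_zero_zero hτ n a ha, dMat_one_one,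
    smul_mul_assoc, add_comm]

theorem d_one (hτ : IsPoisson τ) : d hτ 1 = 0 := by
  change dMat hτ 1 0 1 = 0
  rw [map_one]
  rfl

theorem d_mono_mem (hτ : IsPoisson τ) (l : List (Σ i, V.X i)) :
    d hτ (mono τ l) ∈ deg τ ((l.map fun p => p.1).sum - 1) := by
  induction l with
  | nil =>
    rw [show mono τ ([] : List (Σ i, V.X i)) = 1 from rfl, d_one]
    exact Submodule.zero_mem _
  | cons p l ih =>
    rw [mono_cons, d_mul hτ p.1 _ _ (gen_mem _ _), d_gen]
    refine Submodule.add_mem _ ?_ (Submodule.smul_mem _ _ ?_)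
    · have := SetLike.mul_mem_graded (gen_mem (τ := τ) (p.1 - 1) ((V.d p.1 (p.1 - 1)).hom p.2))
        (mono_mem l)
      rwa [show p.1 - 1 + (l.map fun p => p.1).sum = ((p :: l).map fun p => p.1).sum - 1 by
        simp; ring] at this
    · have := SetLike.mul_mem_graded (gen_mem (τ := τ) p.1 p.2) ih
      rwa [show p.1 + ((l.map fun p => p.1).sum - 1) = ((p :: l).map fun p => p.1).sum - 1 by
        simp; ring] at this

theorem d_mem (hτ : IsPoisson τ) (n : ℤ) (a : CCRAlg τ) (ha : a ∈ deg τ n) :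
    d hτ a ∈ deg τ (n - 1) := by
  refine Submodule.span_induction (p := fun a _ => d hτ a ∈ deg τ (n - 1))
    ?_ (by simp) ?_ ?_ ha
  · rintro _ ⟨l, rfl, rfl⟩
    exact d_mono_mem hτ l
  · intro a b _ _ h1 h2
    rw [map_add]
    exact Submodule.add_mem _ h1 h2
  · intro c a _ h1
    rw [map_smul]
    exact Submodule.smul_mem _ _ h1

theorem d_d (hτ : IsPoisson τ) (a : CCRAlg τ) : d hτ (d hτ a) = 0 := by
  refine induction_mono (p := fun a => d hτ (d hτ a) = 0) hτ (fun l => ?_) (by simp) ?_ ?_ a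
  · induction l with
    | nil => rw [show mono τ ([] : List (Σ i, V.X i)) = 1 from rfl, d_one, map_zero]
    | cons p l ih =>
      have h1 := congrArg (fun f => f.hom p.2) (V.d_comp_d p.1 (p.1 - 1) (p.1 - 1 - 1))
      simp only [ModuleCat.hom_comp, LinearMap.comp_apply, ModuleCat.hom_zero,
        LinearMap.zero_apply] at h1
      have h3 : (-1 : K) ^ p.1 = -(-1 : K) ^ (p.1 - 1) := by
        rw [zpow_sub_one₀ (by simp) p.1]; simp
      rw [mono_cons, d_mul hτ p.1 _ _ (gen_mem _ _), d_gen, map_add, map_smul,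
        d_mul hτ (p.1 - 1) _ _ (gen_mem _ _), d_mul hτ p.1 _ _ (gen_mem _ _), d_gen, d_gen, h1, ih,
        h3]
      simp
  · intro a b ha hb
    rw [map_add, map_add, ha, hb, add_zero]
  · intro c a ha
    rw [map_smul, map_smul, ha, smul_zero]

/-- The algebra homomorphism of CCR-algebras induced by a map of generators. -/
def map {W : Ch K} {σ : Pairing W} (f : V ⟶ W)
    (hf : ∀ i j x y, σ i j ((f.f i).hom x) ((f.f j).hom y) = τ i j x y) :
    CCRAlg τ →ₐ[K] CCRAlg σ :=
  lift (fun i => gen σ i ∘ₗ (f.f i).hom) (fun i j x y => by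
    rw [← hf]
    exact gen_mul_gen σ i j _ _)

section map

variable {W : Ch K} {σ : Pairing W} (f : V ⟶ W)
  (hf : ∀ i j x y, σ i j ((f.f i).hom x) ((f.f j).hom y) = τ i j x y)

theorem map_gen (i : ℤ) (x : V.X i) : map f hf (gen τ i x) = gen σ i ((f.f i).hom x) :=
  lift_gen _ _ i x

theorem map_mono (l : List (Σ i, V.X i)) :
    map f hf (mono τ l) = mono σ (l.map fun p => ⟨p.1, (f.f p.1).hom p.2⟩) := by
  induction l with
  | nil => exact map_one _
  | cons p l ih => rw [mono_cons, map_mul, map_gen, ih, List.map_cons, mono_cons]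

theorem map_mem (n : ℤ) (a : CCRAlg τ) (ha : a ∈ deg τ n) : map f hf a ∈ deg σ n := by
  refine Submodule.span_induction (p := fun a _ => map f hf a ∈ deg σ n) ?_ (by simp) ?_ ?_ ha
  · rintro _ ⟨l, rfl, rfl⟩
    rw [map_mono]
    refine Submodule.subset_span ⟨_, ?_, rfl⟩
    rw [List.map_map]
    rfl
  · intro a b _ _ h1 h2
    rw [map_add]
    exact Submodule.add_mem _ h1 h2
  · intro c a _ h1
    rw [map_smul]
    exact Submodule.smul_mem _ _ h1

theorem map_d (hτ : IsPoisson τ) (hσ : IsPoisson σ) (a : CCRAlg τ) :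
    map f hf (d hτ a) = d hσ (map f hf a) := by
  refine induction_mono (p := fun a => map f hf (d hτ a) = d hσ (map f hf a)) hτ (fun l => ?_)
    (by simp) ?_ ?_ a
  · induction l with
    | nil =>
      rw [show mono τ ([] : List (Σ i, V.X i)) = 1 from rfl, d_one, map_zero, map_one, d_one]
    | cons p l ih =>
      have h1 := congrArg (fun f => f.hom p.2) (f.comm p.1 (p.1 - 1))
      simp only [ModuleCat.hom_comp, LinearMap.comp_apply] at h1
      rw [mono_cons, d_mul hτ p.1 _ _ (gen_mem _ _), map_add, map_smul, map_mul, map_mul, map_mul,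
        d_mul hσ p.1 _ _ (map_mem f hf _ _ (gen_mem _ _)), map_gen, d_gen, d_gen, map_gen, ih, h1]
  · intro a b ha hb
    rw [map_add, map_add, ha, hb, map_add, map_add]
  · intro c a ha
    rw [map_smul, map_smul, ha, map_smul, map_smul]

end map

end CCRAlg

end CCR

variable (K) in
/-- The quantization functor `CCR : PoCh ⥤ dgAlg`. -/
def CCR : PoCh K ⥤ DGAlg K where
  obj P :=
    { A := CCRAlg P.τ
      deg := CCRAlg.deg P.τ
      grading := CCRAlg.gradedAlgebra P.isPoisson
      d := CCRAlg.d P.isPoisson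
      d_mem := CCRAlg.d_mem P.isPoisson
      d_d := CCRAlg.d_d P.isPoisson
      leibniz := CCRAlg.d_mul P.isPoisson }
  map {P Q} f :=
    { f := CCRAlg.map f.f f.compat
      map_mem := CCRAlg.map_mem f.f f.compat
      map_d := CCRAlg.map_d f.f f.compat P.isPoisson Q.isPoisson }
  map_id P := by
    apply DGAlg.Hom.ext
    apply CCRAlg.hom_ext
    intro i x
    exact CCRAlg.map_gen (PoCh.Hom.f (𝟙 P)) (PoCh.Hom.compat (𝟙 P)) i x
  map_comp {P Q R} f g := by
    apply DGAlg.Hom.ext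
    apply CCRAlg.hom_ext
    intro i x
    refine (CCRAlg.map_gen (PoCh.Hom.f (f ≫ g)) (PoCh.Hom.compat (f ≫ g)) i x).trans ?_
    refine Eq.symm ((congrArg (CCRAlg.map g.f g.compat) (CCRAlg.map_gen f.f f.compat i x)).trans ?_)
    exact CCRAlg.map_gen g.f g.compat i _

/-! ### Weak equivalences and relative Cauchy evolution -/

/-- Weak equivalences of dg-algebras: quasi-isomorphisms of the underlying chain complexes. -/
def DGAlg.WeakEquiv {A B : DGAlg K} (f : A ⟶ B) : Prop := QuasiIso ((DGAlg.toCh K).map f)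

/-- There is a weak equivalence (objectwise quasi-isomorphism) from `F` to `G` in
`Fun(C, dgAlg)`. -/
def WeakEquivTo (F G : Obj ⥤ DGAlg K) : Prop :=
  ∃ φ : F ⟶ G, ∀ N : Obj, DGAlg.WeakEquiv (φ.app N)

/-- `F` and `G` are connected by a finite zig-zag of weak equivalences in `Fun(C, dgAlg)`. -/
def ZigzagEquiv (F G : Obj ⥤ DGAlg K) : Prop := Relation.EqvGen WeakEquivTo F G

/-- The homotopy time-slice axiom for chain complexes of linear observables: every morphism of `C`
goes to a quasi-isomorphism. -/
def HoTimeSliceCh (X : Obj ⥤ Ch K) : Prop := ∀ ⦃N N' : Obj⦄ (f : N ⟶ N'), QuasiIso (X.map f)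

/-- The homotopy time-slice axiom for theories `C ⥤ dgAlg`. -/
def HoTimeSlice (F : Obj ⥤ DGAlg K) : Prop :=
  ∀ ⦃N N' : Obj⦄ (f : N ⟶ N'), DGAlg.WeakEquiv (F.map f)

/-- The strict time-slice axiom: every morphism of `C` goes to an isomorphism. -/
def StrictTimeSlice (F : Obj ⥤ DGAlg K) : Prop := ∀ ⦃N N' : Obj⦄ (f : N ⟶ N'), IsIso (F.map f)

/-- The relative Cauchy evolution `F(i₋) F(j₋)⁻¹ F(j₊) F(i₊)⁻¹ : F(M) → F(M)` of a theory that
satisfies the strict time-slice axiom. -/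
def relCauchyEvolution (F : Obj ⥤ DGAlg K) (h : StrictTimeSlice F) : Aut (F.obj .M) :=
  have := h iplus
  have := h jplus
  have := h iminus
  have := h jminus
  (asIso (F.map iplus)).symm ≪≫ asIso (F.map jplus) ≪≫
    (asIso (F.map jminus)).symm ≪≫ asIso (F.map iminus)

/-- The linear homotopy AQFT `𝔄 = CCR(𝔏, τ)`. -/
def theory (L : Obj ⥤ PoCh K) : Obj ⥤ DGAlg K := L ⋙ CCR K

/-- The linear observables `𝔏`, without the Poisson structure. -/
abbrev observables (L : Obj ⥤ PoCh K) : Obj ⥤ Ch K := L ⋙ PoCh.forget K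

/-- The Poisson structure `τ_𝕃` on `𝕃L_!(𝔏)`, for given homotopy coherence data. -/
def tauL (L : Obj ⥤ PoCh K) (D : CoherenceData (observables L)) :
    ∀ p : BZ, Pairing ((LL (observables L)).obj p) :=
  fun _ => tauLL D (fun N => (L.obj N).τ)

/-- The theory `CCR(𝕃L_!(𝔏), τ_𝕃)` on `Bℤ`. -/
def localTheory {L : Obj ⥤ PoCh K} {D : CoherenceData (observables L)}
    (h : IsPoissonOn (LL (observables L)) (tauL L D)) : BZ ⥤ DGAlg K :=
  h.toPoCh ⋙ CCR K

/-- The strictified theory `𝔄^st = L^* CCR(𝕃L_!(𝔏), τ_𝕃)`. -/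
def strictTheory {L : Obj ⥤ PoCh K} {D : CoherenceData (observables L)}
    (h : IsPoissonOn (LL (observables L)) (tauL L D)) : Obj ⥤ DGAlg K :=
  locFunctor ⋙ localTheory h

end RCE

end

/-! Existence of coherence data is linear algebra over a field. The mapping cone of a
quasi-isomorphism is acyclic, hence contractible, and the four matrix entries of a contraction are,
up to sign, the quasi-inverse, the two homotopies and the 2-homotopy (`nonempty_quasiInverse`).

The formulas for `τ_𝕃` are the graded antisymmetrization of a simpler pairing `pairLin`
(`tauLLX_eq_skew`). For a vertex `v`, the maps `Z` and `Γ` assemble to a chain map `p_v` from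
`𝕃L_!(𝔏)` to the value of `𝔏` at `v` (`vertProj`). For an edge `a = (n, f)`, the maps `Λ` and `Ξ`
assemble to a homotopy `e_a` between `𝔏(f) p_{sa}` and `p_{ta}` (`edgeProj`). The pairing sends `(v,
x) ⊗ ω` to `τ(x ⊗ p_v ω)` and `(a, x) ⊗ ω` to `τ(𝔏(f) x ⊗ e_a ω)`. It is a chain map because `τ` is
invariant under `𝔏(f)`, and `ℤ`-invariant because zig-zags depend only on relative positions.

Quantization preserves quasi-isomorphisms (`weakEquiv_CCR`). Letting a generator act by
multiplication plus a contraction identifies `CCR(V, τ)` with `CCR(V, 0)`, the free graded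
commutative algebra on `V`, as complexes and naturally in `(V, τ)`. In characteristic `0` this free
algebra respects deformation retracts: the homotopy extends to a derivation whose commutator with
`d` is minus the operator that counts factors in the kernel of the retraction, so a positive count
can be divided by. Mapping cylinders reduce homotopic maps, and then all quasi-isomorphisms, to this
case.

It remains to compare `𝔏` with `L^* 𝕃L_!(𝔏)`. Each inclusion of a vertex is a quasi-isomorphism
(`quasiIso_inVertHom`): `p_v` retracts it, and a cycle can be freed of its edge components by
cutting the spiral at each edge, then moved to the chosen vertex. These inclusions are compatible
with the morphisms of `C` only up to the homotopies given by the edges. So `𝔏` is replaced by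
`resolution`, in which the values at `M` and `M_h` become double mapping cylinders; it maps strictly
and by quasi-isomorphisms to both sides. On it the pullback of `τ` and that of `pairLin` differ by
the boundary of a natural pairing `R` (`pull_comparison`). A further mapping cylinder, with the
pairing corrected by `R`, carries a Poisson structure that restricts to both
(`zigzagEquiv_of_homotopy`). Applying `CCR` to these Poisson quasi-isomorphisms gives the zig-zag of
weak equivalences.

The statement on relative Cauchy evolution is formal: `L` sends three of the four arrows to `0`, so
only the action of `L(i₋) = 1` survives. -/

noncomputable section

namespace RCE

variable {K : Type u} [Field K]

/-! ### Chain complexes, elementwise -/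

section Elementwise

variable {V W : Ch K}

theorem d_d_apply (V : Ch K) (i j k : ℤ) (x : V.X i) :
    (V.d j k).hom ((V.d i j).hom x) = 0 :=
  congrArg (fun f => f.hom x) (V.d_comp_d i j k)

theorem map_d_apply (f : V ⟶ W) (i j : ℤ) (x : V.X i) :
    (f.f j).hom ((V.d i j).hom x) = (W.d i j).hom ((f.f i).hom x) :=
  (congrArg (fun f => f.hom x) (f.comm i j)).symm

theorem comp_f_apply {U : Ch K} (f : U ⟶ V) (g : V ⟶ W) (i : ℤ) (x : U.X i) :
    ((f ≫ g).f i).hom x = (g.f i).hom ((f.f i).hom x) := rfl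

@[simp]
theorem idOfEq_self (V : Ch K) (i : ℤ) : idOfEq V i i = 𝟙 _ := by
  simp [idOfEq]

theorem homotopy_apply {f g : V ⟶ W} (h : Homotopy f g) (i : ℤ) (x : V.X i) :
    (f.f i).hom x = (g.f i).hom x + (W.d (i + 1) i).hom ((h.hom i (i + 1)).hom x) +
      (h.hom (i - 1) i).hom ((V.d i (i - 1)).hom x) := by
  have e := h.comm i
  rw [dNext_eq _ (show (ComplexShape.down ℤ).Rel i (i - 1) by simp),
    prevD_eq _ (show (ComplexShape.down ℤ).Rel (i + 1) i by simp)] at e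
  rw [e]
  simp only [ModuleCat.hom_add, ModuleCat.hom_comp, LinearMap.add_apply, LinearMap.comp_apply]
  abel

theorem d_idOfEq (V : Ch K) {i j : ℤ} (h : i = j) (k : ℤ) (x : V.X i) :
    (V.d j k).hom ((idOfEq V i j).hom x) = (V.d i k).hom x := by
  subst h
  simp

theorem idOfEq_idOfEq (V : Ch K) {i j k : ℤ} (h : i = j) (h' : j = k) (x : V.X i) :
    (idOfEq V j k).hom ((idOfEq V i j).hom x) = (idOfEq V i k).hom x := by
  subst h h'
  simp

/-- A chain homotopy from elementwise data. -/
def mkHomotopy {f g : V ⟶ W} (h : ∀ i j, V.X i ⟶ W.X j)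
    (hz : ∀ i j, i + 1 ≠ j → h i j = 0)
    (hc : ∀ i (x : V.X i), (f.f i).hom x = (g.f i).hom x +
      (W.d (i + 1) i).hom ((h i (i + 1)).hom x) + (h (i - 1) i).hom ((V.d i (i - 1)).hom x)) :
    Homotopy f g where
  hom := h
  zero i j hij := hz i j hij
  comm i := by
    rw [dNext_eq _ (show (ComplexShape.down ℤ).Rel i (i - 1) by simp),
      prevD_eq _ (show (ComplexShape.down ℤ).Rel (i + 1) i by simp)]
    ext x
    rw [hc]
    simp only [ModuleCat.hom_add, ModuleCat.hom_comp, LinearMap.add_apply, LinearMap.comp_apply]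
    abel

/-- A map of short complexes of vector spaces is a quasi-isomorphism if and only if it is bijective
on homology classes, in terms of cycles. -/
theorem shortComplex_quasiIso_iff {S T : ShortComplex (ModuleCat.{u} K)} (φ : S ⟶ T) :
    ShortComplex.QuasiIso φ ↔
      (∀ w : T.X₂, T.g.hom w = 0 → ∃ v : S.X₂, S.g.hom v = 0 ∧
        ∃ w' : T.X₁, w = φ.τ₂.hom v + T.f.hom w') ∧
      (∀ v : S.X₂, S.g.hom v = 0 → ∀ w' : T.X₁, φ.τ₂.hom v = T.f.hom w' →
        ∃ v' : S.X₁, v = S.f.hom v') := by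
  have h12 : ∀ x, φ.τ₂.hom (S.f.hom x) = T.f.hom (φ.τ₁.hom x) := fun x =>
    (congrArg (fun f => f.hom x) φ.comm₁₂).symm
  have h23 : ∀ x, φ.τ₃.hom (S.g.hom x) = T.g.hom (φ.τ₂.hom x) := fun x =>
    (congrArg (fun f => f.hom x) φ.comm₂₃).symm
  let k : LinearMap.ker S.g.hom →ₗ[K] LinearMap.ker T.g.hom :=
    (φ.τ₂.hom ∘ₗ Submodule.subtype _).codRestrict _ (fun x => by
      rw [LinearMap.mem_ker, LinearMap.comp_apply, ← h23, Submodule.subtype_apply, x.2, map_zero])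
  have hk : LinearMap.range S.moduleCatToCycles ≤
      (LinearMap.range T.moduleCatToCycles).comap k := by
    rintro _ ⟨x, rfl⟩
    exact ⟨φ.τ₁.hom x, Subtype.ext (h12 x).symm⟩
  -- With the concrete model of homology as cycles modulo boundaries, the induced map is
  -- `Submodule.mapQ`, and its surjectivity and injectivity are the two clauses.
  let γ : ShortComplex.LeftHomologyMapData φ
      S.moduleCatLeftHomologyData T.moduleCatLeftHomologyData :=
    { φK := ModuleCat.ofHom k
      φH := ModuleCat.ofHom (Submodule.mapQ _ _ k hk)
      commi := rfl
      commf' := by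
        ext x
        exact Subtype.ext (h12 x)
      commπ := rfl }
  rw [γ.quasiIso_iff, ConcreteCategory.isIso_iff_bijective, Function.Bijective, and_comm]
  refine and_congr ?_ ?_
  · change Function.Surjective (Submodule.mapQ _ _ k hk) ↔ _
    constructor
    · intro h w hw
      obtain ⟨x, hx⟩ := h (Submodule.Quotient.mk ⟨w, hw⟩)
      obtain ⟨⟨v, hv⟩, rfl⟩ := Submodule.Quotient.mk_surjective _ x
      rw [Submodule.mapQ_apply, eq_comm, Submodule.Quotient.eq] at hx
      obtain ⟨w', h'⟩ := hx
      refine ⟨v, hv, w', ?_⟩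
      have h2 : T.f.hom w' = w - φ.τ₂.hom v := congrArg Subtype.val h'
      rw [h2]
      abel
    · intro h x
      obtain ⟨⟨w, hw⟩, rfl⟩ := Submodule.Quotient.mk_surjective _ x
      obtain ⟨v, hv, w', rfl⟩ := h w hw
      refine ⟨Submodule.Quotient.mk ⟨v, hv⟩, ?_⟩
      rw [Submodule.mapQ_apply, eq_comm, Submodule.Quotient.eq]
      refine ⟨w', Subtype.ext ?_⟩
      change T.f.hom w' = φ.τ₂.hom v + T.f.hom w' - φ.τ₂.hom v
      abel
  · change Function.Injective (Submodule.mapQ _ _ k hk) ↔ _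
    rw [← LinearMap.ker_eq_bot, LinearMap.ker_eq_bot']
    constructor
    · intro h v hv w' hw
      have := h (Submodule.Quotient.mk ⟨v, hv⟩) (by
        rw [Submodule.mapQ_apply, Submodule.Quotient.mk_eq_zero]
        exact ⟨w', Subtype.ext hw.symm⟩)
      rw [Submodule.Quotient.mk_eq_zero] at this
      obtain ⟨v', h'⟩ := this
      exact ⟨v', (congrArg Subtype.val h').symm⟩
    · intro h x hx
      obtain ⟨⟨v, hv⟩, rfl⟩ := Submodule.Quotient.mk_surjective _ x
      rw [Submodule.mapQ_apply, Submodule.Quotient.mk_eq_zero] at hx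
      obtain ⟨w', h'⟩ := hx
      obtain ⟨v', rfl⟩ := h v hv w' (congrArg Subtype.val h').symm
      rw [Submodule.Quotient.mk_eq_zero]
      exact ⟨v', rfl⟩

/-- A chain map is a quasi-isomorphism if and only if it is bijective on homology classes, in terms
of cycles. -/
theorem quasiIso_iff_elements (f : V ⟶ W) :
    QuasiIso f ↔ ∀ i : ℤ,
      (∀ w : W.X i, (W.d i (i - 1)).hom w = 0 → ∃ v : V.X i, (V.d i (i - 1)).hom v = 0 ∧
        ∃ w' : W.X (i + 1), w = (f.f i).hom v + (W.d (i + 1) i).hom w') ∧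
      (∀ v : V.X i, (V.d i (i - 1)).hom v = 0 → ∀ w' : W.X (i + 1),
        (f.f i).hom v = (W.d (i + 1) i).hom w' → ∃ v' : V.X (i + 1),
          v = (V.d (i + 1) i).hom v') := by
  rw [quasiIso_iff]
  refine forall_congr' fun i => ?_
  rw [quasiIsoAt_iff' f (i + 1) i (i - 1) (by simp) (by simp), shortComplex_quasiIso_iff]
  rfl

theorem exists_cycle_of_quasiIso {f : V ⟶ W} (hf : QuasiIso f) {i j k : ℤ} (hij : j + 1 = i)
    (hjk : k + 1 = j) (w : W.X j) (hw : (W.d j k).hom w = 0) :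
    ∃ v : V.X j, (V.d j k).hom v = 0 ∧ ∃ w' : W.X i, w = (f.f j).hom v + (W.d i j).hom w' := by
  subst hij
  obtain rfl : k = j - 1 := by omega
  exact ((quasiIso_iff_elements f).1 hf j).1 w hw

theorem exists_boundary_of_quasiIso {f : V ⟶ W} (hf : QuasiIso f) {i j k : ℤ} (hij : j + 1 = i)
    (hjk : k + 1 = j) (v : V.X j) (hv : (V.d j k).hom v = 0) (w' : W.X i)
    (hw : (f.f j).hom v = (W.d i j).hom w') : ∃ v' : V.X i, v = (V.d i j).hom v' := by
  subst hij
  obtain rfl : k = j - 1 := by omega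
  exact ((quasiIso_iff_elements f).1 hf j).2 v hv w' hw

end Elementwise

/-! ### Mapping cones and homotopy coherence data -/

section Cone

variable {V W : Ch K} (f : V ⟶ W)

/-- The differential `(v, w) ↦ (-dv, dw + f v)` of the mapping cone. -/
def coneD (i j : ℤ) : V.X (i - 1) × W.X i →ₗ[K] V.X (j - 1) × W.X j :=
  LinearMap.prod (-((V.d (i - 1) (j - 1)).hom ∘ₗ LinearMap.fst K _ _))
    ((W.d i j).hom ∘ₗ LinearMap.snd K _ _ +
      (f.f j).hom ∘ₗ (idOfEq V (i - 1) j).hom ∘ₗ LinearMap.fst K _ _)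

/-- The mapping cone of a chain map. -/
def cone : Ch K where
  X i := ModuleCat.of K (V.X (i - 1) × W.X i)
  d i j := ModuleCat.ofHom (coneD f i j)
  shape i j h := by
    have h0 : j + 1 ≠ i := h
    have h1 : V.d (i - 1) (j - 1) = 0 := V.shape _ _ (fun h' => h0 (by simp at h'; omega))
    have h2 : W.d i j = 0 := W.shape _ _ h
    have h3 : ¬ (i - 1 = j) := by omega
    rw [show coneD f i j = 0 by ext <;> simp [coneD, h1, h2, idOfEq, h3]]
    rfl
  d_comp_d' i j k hij hjk := by
    obtain rfl : j = i - 1 := by simp at hij; omega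
    obtain rfl : k = i - 1 - 1 := by simp at hjk; omega
    rw [← ModuleCat.ofHom_comp]
    rw [show coneD f (i - 1) (i - 1 - 1) ∘ₗ coneD f i (i - 1) = 0 by
      ext x <;> simp [coneD, d_d_apply, map_d_apply]]
    rfl

/-- The inclusion `V_j → cone(f)_i`, for `j = i - 1`. -/
def coneInl (j i : ℤ) : V.X j →ₗ[K] (cone f).X i :=
  LinearMap.inl K (V.X (i - 1)) (W.X i) ∘ₗ (idOfEq V j (i - 1)).hom

/-- The inclusion `W_i → cone(f)_i`. -/
def coneInr (i : ℤ) : W.X i →ₗ[K] (cone f).X i := LinearMap.inr K (V.X (i - 1)) (W.X i)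

/-- The projection `cone(f)_i → V_j`, for `j = i - 1`. -/
def coneFst (i j : ℤ) : (cone f).X i →ₗ[K] V.X j :=
  (idOfEq V (i - 1) j).hom ∘ₗ LinearMap.fst K (V.X (i - 1)) (W.X i)

/-- The projection `cone(f)_i → W_i`. -/
def coneSnd (i : ℤ) : (cone f).X i →ₗ[K] W.X i := LinearMap.snd K (V.X (i - 1)) (W.X i)

variable {f}

theorem coneFst_coneInl {i j : ℤ} (h : j + 1 = i) (v : V.X j) :
    coneFst f i j (coneInl f j i v) = v := by
  obtain rfl : j = i - 1 := by omega
  simp only [coneFst, coneInl, idOfEq_self]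
  rfl

theorem coneSnd_coneInl (i j : ℤ) (v : V.X j) : coneSnd f i (coneInl f j i v) = 0 := rfl

theorem coneFst_coneInr (i j : ℤ) (w : W.X i) : coneFst f i j (coneInr f i w) = 0 :=
  map_zero (idOfEq V (i - 1) j).hom

theorem coneSnd_coneInr (i : ℤ) (w : W.X i) : coneSnd f i (coneInr f i w) = w := rfl

theorem cone_ext {i : ℤ} (j : ℤ) (h : j + 1 = i) {x y : (cone f).X i}
    (h1 : coneFst f i j x = coneFst f i j y) (h2 : coneSnd f i x = coneSnd f i y) : x = y := by
  obtain rfl : j = i - 1 := by omega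
  simp only [coneFst, idOfEq_self] at h1
  exact Prod.ext h1 h2

theorem coneFst_d {i j k : ℤ} (hi : j + 1 = i) (hj : k + 1 = j)
    (x : (cone f).X i) :
    coneFst f j k (((cone f).d i j).hom x) = -(V.d j k).hom (coneFst f i j x) := by
  obtain rfl : j = i - 1 := by omega
  obtain rfl : k = i - 1 - 1 := by omega
  simp only [coneFst, idOfEq_self]
  rfl

theorem coneSnd_d {i j : ℤ} (x : (cone f).X i) :
    coneSnd f j (((cone f).d i j).hom x) =
      (W.d i j).hom (coneSnd f i x) + (f.f j).hom (coneFst f i j x) := rfl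

theorem cone_d_coneInr (i j : ℤ) (w : W.X i) :
    ((cone f).d i j).hom (coneInr f i w) = coneInr f j ((W.d i j).hom w) := by
  change coneD f i j (0, w) = _
  simp [coneD, coneInr]
  rfl

theorem cone_d_coneInl {i j k : ℤ} (hi : j + 1 = i) (hj : k + 1 = j) (v : V.X j) :
    ((cone f).d i j).hom (coneInl f j i v) =
      coneInr f j ((f.f j).hom v) - coneInl f k j ((V.d j k).hom v) := by
  refine cone_ext k hj ?_ ?_
  · rw [coneFst_d hi hj, coneFst_coneInl hi, map_sub, coneFst_coneInr,
      coneFst_coneInl hj, zero_sub]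
  · rw [coneSnd_d, coneSnd_coneInl, map_zero, coneFst_coneInl hi, map_sub, coneSnd_coneInl,
      coneSnd_coneInr, sub_zero, zero_add]

end Cone

/-- A linear map over a field has a section over its range. -/
theorem exists_linear_section {A B : Type u} [AddCommGroup A] [Module K A] [AddCommGroup B]
    [Module K B] (f : A →ₗ[K] B) : ∃ s : B →ₗ[K] A, ∀ b ∈ LinearMap.range f, f (s b) = b := by
  obtain ⟨g, hg⟩ := f.rangeRestrict.exists_rightInverse_of_surjective f.range_rangeRestrict
  obtain ⟨g', hg'⟩ := LinearMap.exists_extend g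
  refine ⟨g', fun b hb => ?_⟩
  have h1 : g' b = g ⟨b, hb⟩ := congrArg (fun φ => φ ⟨b, hb⟩) hg'
  rw [h1]
  exact congrArg Subtype.val (congrArg (fun φ => φ ⟨b, hb⟩) hg)

/-- An acyclic complex over a field is contractible. -/
theorem exists_contraction (C : Ch K) (hC : ∀ i (x : C.X i), (C.d i (i - 1)).hom x = 0 →
    ∃ y : C.X (i + 1), (C.d (i + 1) i).hom y = x) :
    ∃ h : ∀ i j : ℤ, C.X i →ₗ[K] C.X j, (∀ i j, i + 1 ≠ j → h i j = 0) ∧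
      ∀ i (x : C.X i), (C.d (i + 1) i).hom (h i (i + 1) x) +
        h (i - 1) i ((C.d i (i - 1)).hom x) = x := by
  have : ∀ i j : ℤ, ∃ s : C.X i →ₗ[K] C.X j, (i + 1 = j → ∀ x ∈ LinearMap.range (C.d j i).hom,
      (C.d j i).hom (s x) = x) ∧ (i + 1 ≠ j → s = 0) := by
    intro i j
    by_cases h : i + 1 = j
    · obtain ⟨s, hs⟩ := exists_linear_section (C.d j i).hom
      exact ⟨s, fun _ => hs, fun h' => absurd h h'⟩
    · exact ⟨0, fun h' => absurd h' h, fun _ => rfl⟩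
  choose s hs hs0 using this
  -- For sections `s` of `d` over its image, `h = s (1 - s d)` works: `x - s d x` is a cycle, hence
  -- a boundary, so `d h x = x - s d x`, while `h d x = s d x`.
  refine ⟨fun i j => s i j ∘ₗ (LinearMap.id - s (i - 1) i ∘ₗ (C.d i (i - 1)).hom), ?_, ?_⟩
  · intro i j h
    simp only [hs0 i j h, LinearMap.zero_comp]
  · intro i x
    have h1 : (C.d i (i - 1)).hom (s (i - 1) i ((C.d i (i - 1)).hom x)) =
        (C.d i (i - 1)).hom x := hs (i - 1) i (by omega) _ ⟨x, rfl⟩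
    have h2 : (C.d (i + 1) i).hom (s i (i + 1) (x - s (i - 1) i ((C.d i (i - 1)).hom x))) =
        x - s (i - 1) i ((C.d i (i - 1)).hom x) := by
      refine hs i (i + 1) rfl _ ?_
      obtain ⟨y, hy⟩ := hC i (x - s (i - 1) i ((C.d i (i - 1)).hom x)) (by
        rw [map_sub, h1, sub_self])
      exact ⟨y, hy⟩
    simp only [LinearMap.comp_apply, LinearMap.sub_apply, LinearMap.id_apply, h2, d_d_apply,
      map_zero, sub_zero]
    abel

/-- A cycle `(v, w)` satisfies `dv = 0` and `f v = -dw`. Injectivity on homology gives `v = d v₁`,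
and then `w + f v₁` is a cycle, equal to `f v₂ + d w₂` by surjectivity. A primitive is `(v₂ - v₁,
w₂)`. -/
theorem cone_acyclic {V W : Ch K} {f : V ⟶ W} (hf : QuasiIso f) (i : ℤ) (x : (cone f).X i)
    (hx : ((cone f).d i (i - 1)).hom x = 0) :
    ∃ y : (cone f).X (i + 1), ((cone f).d (i + 1) i).hom y = x := by
  have hj : i - 1 + 1 = i := by omega
  have hk : i - 1 - 1 + 1 = i - 1 := by omega
  have hv : (V.d (i - 1) (i - 1 - 1)).hom (coneFst f i (i - 1) x) = 0 := by
    rw [← neg_eq_zero, ← coneFst_d hj hk, hx, map_zero]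
  have hw : (W.d i (i - 1)).hom (coneSnd f i x) + (f.f (i - 1)).hom (coneFst f i (i - 1) x) = 0 := by
    rw [← coneSnd_d, hx, map_zero]
  obtain ⟨v₁, h₁⟩ := exists_boundary_of_quasiIso hf hj hk _ hv (-coneSnd f i x)
    (by rw [map_neg, eq_neg_iff_add_eq_zero, add_comm, hw])
  rw [h₁, map_d_apply, ← map_add] at hw
  obtain ⟨v₂, hv₂, w₂, h₂⟩ := exists_cycle_of_quasiIso hf rfl hj _ hw
  refine ⟨coneInl f i (i + 1) (v₂ - v₁) + coneInr f (i + 1) w₂, ?_⟩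
  rw [map_add, cone_d_coneInl rfl hj, cone_d_coneInr]
  refine cone_ext (i - 1) hj ?_ ?_
  · rw [map_add, map_sub, coneFst_coneInr, coneFst_coneInr, coneFst_coneInl hj, map_sub, hv₂, h₁]
    abel
  · rw [map_add, map_sub, coneSnd_coneInr, coneSnd_coneInr, coneSnd_coneInl, map_sub]
    have e : coneSnd f i x = (f.f i).hom v₂ + (W.d (i + 1) i).hom w₂ - (f.f i).hom v₁ := by
      rw [← h₂, add_sub_cancel_right]
    rw [e]
    abel

/-- A contraction `h` of the cone is a two by two matrix, and so is the identity `dh + hd = 1`. The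
entry of `h` from `W` to `V` is the quasi-inverse, the diagonal entries are `-lam` on `W` and `gam`
on `V`, and the entry from `V` to `W` is `-xi`. The four entries of the identity (`hWV`, `hWW`,
`hVV`, `hVW`) are exactly the chain map property and the three coherence equations. -/
theorem nonempty_quasiInverse {V W : Ch K} (f : V ⟶ W) (hf : QuasiIso f) :
    Nonempty (QuasiInverse f) := by
  obtain ⟨h, hz, hc⟩ := exists_contraction (cone f) (cone_acyclic hf)
  have hc' : ∀ {i j k : ℤ} (_ : j + 1 = i) (_ : k + 1 = j) (x : (cone f).X j),
      ((cone f).d i j).hom (h j i x) + h k j (((cone f).d j k).hom x) = x := by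
    intro i j k hi hk x
    subst hi
    obtain rfl : k = j - 1 := by omega
    exact hc j x
  have e0 : ∀ i : ℤ, i - 1 + 1 = i := fun i => by omega
  -- the components of the identity `dh + hd = 1`
  have hWV : ∀ i (w : W.X i), (V.d i (i - 1)).hom (coneFst f (i + 1) i (h i (i + 1)
      (coneInr f i w))) = coneFst f i (i - 1) (h (i - 1) i (coneInr f (i - 1)
        ((W.d i (i - 1)).hom w))) := by
    intro i w
    have := congrArg (coneFst f i (i - 1)) (hc' rfl (e0 i) (coneInr f i w))
    rw [map_add, coneFst_d rfl (e0 i), cone_d_coneInr, coneFst_coneInr] at this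
    exact neg_add_eq_zero.mp this
  have hWW : ∀ i (w : W.X i), (W.d (i + 1) i).hom (coneSnd f (i + 1) (h i (i + 1)
      (coneInr f i w))) + (f.f i).hom (coneFst f (i + 1) i (h i (i + 1) (coneInr f i w))) +
        coneSnd f i (h (i - 1) i (coneInr f (i - 1) ((W.d i (i - 1)).hom w))) = w := by
    intro i w
    have := congrArg (coneSnd f i) (hc' rfl (e0 i) (coneInr f i w))
    rwa [map_add, coneSnd_d, cone_d_coneInr, coneSnd_coneInr] at this
  have hVV : ∀ i (v : V.X i), -(V.d (i + 1) i).hom (coneFst f (i + 1 + 1) (i + 1)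
      (h (i + 1) (i + 1 + 1) (coneInl f i (i + 1) v))) + (coneFst f (i + 1) i (h i (i + 1)
        (coneInr f i ((f.f i).hom v))) - coneFst f (i + 1) i (h i (i + 1)
          (coneInl f (i - 1) i ((V.d i (i - 1)).hom v)))) = v := by
    intro i v
    have := congrArg (coneFst f (i + 1) i) (hc' rfl rfl (coneInl f i (i + 1) v))
    rwa [map_add, coneFst_d rfl rfl, cone_d_coneInl rfl (e0 i), map_sub, map_sub,
      coneFst_coneInl rfl] at this
  have hVW : ∀ i (v : V.X i), (W.d (i + 1 + 1) (i + 1)).hom (coneSnd f (i + 1 + 1)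
      (h (i + 1) (i + 1 + 1) (coneInl f i (i + 1) v))) + (f.f (i + 1)).hom
        (coneFst f (i + 1 + 1) (i + 1) (h (i + 1) (i + 1 + 1) (coneInl f i (i + 1) v))) +
          (coneSnd f (i + 1) (h i (i + 1) (coneInr f i ((f.f i).hom v))) -
            coneSnd f (i + 1) (h i (i + 1) (coneInl f (i - 1) i ((V.d i (i - 1)).hom v)))) =
              0 := by
    intro i v
    have := congrArg (coneSnd f (i + 1)) (hc' rfl rfl (coneInl f i (i + 1) v))
    rwa [map_add, coneSnd_d, cone_d_coneInl rfl (e0 i), map_sub, map_sub,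
      coneSnd_coneInl] at this
  let inv : W ⟶ V :=
    { f := fun i => ModuleCat.ofHom (coneFst f (i + 1) i ∘ₗ h i (i + 1) ∘ₗ coneInr f i)
      comm' := by
        intro i j hij
        obtain rfl : j = i - 1 := by simp at hij; omega
        ext w
        change (V.d i (i - 1)).hom (coneFst f (i + 1) i (h i (i + 1) (coneInr f i w))) =
          coneFst f (i - 1 + 1) (i - 1) (h (i - 1) (i - 1 + 1) (coneInr f (i - 1)
            ((W.d i (i - 1)).hom w)))
        rw [hWV, e0] }
  let lam : Homotopy (inv ≫ f) (𝟙 W) := mkHomotopy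
    (fun i j => ModuleCat.ofHom (-(coneSnd f j ∘ₗ h i j ∘ₗ coneInr f i)))
    (fun i j hij => by simp only [hz i j hij, LinearMap.zero_comp, LinearMap.comp_zero, neg_zero]
                       rfl)
    (fun i w => by
      change (f.f i).hom (coneFst f (i + 1) i (h i (i + 1) (coneInr f i w))) =
        w + (W.d (i + 1) i).hom (-coneSnd f (i + 1) (h i (i + 1) (coneInr f i w))) +
          -coneSnd f i (h (i - 1) i (coneInr f (i - 1) ((W.d i (i - 1)).hom w)))
      conv_rhs => enter [1, 1]; rw [← hWW i w]
      rw [map_neg]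
      abel)
  let gam : Homotopy (f ≫ inv) (𝟙 V) := mkHomotopy
    (fun i j => ModuleCat.ofHom (coneFst f (j + 1) j ∘ₗ h (i + 1) (j + 1) ∘ₗ coneInl f i (i + 1)))
    (fun i j hij => by
      simp only [hz (i + 1) (j + 1) (by omega), LinearMap.zero_comp, LinearMap.comp_zero]
      rfl)
    (fun i v => by
      change coneFst f (i + 1) i (h i (i + 1) (coneInr f i ((f.f i).hom v))) =
        v + (V.d (i + 1) i).hom (coneFst f (i + 1 + 1) (i + 1)
          (h (i + 1) (i + 1 + 1) (coneInl f i (i + 1) v))) +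
          coneFst f (i + 1) i (h (i - 1 + 1) (i + 1)
            (coneInl f (i - 1) (i - 1 + 1) ((V.d i (i - 1)).hom v)))
      conv_rhs => enter [1, 1]; rw [← hVV i v]
      rw [e0]
      abel)
  refine ⟨⟨inv, lam, gam, fun i j => ModuleCat.ofHom
    (-(coneSnd f j ∘ₗ h (i + 1) j ∘ₗ coneInl f i (i + 1))), ?_, ?_⟩⟩
  · intro i j hij
    simp only [hz (i + 1) j (by omega), LinearMap.zero_comp, LinearMap.comp_zero, neg_zero]
    rfl
  · intro i
    ext v
    change (f.f (i + 1)).hom (coneFst f (i + 1 + 1) (i + 1)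
          (h (i + 1) (i + 1 + 1) (coneInl f i (i + 1) v))) -
        -coneSnd f (i + 1) (h i (i + 1) (coneInr f i ((f.f i).hom v))) =
      (W.d (i + 2) (i + 1)).hom (-coneSnd f (i + 2) (h (i + 1) (i + 2) (coneInl f i (i + 1) v))) -
        -coneSnd f (i + 1) (h (i - 1 + 1) (i + 1)
          (coneInl f (i - 1) (i - 1 + 1) ((V.d i (i - 1)).hom v)))
    have := hVW i v
    rw [show i + 2 = i + 1 + 1 by omega, e0, map_neg, ← sub_eq_zero, ← this]
    abel

theorem nonempty_coherenceData {X : Obj ⥤ Ch K} (hX : HoTimeSliceCh X) :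
    Nonempty (CoherenceData X) :=
  ⟨fun f => (nonempty_quasiInverse _ (hX f.hom)).some⟩

/-! ### Graded derivations of CCR-algebras -/

namespace CCRAlg

variable {V : Ch K} {τ : Pairing V}

theorem induction_gen {p : CCRAlg τ → Prop} (hτ : IsPoisson τ) (h1 : p 1)
    (hg : ∀ i x a, p a → p (gen τ i x * a)) (h0 : p 0) (ha : ∀ a b, p a → p b → p (a + b))
    (hs : ∀ (c : K) a, p a → p (c • a)) (a : CCRAlg τ) : p a := by
  refine induction_mono hτ (fun l => ?_) h0 ha hs a
  induction l with
  | nil => exact h1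
  | cons q l ih =>
    rw [mono_cons]
    exact hg _ _ _ ih

theorem linearMap_ext_gen (hτ : IsPoisson τ) {M : Type*} [AddCommGroup M] [Module K M]
    {f g : CCRAlg τ →ₗ[K] M} (h1 : f 1 = g 1)
    (hg : ∀ i x a, f a = g a → f (gen τ i x * a) = g (gen τ i x * a)) : f = g := by
  ext a
  refine induction_gen (p := fun a => f a = g a) hτ h1 hg (by simp) ?_ ?_ a
  · intro a b h h'
    rw [map_add, map_add, h, h']
  · intro c a h
    rw [map_smul, map_smul, h]

/-- A linear map that raises the degree of left multiplications by generators consistently is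
homogeneous. -/
theorem map_deg_of_gen {W : Ch K} {σ : Pairing W} (k : ℤ) (f : CCRAlg τ →ₗ[K] CCRAlg σ)
    (h1 : f 1 ∈ deg σ k)
    (hg : ∀ i x n a, a ∈ deg τ n → f a ∈ deg σ (n + k) → f (gen τ i x * a) ∈ deg σ (i + n + k))
    (n : ℤ) (a : CCRAlg τ) (ha : a ∈ deg τ n) : f a ∈ deg σ (n + k) := by
  refine Submodule.span_induction (p := fun a _ => f a ∈ deg σ (n + k)) ?_ (by simp) ?_ ?_ ha
  · rintro _ ⟨l, rfl, rfl⟩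
    clear ha
    induction l with
    | nil => simpa [mono] using h1
    | cons q l ih =>
      rw [mono_cons, List.map_cons, List.sum_cons]
      exact hg _ _ _ _ (mono_mem l) ih
  · intro a b _ _ h h'
    rw [map_add]
    exact Submodule.add_mem _ h h'
  · intro c a _ h
    rw [map_smul]
    exact Submodule.smul_mem _ _ h

section Derivation

variable (τ) in
/-- The matrix `!![(-1)^(k|v|) v, θ v; 0, v]` of a generator `v`. -/
def derMat (k : ℤ) (θ : ∀ i, V.X i →ₗ[K] CCRAlg τ) (i : ℤ) :
    V.X i →ₗ[K] Matrix (Fin 2) (Fin 2) (CCRAlg τ) where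
  toFun x := !![(-1 : K) ^ (k * i) • gen τ i x, θ i x; 0, gen τ i x]
  map_add' x y := by
    ext a b
    fin_cases a <;> fin_cases b <;> simp
  map_smul' c x := by
    ext a b
    fin_cases a <;> fin_cases b <;> simp [smul_comm c]

variable (τ) in
/-- The values `θ` on generators are those of a graded derivation of degree `k`. -/
def DerCompat (k : ℤ) (θ : ∀ i, V.X i →ₗ[K] CCRAlg τ) : Prop :=
  ∀ (i j : ℤ) (x : V.X i) (y : V.X j),
    (-1 : K) ^ (k * i) • (gen τ i x * θ j y) + θ i x * gen τ j y =
      (-1 : K) ^ (i * j) • ((-1 : K) ^ (k * j) • (gen τ j y * θ i x) + θ j y * gen τ i x)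

variable (hτ : IsPoisson τ) (k : ℤ) {θ : ∀ i, V.X i →ₗ[K] CCRAlg τ} (hθ : DerCompat τ k θ)
include hτ hθ

/-- The upper right entry of the relation is `DerCompat`; the scalar `τ(x, y)` enters only on the
diagonal. There the sign `(-1)^(k(i+j))` is harmless, since it is `1` when `i + j = 0` and `τ`
vanishes otherwise. -/
theorem derMat_rel (i j : ℤ) (x : V.X i) (y : V.X j) :
    (derMat τ k θ i x * derMat τ k θ j y : Matrix (Fin 2) (Fin 2) (CCRAlg τ)) =
      (-1 : K) ^ (i * j) • (derMat τ k θ j y * derMat τ k θ i x) +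
        algebraMap K _ (τ i j x y) := by
  have h00 : ((-1 : K) ^ (k * i) • gen τ i x) * ((-1 : K) ^ (k * j) • gen τ j y) =
      (-1 : K) ^ (i * j) • (((-1 : K) ^ (k * j) • gen τ j y) * ((-1 : K) ^ (k * i) • gen τ i x)) +
        algebraMap K _ (τ i j x y) := by
    by_cases h : i + j = 0
    · have h1 : (-1 : K) ^ (k * i) * (-1 : K) ^ (k * j) = 1 := by
        rw [← zpow_add₀ (by simp), ← mul_add, h, mul_zero, zpow_zero]
      rw [smul_mul_smul_comm, smul_mul_smul_comm, mul_comm ((-1 : K) ^ (k * j)), h1, one_smul,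
        one_smul, gen_mul_gen]
    · have h0 : τ i j x y = 0 := by rw [hτ.degree_zero i j h]; rfl
      rw [smul_mul_smul_comm, smul_mul_smul_comm, gen_mul_gen τ i j, h0, map_zero, add_zero,
        add_zero, smul_comm, mul_comm ((-1 : K) ^ (k * j))]
  ext a b
  rw [Algebra.algebraMap_eq_smul_one]
  fin_cases a <;> fin_cases b
  · rw [Algebra.algebraMap_eq_smul_one, smul_mul_assoc ((-1 : K) ^ (k * j))] at h00
    simpa [derMat, Matrix.mul_apply, -Algebra.mul_smul_comm, -Algebra.smul_mul_assoc] using h00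
  · simpa [derMat, Matrix.mul_apply] using hθ i j x y
  · simp [derMat, Matrix.mul_apply]
  · simpa [derMat, Matrix.mul_apply, Algebra.algebraMap_eq_smul_one] using gen_mul_gen τ i j x y

/-- A graded derivation is the upper right entry of an algebra homomorphism into upper triangular
matrices, and such homomorphisms are obtained from the universal property of the CCR-algebra. The
Leibniz rule is recorded only for left multiplication by generators, which determines the map and
suffices for all inductions below. -/
theorem exists_derivation : ∃ D : CCRAlg τ →ₗ[K] CCRAlg τ, D 1 = 0 ∧
    ∀ i x a, D (gen τ i x * a) = θ i x * a + (-1 : K) ^ (k * i) • (gen τ i x * D a) := by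
  let M : CCRAlg τ →ₐ[K] Matrix (Fin 2) (Fin 2) (CCRAlg τ) := lift _ (derMat_rel hτ k hθ)
  have hM : ∀ i x, M (gen τ i x) = !![(-1 : K) ^ (k * i) • gen τ i x, θ i x; 0, gen τ i x] :=
    fun i x => lift_gen _ (derMat_rel hτ k hθ) i x
  have h11 : ∀ a, M a 1 0 = 0 ∧ M a 1 1 = a := by
    refine induction_gen hτ (by simp) ?_ (by simp) ?_ ?_
    · rintro i x a ⟨h1, h2⟩
      rw [map_mul, hM]
      simp [Matrix.mul_apply, h1, h2]
    · rintro a b ⟨h1, h2⟩ ⟨h1', h2'⟩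
      simp [h1, h2, h1', h2']
    · rintro c a ⟨h1, h2⟩
      simp [h1, h2]
  refine ⟨{ toFun := fun a => M a 0 1, map_add' := by simp, map_smul' := by simp }, ?_, ?_⟩
  · change M 1 0 1 = 0
    rw [map_one]
    rfl
  · intro i x a
    change M _ 0 1 = _ * _ + _ • (_ * M a 0 1)
    rw [map_mul, hM]
    simp [Matrix.mul_apply, (h11 a).2, add_comm]

/-- The graded derivation of degree `k` with prescribed values on generators. -/
def der : CCRAlg τ →ₗ[K] CCRAlg τ := (exists_derivation hτ k hθ).choose

theorem der_one : der hτ k hθ 1 = 0 := (exists_derivation hτ k hθ).choose_spec.1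

theorem der_gen_mul (i : ℤ) (x : V.X i) (a : CCRAlg τ) : der hτ k hθ (gen τ i x * a) =
    θ i x * a + (-1 : K) ^ (k * i) • (gen τ i x * der hτ k hθ a) :=
  (exists_derivation hτ k hθ).choose_spec.2 i x a

theorem der_mem (hθ' : ∀ i x, θ i x ∈ deg τ (i + k)) (n : ℤ) (a : CCRAlg τ) (ha : a ∈ deg τ n) :
    der hτ k hθ a ∈ deg τ (n + k) := by
  refine map_deg_of_gen k _ ?_ ?_ n a ha
  · rw [der_one]
    exact Submodule.zero_mem _
  · intro i x n a ha h
    rw [der_gen_mul]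
    refine Submodule.add_mem _ ?_ (Submodule.smul_mem _ _ ?_)
    · rw [show i + n + k = i + k + n by ring]
      exact SetLike.mul_mem_graded (hθ' i x) ha
    · rw [add_assoc]
      exact SetLike.mul_mem_graded (gen_mem i x) h

end Derivation

/-! ### Changing the Poisson structure of a CCR-algebra -/

/-- `(-1)^m` only depends on the parity of `m`. -/
theorem neg_one_zpow_congr {m n : ℤ} (h : Even (m - n)) : (-1 : K) ^ m = (-1 : K) ^ n := by
  rw [← sub_add_cancel m n, zpow_add₀ (by simp), h.neg_one_zpow, one_mul]

section Contraction

variable {κ : Pairing V} (hτ : IsPoisson τ) (hκ : IsPoisson κ)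

/-- The values `κ(x, y)` are scalars, hence central, so only signs have to agree; they do because
`κ` is nonzero only in total degree `0`. -/
theorem contr_compat {κ : Pairing V} (hκ : IsPoisson κ) (i : ℤ) (x : V.X i) :
    DerCompat τ i (fun j => (Algebra.linearMap K (CCRAlg τ)) ∘ₗ κ i j x) := by
  intro j l y z
  change (-1 : K) ^ (i * j) • (gen τ j y * algebraMap K _ (κ i l x z)) +
    algebraMap K _ (κ i j x y) * gen τ l z = (-1 : K) ^ (j * l) • ((-1 : K) ^ (i * l) •
      (gen τ l z * algebraMap K _ (κ i j x y)) + algebraMap K _ (κ i l x z) * gen τ j y)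
  rw [← Algebra.commutes (κ i l x z), ← Algebra.commutes (κ i j x y), ← Algebra.smul_def,
    ← Algebra.smul_def, smul_add, smul_smul, smul_smul, smul_smul, smul_smul]
  have e1 : (-1 : K) ^ (i * j) * κ i l x z = (-1 : K) ^ (j * l) * κ i l x z := by
    by_cases h : i + l = 0
    · obtain rfl : l = -i := by omega
      rw [neg_one_zpow_congr (show Even (i * j - j * -i) from ⟨i * j, by ring⟩)]
    · simp [hκ.degree_zero i l h]
  have e2 : κ i j x y = (-1 : K) ^ (j * l) * ((-1 : K) ^ (i * l) * κ i j x y) := by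
    by_cases h : i + j = 0
    · rw [← mul_assoc, ← zpow_add₀ (by simp), ← add_mul, add_comm j i, h, zero_mul, zpow_zero,
        one_mul]
    · simp [hκ.degree_zero i j h]
  rw [e1, mul_assoc, ← e2, add_comm]

/-- The graded derivation of the CCR-algebra given by `y ↦ κ(x, y)` on generators. -/
def contr (i : ℤ) : V.X i →ₗ[K] CCRAlg τ →ₗ[K] CCRAlg τ where
  toFun x := der hτ i (contr_compat hκ i x)
  map_add' x y := by
    refine linearMap_ext_gen hτ ?_ ?_
    · simp [der_one]
    · intro j z a h
      rw [der_gen_mul, h]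
      simp only [LinearMap.add_apply, der_gen_mul, LinearMap.comp_apply, map_add, add_mul, mul_add,
        smul_add]
      abel
  map_smul' c x := by
    refine linearMap_ext_gen hτ ?_ ?_
    · simp [der_one]
    · intro j z a h
      rw [der_gen_mul, h]
      simp only [LinearMap.smul_apply, der_gen_mul, LinearMap.comp_apply, map_smul, smul_mul_assoc,
        mul_smul_comm, smul_add, RingHom.id_apply, smul_comm c]

theorem contr_one (i : ℤ) (x : V.X i) : contr hτ hκ i x 1 = 0 :=
  der_one hτ i (contr_compat hκ i x)

theorem contr_gen_mul (i : ℤ) (x : V.X i) (j : ℤ) (y : V.X j) (a : CCRAlg τ) :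
    contr hτ hκ i x (gen τ j y * a) =
      κ i j x y • a + (-1 : K) ^ (i * j) • (gen τ j y * contr hτ hκ i x a) := by
  refine (der_gen_mul hτ i (contr_compat hκ i x) j y a).trans ?_
  rw [Algebra.smul_def]
  rfl

theorem contr_mem (i : ℤ) (x : V.X i) (n : ℤ) (a : CCRAlg τ) (ha : a ∈ deg τ n) :
    contr hτ hκ i x a ∈ deg τ (n + i) := by
  refine der_mem hτ i (contr_compat hκ i x) (fun j y => ?_) n a ha
  change algebraMap K _ (κ i j x y) ∈ _
  by_cases h : i + j = 0
  · rw [add_comm j i, h]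
    exact SetLike.algebraMap_mem_graded _ _
  · rw [hκ.degree_zero i j h, LinearMap.zero_apply, LinearMap.zero_apply, map_zero]
    exact Submodule.zero_mem _

/-- Signs in front of a pairing have to be compared only when the degrees of its arguments add up to
zero. -/
theorem pairing_smul_sign (hκ : IsPoisson κ) {i j : ℤ} (x : V.X i) (y : V.X j) {m n : ℤ}
    (h : i + j = 0 → Even (m - n)) :
    (-1 : K) ^ m * κ i j x y = (-1 : K) ^ n * κ i j x y := by
  by_cases h0 : i + j = 0
  · rw [neg_one_zpow_congr (h h0)]
  · simp [hκ.degree_zero i j h0]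

/-- The graded commutator of the two contractions is a derivation that vanishes on generators, as
each contraction sends a generator to a scalar and kills scalars. -/
theorem contr_contr (i j : ℤ) (x : V.X i) (y : V.X j) (a : CCRAlg τ) :
    contr hτ hκ i x (contr hτ hκ j y a) =
      (-1 : K) ^ (i * j) • contr hτ hκ j y (contr hτ hκ i x a) := by
  refine induction_gen (p := fun a => contr hτ hκ i x (contr hτ hκ j y a) =
      (-1 : K) ^ (i * j) • contr hτ hκ j y (contr hτ hκ i x a)) hτ ?_ ?_ (by simp) ?_ ?_ a
  · simp [contr_one]
  · intro l z a h
    have e1 : (-1 : K) ^ (j * l) * κ i l x z = (-1 : K) ^ (i * j) * κ i l x z :=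
      pairing_smul_sign hκ x z (fun h => ⟨j * l, by
        obtain rfl : i = -l := by omega
        ring⟩)
    have e2 : κ j l y z = (-1 : K) ^ (i * j) * ((-1 : K) ^ (i * l) * κ j l y z) := by
      rw [← mul_assoc, ← zpow_add₀ (by simp), pairing_smul_sign hκ y z (n := 0), zpow_zero, one_mul]
      intro h
      obtain rfl : j = -l := by omega
      exact ⟨0, by ring⟩
    simp only [contr_gen_mul, map_add, map_smul, smul_add, smul_smul, h, mul_smul_comm]
    rw [e1, ← e2]
    module
  · intro a b h h'
    simp only [map_add, h, h', smul_add]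
  · intro c a h
    simp only [map_smul, h]
    rw [smul_comm]

/-- This is the graded commutator formula `[d, κ(x, -)] = κ(dx, -)`; on generators it is the chain
map property of `κ`. -/
theorem d_contr (i : ℤ) (x : V.X i) (a : CCRAlg τ) :
    d hτ (contr hτ hκ i x a) = contr hτ hκ (i - 1) ((V.d i (i - 1)).hom x) a +
      (-1 : K) ^ i • contr hτ hκ i x (d hτ a) := by
  refine induction_gen (p := fun a => d hτ (contr hτ hκ i x a) =
    contr hτ hκ (i - 1) ((V.d i (i - 1)).hom x) a + (-1 : K) ^ i • contr hτ hκ i x (d hτ a)) hτ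
    ?_ ?_ (by simp) ?_ ?_ a
  · simp [contr_one, d_one]
  · intro l z a h
    have e1 : κ (i - 1) l ((V.d i (i - 1)).hom x) z =
        -((-1 : K) ^ i * κ i (l - 1) x ((V.d l (l - 1)).hom z)) :=
      eq_neg_of_add_eq_zero_left (hκ.chain_map i l x z)
    have e2 : (-1 : K) ^ i * ((-1 : K) ^ l * κ i l x z) = κ i l x z := by
      rw [← mul_assoc, ← zpow_add₀ (by simp), pairing_smul_sign hκ x z (n := 0), zpow_zero, one_mul]
      intro h
      exact ⟨0, by omega⟩
    have e3 : (-1 : K) ^ i * (-1 : K) ^ (i * (l - 1)) = (-1 : K) ^ (i * l) := by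
      rw [← zpow_add₀ (by simp)]
      congr 1
      ring
    have e4 : (-1 : K) ^ ((i - 1) * l) = (-1 : K) ^ (i * l) * (-1 : K) ^ l := by
      rw [← zpow_add₀ (by simp)]
      exact neg_one_zpow_congr ⟨-l, by ring⟩
    simp only [contr_gen_mul, d_mul hτ l _ _ (gen_mem _ _), d_gen, map_add, map_smul, h, smul_add,
      mul_add, mul_smul_comm, smul_smul, e1, e4, neg_smul]
    rw [e2, e3]
    module
  · intro a b h h'
    simp only [map_add, h, h', smul_add]
    abel
  · intro c a h
    simp only [map_smul, h, smul_add]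
    rw [smul_comm c]

variable {σ : Pairing V} (hσ : IsPoisson σ)

/-- In the graded commutator of `x + κ(x, -)` and `y + κ(y, -)` the two products give `σ(x, y)`, the
mixed terms give `κ(x, y) - (-1)^(ij) κ(y, x) = 2 κ(x, y)` by antisymmetry, and the contractions
commute. This is where the factor `2` comes from. -/
theorem comparison_rel (hk : ∀ i j x y, τ i j x y = σ i j x y + 2 * κ i j x y) (i j : ℤ)
    (x : V.X i) (y : V.X j) :
    (((LinearMap.mul K _ ∘ₗ gen σ i + contr hσ hκ i) x) *
      ((LinearMap.mul K _ ∘ₗ gen σ j + contr hσ hκ j) y) : Module.End K (CCRAlg σ)) =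
      (-1 : K) ^ (i * j) • (((LinearMap.mul K _ ∘ₗ gen σ j + contr hσ hκ j) y) *
        ((LinearMap.mul K _ ∘ₗ gen σ i + contr hσ hκ i) x)) +
          algebraMap K (Module.End K (CCRAlg σ)) (τ i j x y) := by
  ext a
  have e1 : (-1 : K) ^ (i * j) * (-1 : K) ^ (i * j) = 1 := neg_one_zpow_mul_self _
  have e2 : gen σ i x * (gen σ j y * a) = (-1 : K) ^ (i * j) • (gen σ j y * (gen σ i x * a)) +
      σ i j x y • a := by
    rw [← mul_assoc, gen_mul_gen, add_mul, smul_mul_assoc, mul_assoc, ← Algebra.smul_def]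
  have e3 : κ i j x y = -((-1 : K) ^ (i * j) * κ j i y x) := hκ.antisymm i j x y
  have e4 : (-1 : K) ^ (j * i) = (-1 : K) ^ (i * j) := by rw [mul_comm]
  simp only [Module.End.mul_apply, LinearMap.add_apply, LinearMap.comp_apply, LinearMap.mul_apply',
    LinearMap.smul_apply, Module.algebraMap_end_apply, map_add, contr_gen_mul, hk,
    contr_contr hσ hκ i j, e2]
  rw [e4]
  have e5 : (-1 : K) ^ (i * j) * κ j i y x = - κ i j x y := by rw [e3, neg_neg]
  simp only [smul_add, smul_smul, e1, e5]
  module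

/-- The comparison of the CCR-algebras of the Poisson structures `σ + 2 κ` and `σ`, by letting a
generator `x` act on `CCR(V, σ)` by left multiplication plus the derivation `κ(x, -)`. -/
def comparison (hk : ∀ i j x y, τ i j x y = σ i j x y + 2 * κ i j x y) :
    CCRAlg τ →ₗ[K] CCRAlg σ :=
  LinearMap.applyₗ (1 : CCRAlg σ) ∘ₗ (lift _ (comparison_rel hκ hσ hk)).toLinearMap

variable (hk : ∀ i j x y, τ i j x y = σ i j x y + 2 * κ i j x y)

theorem comparison_one : comparison hκ hσ hk 1 = 1 := by
  change lift _ (comparison_rel hκ hσ hk) 1 1 = 1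
  rw [map_one (lift _ (comparison_rel hκ hσ hk))]
  rfl

theorem comparison_gen_mul (i : ℤ) (x : V.X i) (a : CCRAlg τ) :
    comparison hκ hσ hk (gen τ i x * a) =
      gen σ i x * comparison hκ hσ hk a + contr hσ hκ i x (comparison hκ hσ hk a) := by
  change lift _ (comparison_rel hκ hσ hk) (gen τ i x * a) 1 = _
  rw [map_mul, lift_gen]
  rfl

/-- Contractions do not see the change of Poisson structure. This makes the comparison maps for `κ`
and `-κ` mutually inverse. -/
theorem comparison_contr (i : ℤ) (x : V.X i) (a : CCRAlg τ) :
    comparison hκ hσ hk (contr hτ hκ i x a) = contr hσ hκ i x (comparison hκ hσ hk a) := by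
  refine induction_gen (p := fun a => comparison hκ hσ hk (contr hτ hκ i x a) =
    contr hσ hκ i x (comparison hκ hσ hk a)) hτ ?_ ?_ (by simp) ?_ ?_ a
  · rw [contr_one, comparison_one, contr_one, map_zero]
  · intro l z a h
    rw [contr_gen_mul, comparison_gen_mul, map_add, map_smul, map_smul, comparison_gen_mul, h,
      map_add, contr_gen_mul, contr_contr hσ hκ i l]
    module
  · intro a b h h'
    simp only [map_add, h, h']
  · intro c a h
    simp only [map_smul, h]

theorem comparison_d (a : CCRAlg τ) :
    comparison hκ hσ hk (d hτ a) = d hσ (comparison hκ hσ hk a) := by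
  refine induction_gen (p := fun a => comparison hκ hσ hk (d hτ a) =
    d hσ (comparison hκ hσ hk a)) hτ ?_ ?_ (by simp) ?_ ?_ a
  · rw [comparison_one, d_one, d_one, map_zero]
  · intro l z a h
    rw [d_mul hτ l _ _ (gen_mem _ _), d_gen, map_add, map_smul, comparison_gen_mul,
      comparison_gen_mul, comparison_gen_mul, map_add, d_mul hσ l _ _ (gen_mem _ _), d_gen, d_contr,
      h]
    module
  · intro a b h h'
    simp only [map_add, h, h']
  · intro c a h
    simp only [map_smul, h]

theorem comparison_mem (n : ℤ) (a : CCRAlg τ) (ha : a ∈ deg τ n) :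
    comparison hκ hσ hk a ∈ deg σ n := by
  have := map_deg_of_gen 0 (comparison hκ hσ hk) (by
    rw [comparison_one]
    exact SetLike.GradedOne.one_mem) (fun i x n a ha h => ?_) n a ha
  · rwa [add_zero] at this
  · rw [add_zero] at h ⊢
    rw [comparison_gen_mul]
    refine Submodule.add_mem _ (SetLike.mul_mem_graded (gen_mem i x) h) ?_
    rw [add_comm]
    exact contr_mem _ _ _ _ _ _ h

/-- The inner map adds `κ(x, -)` to multiplication by `x`, the outer one adds `κ'(x, -) = -κ(x, -)`,
and `comparison_contr` lets the two corrections meet and cancel. -/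
theorem comparison_comparison {κ' : Pairing V} (hκ' : IsPoisson κ')
    (hk' : ∀ i j x y, σ i j x y = τ i j x y + 2 * κ' i j x y)
    (hkk : ∀ i j x y, κ' i j x y = -κ i j x y) (a : CCRAlg τ) :
    comparison hκ' hτ hk' (comparison hκ hσ hk a) = a := by
  have hc : ∀ i x a, contr hτ hκ' i x a = -contr hτ hκ i x a := by
    intro i x a
    have : contr hτ hκ' i x = -contr hτ hκ i x := by
      refine linearMap_ext_gen hτ (by simp [contr_one]) ?_
      intro j y a h
      rw [LinearMap.neg_apply, contr_gen_mul, contr_gen_mul, h, hkk, LinearMap.neg_apply]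
      simp only [mul_neg]
      module
    rw [this, LinearMap.neg_apply]
  have hcc : ∀ i x a, comparison hκ' hτ hk' (contr hσ hκ i x a) =
      contr hτ hκ i x (comparison hκ' hτ hk' a) := by
    intro i x a
    have hc' : contr hσ hκ i x a = -contr hσ hκ' i x a := by
      have : contr hσ hκ i x = -contr hσ hκ' i x := by
        refine linearMap_ext_gen hσ (by simp [contr_one]) ?_
        intro j y a h
        rw [LinearMap.neg_apply, contr_gen_mul, contr_gen_mul, h, hkk, LinearMap.neg_apply]
        simp only [mul_neg]
        module
      rw [this, LinearMap.neg_apply]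
    rw [hc', map_neg, comparison_contr hσ hκ' hτ hk', hc, neg_neg]
  refine induction_gen (p := fun a => comparison hκ' hτ hk' (comparison hκ hσ hk a) = a) hτ ?_ ?_
    (by simp) ?_ ?_ a
  · rw [comparison_one, comparison_one]
  · intro i x a h
    rw [comparison_gen_mul, map_add, comparison_gen_mul, hcc, hc, h]
    abel
  · intro a b h h'
    simp only [map_add, h, h']
  · intro c a h
    simp only [map_smul, h]

end Contraction

theorem map_contr {W : Ch K} {σ κ' : Pairing W} {κ : Pairing V} (hτ : IsPoisson τ)
    (hκ : IsPoisson κ) (hσ : IsPoisson σ) (hκ' : IsPoisson κ') (f : V ⟶ W)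
    (hf : ∀ i j x y, σ i j ((f.f i).hom x) ((f.f j).hom y) = τ i j x y)
    (hf' : ∀ i j x y, κ' i j ((f.f i).hom x) ((f.f j).hom y) = κ i j x y) (i : ℤ) (x : V.X i)
    (a : CCRAlg τ) :
    map f hf (contr hτ hκ i x a) = contr hσ hκ' i ((f.f i).hom x) (map f hf a) := by
  refine induction_gen (p := fun a => map f hf (contr hτ hκ i x a) =
    contr hσ hκ' i ((f.f i).hom x) (map f hf a)) hτ ?_ ?_ (by simp) ?_ ?_ a
  · rw [contr_one, map_one, contr_one, map_zero]
  · intro l z a h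
    rw [contr_gen_mul, map_add, map_smul, map_smul, map_mul, map_mul, map_gen, h, contr_gen_mul,
      hf']
  · intro a b h h'
    simp only [map_add, h, h']
  · intro c a h
    simp only [map_smul, h]

/-- Naturality turns the comparison into an isomorphism of arrows, so that being a quasi-isomorphism
can be tested for the Poisson structure `σ`. -/
theorem map_comparison {W : Ch K} {τ' σ' κ' : Pairing W} {σ κ : Pairing V} (hτ : IsPoisson τ)
    (hκ : IsPoisson κ) (hσ : IsPoisson σ) (hκ' : IsPoisson κ') (hσ' : IsPoisson σ')
    (hk : ∀ i j x y, τ i j x y = σ i j x y + 2 * κ i j x y)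
    (hk' : ∀ i j x y, τ' i j x y = σ' i j x y + 2 * κ' i j x y) (f : V ⟶ W)
    (hf : ∀ i j x y, τ' i j ((f.f i).hom x) ((f.f j).hom y) = τ i j x y)
    (hfσ : ∀ i j x y, σ' i j ((f.f i).hom x) ((f.f j).hom y) = σ i j x y)
    (hfκ : ∀ i j x y, κ' i j ((f.f i).hom x) ((f.f j).hom y) = κ i j x y)
    (a : CCRAlg τ) :
    map f hfσ (comparison hκ hσ hk a) = comparison hκ' hσ' hk' (map f hf a) := by
  refine induction_gen (p := fun a => map f hfσ (comparison hκ hσ hk a) =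
    comparison hκ' hσ' hk' (map f hf a)) hτ ?_ ?_ (by simp) ?_ ?_ a
  · rw [comparison_one, map_one, map_one, comparison_one]
  · intro l z a h
    rw [comparison_gen_mul, map_add, map_mul, map_mul, map_gen, map_gen, h, comparison_gen_mul,
      map_contr hσ hκ hσ' hκ' f hfσ hfκ, h]
  · intro a b h h'
    simp only [map_add, h, h']
  · intro c a h
    simp only [map_smul, h]

end CCRAlg

/-! ### Chain maps between dg-algebras -/

/-- The chain map given by a degree preserving linear map that commutes with the differentials. -/
def DGAlg.chainMap (A B : DGAlg K) (f : A.A →ₗ[K] B.A) (hf : ∀ n a, a ∈ A.deg n → f a ∈ B.deg n)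
    (hd : ∀ a, f (A.d a) = B.d (f a)) : (DGAlg.toCh K).obj A ⟶ (DGAlg.toCh K).obj B where
  f n := ModuleCat.ofHom ((f ∘ₗ (A.deg n).subtype).codRestrict (B.deg n) (fun a => hf n a a.2))
  comm' i j hij := by
    ext a
    refine Subtype.ext ?_
    exact (B.dHom_coe hij _).trans ((hd _).symm.trans (congrArg f (A.dHom_coe hij a).symm))

variable (K) in
/-- The zero pairing is a Poisson structure. -/
theorem isPoisson_zero (V : Ch K) : IsPoisson (0 : Pairing V) where
  degree_zero _ _ _ := rfl
  antisymm _ _ _ _ := by simp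
  chain_map _ _ _ _ := by simp

/-- The comparison of CCR-algebras as an isomorphism of chain complexes. -/
def comparisonIso {V : Ch K} {τ σ κ : Pairing V} (hτ : IsPoisson τ) (hσ : IsPoisson σ)
    (hκ : IsPoisson κ) (hκ' : IsPoisson (-κ))
    (hk : ∀ i j x y, τ i j x y = σ i j x y + 2 * κ i j x y) :
    (DGAlg.toCh K).obj ((CCR K).obj ⟨V, τ, hτ⟩) ≅ (DGAlg.toCh K).obj ((CCR K).obj ⟨V, σ, hσ⟩) where
  hom := DGAlg.chainMap _ _ (CCRAlg.comparison hκ hσ hk) (CCRAlg.comparison_mem hκ hσ hk)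
    (CCRAlg.comparison_d hτ hκ hσ hk)
  inv := DGAlg.chainMap ((CCR K).obj ⟨V, σ, hσ⟩) ((CCR K).obj ⟨V, τ, hτ⟩)
    (CCRAlg.comparison hκ' hτ (fun i j x y => by rw [hk]; simp))
    (CCRAlg.comparison_mem _ _ _) (CCRAlg.comparison_d hσ _ _ _)
  hom_inv_id := by
    ext n a
    exact Subtype.ext (CCRAlg.comparison_comparison hτ hκ hσ hk hκ'
      (fun i j x y => by rw [hk]; simp) (fun _ _ _ _ => rfl) _)
  inv_hom_id := by
    ext n a
    exact Subtype.ext (CCRAlg.comparison_comparison hσ hκ' hτ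
      (fun i j x y => by rw [hk]; simp) hκ hk (fun _ _ _ _ => (neg_neg _).symm) _)

/-- The category embedding of chain complexes as Poisson chain complexes with zero Poisson
structure. -/
def zeroPoisson : Ch K ⥤ PoCh K where
  obj V := ⟨V, 0, isPoisson_zero K V⟩
  map f := ⟨f, fun _ _ _ _ => rfl⟩

/-- The functor that sends a chain complex to its free graded commutative algebra, as a chain
complex. -/
def symFunctor : Ch K ⥤ Ch K := zeroPoisson ⋙ CCR K ⋙ DGAlg.toCh K

theorem IsPoisson.const_smul {V : Ch K} {τ : Pairing V} (hτ : IsPoisson τ) (c : K) :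
    IsPoisson (c • τ) where
  degree_zero i j h := by
    change c • τ i j = 0
    rw [hτ.degree_zero i j h, smul_zero]
  antisymm i j x y := by
    change c * τ i j x y = -(_ * (c * τ j i y x))
    rw [hτ.antisymm i j x y]
    ring
  chain_map i j x y := by
    change c * τ (i - 1) j _ y + _ * (c * τ i (j - 1) x _) = 0
    linear_combination c * hτ.chain_map i j x y

theorem IsPoisson.neg {V : Ch K} {τ : Pairing V} (hτ : IsPoisson τ) : IsPoisson (-τ) where
  degree_zero i j h := by
    change -τ i j = 0
    rw [hτ.degree_zero i j h]
    exact neg_zero (G := V.X i →ₗ[K] V.X j →ₗ[K] K)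
  antisymm i j x y := by
    change -τ i j x y = -(_ * -τ j i y x)
    rw [hτ.antisymm i j x y]
    ring
  chain_map i j x y := by
    change -τ (i - 1) j _ y + _ * -τ i (j - 1) x _ = 0
    linear_combination -hτ.chain_map i j x y

/-- The comparison with `σ = 0` and `κ = τ / 2` removes the Poisson structure. It is not
multiplicative, but quasi-isomorphisms only concern the underlying complexes. -/
theorem quasiIso_CCR_iff [CharZero K] {P Q : PoCh K} (f : P ⟶ Q) :
    DGAlg.WeakEquiv ((CCR K).map f) ↔ QuasiIso (symFunctor.map (PoCh.Hom.f f)) := by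
  have hk : ∀ (P : PoCh K) i j (x : P.V.X i) (y : P.V.X j),
      P.τ i j x y = (0 : Pairing P.V) i j x y + 2 * (((2 : K)⁻¹ • P.τ) i j x y) := by
    intro P i j x y
    change P.τ i j x y = 0 + 2 * ((2 : K)⁻¹ * P.τ i j x y)
    rw [zero_add, mul_inv_cancel_left₀ two_ne_zero]
  have hn : ∀ P : PoCh K, IsPoisson (-((2 : K)⁻¹ • P.τ)) := fun P =>
    (P.isPoisson.const_smul _).neg
  refine quasiIso_iff_of_arrow_mk_iso _ _ (Arrow.isoMk
    (comparisonIso P.isPoisson (isPoisson_zero K P.V) (P.isPoisson.const_smul _) (hn P) (hk P))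
    (comparisonIso Q.isPoisson (isPoisson_zero K Q.V) (Q.isPoisson.const_smul _) (hn Q) (hk Q)) ?_)
  ext n a
  refine Subtype.ext (CCRAlg.map_comparison P.isPoisson (P.isPoisson.const_smul _)
    (isPoisson_zero K P.V) (Q.isPoisson.const_smul _) (isPoisson_zero K Q.V) (hk P) (hk Q)
    (PoCh.Hom.f f) (PoCh.Hom.compat f) (fun _ _ _ _ => rfl) (fun i j x y => ?_) _)
  change (2 : K)⁻¹ * _ = (2 : K)⁻¹ * _
  rw [PoCh.Hom.compat f]

/-! ### Products and mapping cylinders -/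

section Prod

variable (A B : Ch K)

/-- The product of two chain complexes. -/
def prodCh : Ch K where
  X i := ModuleCat.of K (A.X i × B.X i)
  d i j := ModuleCat.ofHom (LinearMap.prodMap (A.d i j).hom (B.d i j).hom)
  shape i j h := by
    rw [A.shape i j h, B.shape i j h]
    ext <;> rfl
  d_comp_d' i j k _ _ := ModuleCat.hom_ext (LinearMap.ext fun x =>
    Prod.ext (d_d_apply A i j k x.1) (d_d_apply B i j k x.2))

/-- The inclusion of the first factor. -/
def prodInl : A ⟶ prodCh A B where
  f i := ModuleCat.ofHom (LinearMap.inl K (A.X i) (B.X i))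
  comm' i j _ := by
    ext x
    exact Prod.ext rfl (map_zero (B.d i j).hom)

/-- The inclusion of the second factor. -/
def prodInr : B ⟶ prodCh A B where
  f i := ModuleCat.ofHom (LinearMap.inr K (A.X i) (B.X i))
  comm' i j _ := by
    ext x
    exact Prod.ext (map_zero (A.d i j).hom) rfl

variable {A B}

/-- The map into a product given by its components. -/
def prodLift {W : Ch K} (f : W ⟶ A) (g : W ⟶ B) : W ⟶ prodCh A B where
  f i := ModuleCat.ofHom (LinearMap.prod (f.f i).hom (g.f i).hom)
  comm' i j _ := by
    ext x
    exact Prod.ext (map_d_apply f i j x).symm (map_d_apply g i j x).symm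

/-- The map out of a product given by its components. -/
def prodDesc {W : Ch K} (f : A ⟶ W) (g : B ⟶ W) : prodCh A B ⟶ W where
  f i := ModuleCat.ofHom (LinearMap.coprod (f.f i).hom (g.f i).hom)
  comm' i j _ := by
    refine ModuleCat.hom_ext (LinearMap.ext fun x => ?_)
    change (W.d i j).hom ((f.f i).hom x.1 + (g.f i).hom x.2) =
      (f.f j).hom ((A.d i j).hom x.1) + (g.f j).hom ((B.d i j).hom x.2)
    rw [map_add, map_d_apply, map_d_apply]

end Prod

section Cylinder

variable {A B : Ch K} (f : A ⟶ B)

/-- The mapping cylinder of `f : A ⟶ B`. Its elements are triples `(a, b, e)` in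
`A_i × B_i × A_{i-1}`, and `d (a, b, e) = (da + e, db - f e, -de)`. -/
def cyl : Ch K := cone (prodLift (𝟙 A) (-f))

/-- The component in `A_i`. -/
def cylA (i : ℤ) : (cyl f).X i →ₗ[K] A.X i := LinearMap.fst K (A.X i) (B.X i) ∘ₗ coneSnd _ i

/-- The component in `B_i`. -/
def cylB (i : ℤ) : (cyl f).X i →ₗ[K] B.X i := LinearMap.snd K (A.X i) (B.X i) ∘ₗ coneSnd _ i

/-- The component in `A_j`, for `j = i - 1`. -/
def cylE (i j : ℤ) : (cyl f).X i →ₗ[K] A.X j := coneFst _ i j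

/-- The inclusion of `A_i`. -/
def cylInA (i : ℤ) : A.X i →ₗ[K] (cyl f).X i := coneInr _ i ∘ₗ LinearMap.inl K (A.X i) (B.X i)

/-- The inclusion of `B_i`. -/
def cylInB (i : ℤ) : B.X i →ₗ[K] (cyl f).X i := coneInr _ i ∘ₗ LinearMap.inr K (A.X i) (B.X i)

/-- The inclusion of `A_j`, for `j = i - 1`, as the edges of the cylinder. -/
def cylInE (j i : ℤ) : A.X j →ₗ[K] (cyl f).X i := coneInl _ j i

variable {f}

theorem cyl_ext {i : ℤ} (j : ℤ) (h : j + 1 = i) {x y : (cyl f).X i}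
    (hA : cylA f i x = cylA f i y) (hB : cylB f i x = cylB f i y)
    (hE : cylE f i j x = cylE f i j y) : x = y :=
  cone_ext j h hE (Prod.ext hA hB)

@[simp] theorem cylA_inA (i : ℤ) (a : A.X i) : cylA f i (cylInA f i a) = a := rfl
@[simp] theorem cylB_inA (i : ℤ) (a : A.X i) : cylB f i (cylInA f i a) = 0 := rfl
@[simp] theorem cylE_inA (i j : ℤ) (a : A.X i) : cylE f i j (cylInA f i a) = 0 :=
  coneFst_coneInr i j _
@[simp] theorem cylA_inB (i : ℤ) (b : B.X i) : cylA f i (cylInB f i b) = 0 := rfl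
@[simp] theorem cylB_inB (i : ℤ) (b : B.X i) : cylB f i (cylInB f i b) = b := rfl
@[simp] theorem cylE_inB (i j : ℤ) (b : B.X i) : cylE f i j (cylInB f i b) = 0 :=
  coneFst_coneInr i j _
@[simp] theorem cylA_inE (i j : ℤ) (e : A.X j) : cylA f i (cylInE f j i e) = 0 := rfl
@[simp] theorem cylB_inE (i j : ℤ) (e : A.X j) : cylB f i (cylInE f j i e) = 0 := rfl
theorem cylE_inE {i j : ℤ} (h : j + 1 = i) (e : A.X j) : cylE f i j (cylInE f j i e) = e :=
  coneFst_coneInl h e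

theorem cylInE_eq_zero {i j : ℤ} (h : i + 1 ≠ j) : cylInE f i j = 0 := by
  have h' : ¬ (i = j - 1) := by omega
  rw [cylInE, coneInl, idOfEq, dif_neg h']
  exact LinearMap.comp_zero _

theorem cylA_d {i j : ℤ} (x : (cyl f).X i) :
    cylA f j (((cyl f).d i j).hom x) = (A.d i j).hom (cylA f i x) + cylE f i j x := rfl

theorem cylB_d {i j : ℤ} (x : (cyl f).X i) :
    cylB f j (((cyl f).d i j).hom x) =
      (B.d i j).hom (cylB f i x) - (f.f j).hom (cylE f i j x) :=
  (sub_eq_add_neg _ _).symm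

theorem cylE_d {i j k : ℤ} (hi : j + 1 = i) (hj : k + 1 = j) (x : (cyl f).X i) :
    cylE f j k (((cyl f).d i j).hom x) = -(A.d j k).hom (cylE f i j x) :=
  coneFst_d hi hj x

theorem cyl_decomp {i j : ℤ} (h : j + 1 = i) (x : (cyl f).X i) :
    x = cylInA f i (cylA f i x) + cylInB f i (cylB f i x) + cylInE f j i (cylE f i j x) := by
  refine cyl_ext j h ?_ ?_ ?_ <;> simp [cylE_inE h]

/-- The inclusion of the source of the mapping cylinder. -/
def cylιA (f : A ⟶ B) : A ⟶ cyl f where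
  f i := ModuleCat.ofHom (cylInA f i)
  comm' i j hij := by
    ext x
    change ((cyl f).d i j).hom (cylInA f i x) = cylInA f j ((A.d i j).hom x)
    refine cyl_ext (j - 1) (by omega) ?_ ?_ ?_
    · rw [cylA_d]; simp
    · rw [cylB_d]; simp
    · rw [cylE_d hij (by omega)]; simp

/-- The inclusion of the target of the mapping cylinder. -/
def cylιB (f : A ⟶ B) : B ⟶ cyl f where
  f i := ModuleCat.ofHom (cylInB f i)
  comm' i j hij := by
    ext x
    change ((cyl f).d i j).hom (cylInB f i x) = cylInB f j ((B.d i j).hom x)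
    refine cyl_ext (j - 1) (by omega) ?_ ?_ ?_
    · rw [cylA_d]; simp
    · rw [cylB_d]; simp
    · rw [cylE_d hij (by omega)]; simp

/-- The map `(a, b, e) ↦ α a + β b + s e` out of the mapping cylinder, for a chain homotopy
`α - β f = ds + sd`. -/
def cylDesc {W : Ch K} (α : A ⟶ W) (β : B ⟶ W) (s : ∀ i j, A.X i →ₗ[K] W.X j)
    (hs : ∀ i (a : A.X i), (α.f i).hom a - (β.f i).hom ((f.f i).hom a) =
      (W.d (i + 1) i).hom (s i (i + 1) a) + s (i - 1) i ((A.d i (i - 1)).hom a)) :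
    cyl f ⟶ W where
  f i := ModuleCat.ofHom ((α.f i).hom ∘ₗ cylA f i + (β.f i).hom ∘ₗ cylB f i +
    s (i - 1) i ∘ₗ cylE f i (i - 1))
  comm' i j hij := by
    obtain rfl : i = j + 1 := hij.symm
    ext x
    change (W.d (j + 1) j).hom ((α.f (j + 1)).hom (cylA f (j + 1) x) +
      (β.f (j + 1)).hom (cylB f (j + 1) x) +
        s (j + 1 - 1) (j + 1) (cylE f (j + 1) (j + 1 - 1) x)) =
      (α.f j).hom (cylA f j (((cyl f).d (j + 1) j).hom x)) +
        (β.f j).hom (cylB f j (((cyl f).d (j + 1) j).hom x)) +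
          s (j - 1) j (cylE f j (j - 1) (((cyl f).d (j + 1) j).hom x))
    rw [cylA_d, cylB_d, cylE_d rfl (sub_add_cancel j 1), show j + 1 - 1 = j by omega]
    simp only [map_add, map_sub, map_neg, map_d_apply]
    rw [← add_right_inj (-(β.f j).hom ((f.f j).hom (cylE f (j + 1) j x))),
      show (W.d (j + 1) j).hom (s j (j + 1) (cylE f (j + 1) j x)) = _ from
        eq_sub_of_add_eq (hs j (cylE f (j + 1) j x)).symm]
    abel

theorem cylDesc_apply {W : Ch K} (α : A ⟶ W) (β : B ⟶ W) (s : ∀ i j, A.X i →ₗ[K] W.X j)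
    (hs : ∀ i (a : A.X i), (α.f i).hom a - (β.f i).hom ((f.f i).hom a) =
      (W.d (i + 1) i).hom (s i (i + 1) a) + s (i - 1) i ((A.d i (i - 1)).hom a))
    (i : ℤ) (x : (cyl f).X i) : ((cylDesc α β s hs).f i).hom x =
      (α.f i).hom (cylA f i x) + (β.f i).hom (cylB f i x) + s (i - 1) i (cylE f i (i - 1) x) := rfl

/-- The projection `(a, b, e) ↦ f a + b` of the mapping cylinder onto the target. -/
def cylπ (f : A ⟶ B) : cyl f ⟶ B := cylDesc f (𝟙 B) 0 (fun i a => by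
  change (f.f i).hom a - (f.f i).hom a = (B.d (i + 1) i).hom 0 + 0
  rw [sub_self, map_zero, add_zero])

theorem cylπ_apply (i : ℤ) (x : (cyl f).X i) :
    ((cylπ f).f i).hom x = (f.f i).hom (cylA f i x) + cylB f i x := add_zero _

theorem cylιB_cylπ (f : A ⟶ B) : cylιB f ≫ cylπ f = 𝟙 B := by
  ext i x
  change ((cylπ f).f i).hom (cylInB f i x) = x
  rw [cylπ_apply, cylA_inB, cylB_inB, map_zero, zero_add]

theorem cylιA_cylπ (f : A ⟶ B) : cylιA f ≫ cylπ f = f := by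
  ext i x
  change ((cylπ f).f i).hom (cylInA f i x) = _
  rw [cylπ_apply, cylA_inA, cylB_inA, add_zero]

/-- The mapping cylinder deformation retracts onto the target. -/
def cylHomotopy (f : A ⟶ B) : Homotopy (cylπ f ≫ cylιB f) (𝟙 (cyl f)) :=
  mkHomotopy (fun i j => ModuleCat.ofHom (-(cylInE f i j ∘ₗ cylA f i)))
    (fun i j h => by
      rw [cylInE_eq_zero h, LinearMap.zero_comp, neg_zero]
      rfl)
    (fun i x => by
      change cylInB f i (((cylπ f).f i).hom x) = x +
        ((cyl f).d (i + 1) i).hom (-cylInE f i (i + 1) (cylA f i x)) +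
          -cylInE f (i - 1) i (cylA f (i - 1) (((cyl f).d i (i - 1)).hom x))
      have e : i - 1 + 1 = i := by omega
      refine cyl_ext (i - 1) e ?_ ?_ ?_
      · rw [map_add, map_add, cylA_d, map_neg, map_neg, map_neg, map_neg, cylA_inE,
          cylE_inE rfl, cylA_inE,
          cylA_inB]
        simp
      · rw [map_add, map_add, cylB_d, map_neg, map_neg, map_neg, map_neg, map_neg, cylB_inE,
          cylE_inE rfl, cylB_inE, cylB_inB, cylπ_apply]
        simp [add_comm]
      · rw [map_add, map_add, cylE_d rfl e, map_neg, map_neg, map_neg, cylE_inE rfl,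
          cylE_inE e, cylE_inB, cylA_d]
        simp only [neg_neg, neg_add_rev]
        abel)

/-- The map of mapping cylinders induced by a commutative square. -/
def cylMap {A' B' : Ch K} {f' : A' ⟶ B'} (a : A ⟶ A') (b : B ⟶ B') (h : a ≫ f' = f ≫ b) :
    cyl f ⟶ cyl f' :=
  cylDesc (a ≫ cylιA f') (b ≫ cylιB f') (fun i j => cylInE f' i j ∘ₗ (a.f i).hom) (fun i x => by
    have hx : (f'.f i).hom ((a.f i).hom x) = (b.f i).hom ((f.f i).hom x) :=
      congrArg (fun g => (g.f i).hom x) h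
    change cylInA f' i ((a.f i).hom x) - cylInB f' i ((b.f i).hom ((f.f i).hom x)) =
      ((cyl f').d (i + 1) i).hom (cylInE f' i (i + 1) ((a.f i).hom x)) +
        cylInE f' (i - 1) i ((a.f (i - 1)).hom ((A.d i (i - 1)).hom x))
    have e : i - 1 + 1 = i := by omega
    refine cyl_ext (i - 1) e ?_ ?_ ?_
    · rw [map_add, map_sub, cylA_d]
      simp [cylE_inE]
    · rw [map_add, map_sub, cylB_d]
      simp [cylE_inE, hx]
    · rw [map_add, map_sub, cylE_d rfl e, cylE_inE e, cylE_inE rfl, map_d_apply]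
      simp)

theorem cylMap_apply {A' B' : Ch K} {f' : A' ⟶ B'} (a : A ⟶ A') (b : B ⟶ B')
    (h : a ≫ f' = f ≫ b) (i : ℤ) (x : (cyl f).X i) : ((cylMap a b h).f i).hom x =
      cylInA f' i ((a.f i).hom (cylA f i x)) + cylInB f' i ((b.f i).hom (cylB f i x)) +
        cylInE f' (i - 1) i ((a.f (i - 1)).hom (cylE f i (i - 1) x)) := rfl

theorem cylMap_id (h : 𝟙 A ≫ f = f ≫ 𝟙 B) : cylMap (𝟙 A) (𝟙 B) h = 𝟙 (cyl f) := by
  ext i : 1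
  refine ModuleCat.hom_ext (LinearMap.ext fun x => ?_)
  exact (cyl_decomp (sub_add_cancel i 1) x).symm

theorem cylMap_comp {A' B' A'' B'' : Ch K} {f' : A' ⟶ B'} {f'' : A'' ⟶ B''} (a : A ⟶ A')
    (b : B ⟶ B') (h : a ≫ f' = f ≫ b) (a' : A' ⟶ A'') (b' : B' ⟶ B'')
    (h' : a' ≫ f'' = f' ≫ b') (h'' : (a ≫ a') ≫ f'' = f ≫ (b ≫ b')) :
    cylMap (a ≫ a') (b ≫ b') h'' = cylMap a b h ≫ cylMap a' b' h' := by
  ext i : 1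
  refine ModuleCat.hom_ext (LinearMap.ext fun x => ?_)
  change _ = ((cylMap a' b' h').f i).hom (((cylMap a b h).f i).hom x)
  have e : i - 1 + 1 = i := by omega
  have h1 : ∀ y, ((cylMap a' b' h').f i).hom (cylInA f' i y) = cylInA f'' i ((a'.f i).hom y) := by
    intro y
    rw [cylMap_apply, cylA_inA, cylB_inA, cylE_inA]
    simp only [map_zero, add_zero]
  have h2 : ∀ y, ((cylMap a' b' h').f i).hom (cylInB f' i y) = cylInB f'' i ((b'.f i).hom y) := by
    intro y
    rw [cylMap_apply, cylA_inB, cylB_inB, cylE_inB]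
    simp only [map_zero, add_zero, zero_add]
  have h3 : ∀ y, ((cylMap a' b' h').f i).hom (cylInE f' (i - 1) i y) =
      cylInE f'' (i - 1) i ((a'.f (i - 1)).hom y) := by
    intro y
    rw [cylMap_apply, cylA_inE, cylB_inE, cylE_inE e]
    simp only [map_zero, zero_add]
  rw [cylMap_apply a b h, map_add, map_add, h1, h2, h3]
  exact cylMap_apply _ _ _ i x

end Cylinder

/-- The functor of mapping cylinders of a natural transformation. -/
def cylFunctor {J : Type*} [Category J] {Q B : J ⥤ Ch K} (u : Q ⟶ B) : J ⥤ Ch K where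
  obj j := cyl (u.app j)
  map g := cylMap (Q.map g) (B.map g) (u.naturality g)
  map_id j := by
    simp only [Q.map_id, B.map_id, cylMap_id]
  map_comp g g' := by
    simp only [Q.map_comp, B.map_comp]
    exact cylMap_comp _ _ _ _ _ _ _

theorem quasiIso_cylιB {A B : Ch K} (f : A ⟶ B) : QuasiIso (cylιB f) :=
  (HomotopyEquiv.mk (cylιB f) (cylπ f) (Homotopy.ofEq (cylιB_cylπ f))
    (cylHomotopy f)).quasiIso_hom

theorem quasiIso_cylπ {A B : Ch K} (f : A ⟶ B) : QuasiIso (cylπ f) :=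
  (HomotopyEquiv.mk (cylπ f) (cylιB f) (cylHomotopy f)
    (Homotopy.ofEq (cylιB_cylπ f))).quasiIso_hom

theorem quasiIso_cylιA {A B : Ch K} (f : A ⟶ B) [QuasiIso f] : QuasiIso (cylιA f) := by
  have := quasiIso_cylπ f
  have : QuasiIso (cylιA f ≫ cylπ f) := by rwa [cylιA_cylπ]
  exact quasiIso_of_comp_right (cylιA f) (cylπ f)

/-! ### Free graded commutative algebras preserve quasi-isomorphisms -/

section Sym

variable {B C : Ch K} {j : B ⟶ C} {r : C ⟶ B} (hjr : j ≫ r = 𝟙 B)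
  (h : ∀ i k : ℤ, C.X i →ₗ[K] C.X k)
  (hh : ∀ i (x : C.X i), (j.f i).hom ((r.f i).hom x) =
    x + (C.d (i + 1) i).hom (h i (i + 1) x) + h (i - 1) i ((C.d i (i - 1)).hom x))

open CCRAlg

theorem sym_commute (i k : ℤ) (x : C.X i) (y : C.X k) : gen (0 : Pairing C) i x * gen 0 k y =
    (-1 : K) ^ (i * k) • (gen 0 k y * gen 0 i x) := by
  have := gen_mul_gen (0 : Pairing C) i k x y
  rwa [Pi.zero_apply, Pi.zero_apply, LinearMap.zero_apply, LinearMap.zero_apply, map_zero,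
    add_zero] at this

/-- Any linear map of generators extends to a derivation because the algebra is free graded
commutative. For a nonzero Poisson structure `h` would have to be compatible with it, which is why
the pairing is removed beforehand. -/
theorem sym_compat : DerCompat (0 : Pairing C) 1 (fun i => gen 0 (i + 1) ∘ₗ h i (i + 1)) := by
  intro i k x y
  simp only [LinearMap.comp_apply]
  rw [sym_commute i (k + 1), sym_commute (i + 1) k, smul_smul, smul_add, smul_smul,
    ← zpow_add₀ (by simp), ← zpow_add₀ (by simp), add_comm]
  congr 2
  · exact neg_one_zpow_congr ⟨0, by ring⟩
  · exact neg_one_zpow_congr ⟨i, by ring⟩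

/-- The derivation of the free graded commutative algebra that extends a chain homotopy. -/
def symH : CCRAlg (0 : Pairing C) →ₗ[K] CCRAlg (0 : Pairing C) :=
  der (isPoisson_zero K C) 1 (sym_compat h)

/-- The derivation `[d, symH]`. -/
def symD : CCRAlg (0 : Pairing C) →ₗ[K] CCRAlg (0 : Pairing C) :=
  d (isPoisson_zero K C) ∘ₗ symH h + symH h ∘ₗ d (isPoisson_zero K C)

theorem symH_one : symH h 1 = 0 := der_one _ _ _

theorem symH_gen_mul (i : ℤ) (x : C.X i) (a : CCRAlg (0 : Pairing C)) :
    symH h (gen 0 i x * a) =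
      gen 0 (i + 1) (h i (i + 1) x) * a + (-1 : K) ^ i • (gen 0 i x * symH h a) := by
  have := der_gen_mul (isPoisson_zero K C) 1 (sym_compat h) i x a
  rwa [one_mul] at this

theorem symH_mem (n : ℤ) (a : CCRAlg (0 : Pairing C)) (ha : a ∈ deg 0 n) :
    symH h a ∈ deg (0 : Pairing C) (n + 1) :=
  der_mem (isPoisson_zero K C) 1 (sym_compat h) (fun _ _ => gen_mem _ _) n a ha

theorem symD_one : symD h 1 = 0 := by
  simp [symD, symH_one, d_one]

set_option maxHeartbeats 800000 in
include hh in
-- The graded commutator of two odd derivations is an even derivation, here without signs. On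
-- generators it is `dh + hd = j r - 1`, which is `0` on the image of `j` and `-1` on the kernel of
-- `r`.
theorem symD_gen_mul (i : ℤ) (x : C.X i) (a : CCRAlg (0 : Pairing C)) :
    symD h (gen 0 i x * a) =
      gen 0 i ((j.f i).hom ((r.f i).hom x) - x) * a + gen 0 i x * symD h a := by
  have e : i - 1 + 1 = i := by omega
  have e1 : (-1 : K) ^ i * (-1 : K) ^ i = 1 := neg_one_zpow_mul_self i
  have e2 : (-1 : K) ^ (i + 1) = -(-1 : K) ^ i := by rw [zpow_add_one₀ (by simp)]; simp
  have e3 : (-1 : K) ^ (i - 1) = -(-1 : K) ^ i := by rw [zpow_sub_one₀ (by simp)]; simp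
  have e4 : ∀ a, d (isPoisson_zero K C) (gen 0 (i + 1) (h i (i + 1) x) * a) =
      gen 0 i ((C.d (i + 1) i).hom (h i (i + 1) x)) * a +
        (-1 : K) ^ (i + 1) • (gen 0 (i + 1) (h i (i + 1) x) * d (isPoisson_zero K C) a) := by
    intro a
    rw [d_mul _ (i + 1) _ _ (gen_mem _ _), d_gen, show i + 1 - 1 = i by omega]
  have e5 : ∀ a, symH h (gen 0 (i - 1) ((C.d i (i - 1)).hom x) * a) =
      gen 0 i (h (i - 1) i ((C.d i (i - 1)).hom x)) * a +
        (-1 : K) ^ (i - 1) • (gen 0 (i - 1) ((C.d i (i - 1)).hom x) * symH h a) := by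
    intro a
    rw [symH_gen_mul, e]
  simp only [symD, LinearMap.add_apply, LinearMap.comp_apply]
  rw [symH_gen_mul, map_add, map_smul, e4, d_mul _ i _ _ (gen_mem _ _),
    d_mul _ i _ _ (gen_mem _ _), d_gen, map_add, map_smul, e5, symH_gen_mul, hh]
  simp only [smul_add, smul_smul, e1, e2, e3, map_add, map_sub, add_mul, sub_mul, mul_add, one_smul,
    neg_smul]
  abel

theorem symD_mem (n : ℤ) (a : CCRAlg (0 : Pairing C)) (ha : a ∈ deg 0 n) :
    symD h a ∈ deg (0 : Pairing C) n := by
  refine Submodule.add_mem _ ?_ ?_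
  · have := d_mem (isPoisson_zero K C) _ _ (symH_mem h n a ha)
    rwa [add_sub_cancel_right] at this
  · have := symH_mem h _ _ (d_mem (isPoisson_zero K C) _ _ ha)
    rwa [sub_add_cancel] at this

theorem d_symD (a : CCRAlg (0 : Pairing C)) :
    d (isPoisson_zero K C) (symD h a) = symD h (d (isPoisson_zero K C) a) := by
  simp [symD, d_d]

/-- The endomorphism induced by the idempotent of a retract. -/
def symP (j : B ⟶ C) (r : C ⟶ B) : CCRAlg (0 : Pairing C) →ₐ[K] CCRAlg (0 : Pairing C) :=
  CCRAlg.map (r ≫ j) (fun _ _ _ _ => rfl)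

theorem symP_gen (i : ℤ) (x : C.X i) :
    symP j r (gen 0 i x) = gen 0 i ((j.f i).hom ((r.f i).hom x)) := map_gen _ _ _ _

/-- The elements on which the derivation `symD` counts `k` factors in the kernel of the
retraction. -/
def symEigen (j : B ⟶ C) (r : C ⟶ B) (k : ℕ) : Submodule K (CCRAlg (0 : Pairing C)) where
  carrier := {a | symD h a = -(k : K) • a ∧ symP j r a = if k = 0 then a else 0}
  zero_mem' := by simp
  add_mem' := by
    rintro a b ⟨h1, h2⟩ ⟨h3, h4⟩
    refine ⟨by rw [map_add, h1, h3, smul_add], ?_⟩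
    rw [map_add, h2, h4]
    split_ifs <;> simp
  smul_mem' := by
    rintro c a ⟨h1, h2⟩
    refine ⟨by rw [map_smul, h1, smul_comm], ?_⟩
    rw [map_smul, h2]
    split_ifs <;> simp

include hjr hh in
-- Splitting a generator as `x = j r x + (x - j r x)`, multiplication by the first summand preserves
-- the number of factors in the kernel of `r`, and multiplication by the second raises it by one.
theorem symEigen_iSup (a : CCRAlg (0 : Pairing C)) : a ∈ ⨆ k, symEigen h j r k := by
  have hr : ∀ i x, (r.f i).hom ((j.f i).hom x) = x := fun i x =>
    congrArg (fun φ => (φ.f i).hom x) hjr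
  refine induction_gen (p := fun a => a ∈ ⨆ k, symEigen h j r k) (isPoisson_zero K C) ?_ ?_
    (Submodule.zero_mem _) (fun a b => Submodule.add_mem _) (fun c a => Submodule.smul_mem _ c) a
  · refine Submodule.mem_iSup_of_mem 0 ⟨?_, by simp⟩
    simp [symD_one]
  · intro i x a ha
    induction ha using Submodule.iSup_induction' with
    | mem k a ha =>
      obtain ⟨h1, h2⟩ := ha
      have hx : gen 0 i x * a = gen (0 : Pairing C) i ((j.f i).hom ((r.f i).hom x)) * a +
          gen 0 i (x - (j.f i).hom ((r.f i).hom x)) * a := by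
        rw [← add_mul, ← map_add, add_sub_cancel]
      rw [hx]
      refine Submodule.add_mem _ (Submodule.mem_iSup_of_mem k ⟨?_, ?_⟩)
        (Submodule.mem_iSup_of_mem (k + 1) ⟨?_, ?_⟩)
      · rw [symD_gen_mul h hh, hr, sub_self, map_zero, zero_mul, zero_add, h1, mul_smul_comm]
      · rw [map_mul, symP_gen, hr, h2]
        split_ifs <;> simp
      · rw [symD_gen_mul h hh, map_sub, map_sub, hr, sub_self, map_zero, map_zero, zero_sub, h1, mul_smul_comm,
          neg_mul]
        push_cast
        module
      · rw [map_mul, symP_gen, map_sub, map_sub, hr, sub_self, map_zero, zero_mul, if_neg (by simp)]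
    | zero => simp
    | add a b _ _ h1 h2 =>
      rw [mul_add]
      exact Submodule.add_mem _ h1 h2

open Polynomial in
include hjr hh in
-- Removing the image under the idempotent leaves only eigenvalues `-k` with `k ≠ 0`, each killed by
-- `X + k`; characteristic zero makes `k` invertible. Polynomials multiply, so the decomposition
-- into eigenvectors need not be shown to be direct.
theorem exists_polynomial_symD [CharZero K] (a : CCRAlg (0 : Pairing C)) :
    ∃ q : K[X], q.coeff 0 ≠ 0 ∧ aeval (symD h) q (a - symP j r a) = 0 := by
  induction symEigen_iSup hjr h hh a using Submodule.iSup_induction' with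
  | mem k a ha =>
    obtain ⟨h1, h2⟩ := ha
    by_cases hk : k = 0
    · refine ⟨1, by simp, ?_⟩
      rw [h2, if_pos hk, sub_self, map_zero]
    · refine ⟨X + Polynomial.C (k : K), by simpa using hk, ?_⟩
      rw [h2, if_neg hk, sub_zero]
      rw [map_add, LinearMap.add_apply, aeval_X, aeval_C, h1, Module.algebraMap_end_apply]
      module
  | zero => exact ⟨1, by simp, by simp⟩
  | add a b _ _ h1 h2 =>
    obtain ⟨q, hq, hqa⟩ := h1
    obtain ⟨q', hq', hqb⟩ := h2
    refine ⟨q * q', by simp [mul_coeff_zero, hq, hq'], ?_⟩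
    have e1 : aeval (symD h) (q * q') (a - symP j r a) = 0 := by
      rw [mul_comm, map_mul, Module.End.mul_apply, hqa, map_zero]
    have e2 : aeval (symD h) (q * q') (b - symP j r b) = 0 := by
      rw [map_mul, Module.End.mul_apply, hqb, map_zero]
    rw [map_add, add_sub_add_comm, map_add, e1, e2, add_zero]

theorem aeval_symD_mem (q : Polynomial K) (n : ℤ) (a : CCRAlg (0 : Pairing C)) (ha : a ∈ deg 0 n) :
    Polynomial.aeval (symD h) q a ∈ deg (0 : Pairing C) n := by
  induction q using Polynomial.induction_on' with
  | add p q hp hq =>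
    rw [map_add]
    exact Submodule.add_mem _ hp hq
  | monomial k c =>
    rw [Polynomial.aeval_monomial, Module.End.mul_apply, Module.algebraMap_end_apply]
    refine Submodule.smul_mem _ _ ?_
    induction k with
    | zero => exact ha
    | succ k ih =>
      rw [pow_succ', Module.End.mul_apply]
      exact symD_mem h n _ ih

theorem d_aeval_symD (q : Polynomial K) (a : CCRAlg (0 : Pairing C)) :
    d (isPoisson_zero K C) (Polynomial.aeval (symD h) q a) =
      Polynomial.aeval (symD h) q (d (isPoisson_zero K C) a) := by
  induction q using Polynomial.induction_on' with
  | add p q hp hq => rw [map_add, LinearMap.add_apply, map_add, hp, hq, LinearMap.add_apply]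
  | monomial k c =>
    rw [Polynomial.aeval_monomial, Module.End.mul_apply, Module.algebraMap_end_apply, map_smul,
      Module.End.mul_apply, Module.algebraMap_end_apply]
    congr 1
    induction k with
    | zero => rfl
    | succ k ih => rw [pow_succ', Module.End.mul_apply, Module.End.mul_apply, d_symD, ih]

include hjr hh in
/-- A cycle is homologous to its image under the idempotent of a deformation retract. -/
theorem sym_homologous [CharZero K] (n : ℤ) (a : CCRAlg (0 : Pairing C)) (ha : a ∈ deg 0 n)
    (hda : d (isPoisson_zero K C) a = 0) : ∃ b ∈ deg (0 : Pairing C) (n + 1),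
      a = symP j r a + d (isPoisson_zero K C) b := by
  obtain ⟨q, hq, hqa⟩ := exists_polynomial_symD hjr h hh a
  have hP : d (isPoisson_zero K C) (a - symP j r a) = 0 := by
    rw [map_sub, hda, symP, ← map_d _ _ (isPoisson_zero K C), hda, map_zero, sub_zero]
  have hPm : a - symP j r a ∈ deg (0 : Pairing C) n :=
    Submodule.sub_mem _ ha (map_mem _ _ _ _ ha)
  set a' := a - symP j r a with ha'
  -- Write `q = X * q.divX + q(0)`. As `q(symD)` kills `a'`, the element `q(0) a'` is `-symD e`.
  -- Since `e` is a cycle, `symD e = d (symH e)`, so `a'` is a boundary.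
  set e := Polynomial.aeval (symD h) q.divX a' with he
  have he0 : d (isPoisson_zero K C) e = 0 := by rw [he, d_aeval_symD, hP, map_zero]
  have h1 : symD h e + q.coeff 0 • a' = 0 := by
    rw [← q.X_mul_divX_add, map_add, map_mul, Polynomial.aeval_X, Polynomial.aeval_C] at hqa
    exact hqa
  have h2 : symD h e = d (isPoisson_zero K C) (symH h e) := by
    rw [symD, LinearMap.add_apply, LinearMap.comp_apply, LinearMap.comp_apply, he0, map_zero,
      add_zero]
  refine ⟨-((q.coeff 0)⁻¹ • symH h e), Submodule.neg_mem _ (Submodule.smul_mem _ _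
    (symH_mem h n e (aeval_symD_mem h _ n _ hPm))), ?_⟩
  rw [map_neg, map_smul, ← h2, eq_neg_of_add_eq_zero_left h1, smul_neg, neg_neg,
    inv_smul_smul₀ hq, ha', add_sub_cancel]

end Sym

theorem symFunctor_d_coe {C : Ch K} {i k : ℤ} (h : k + 1 = i) (a : (symFunctor.obj C).X i) :
    (((symFunctor.obj C).d i k).hom a).1 = CCRAlg.d (isPoisson_zero K C) a.1 :=
  DGAlg.dHom_coe ((CCR K).obj (zeroPoisson.obj C)) h a

/-- Surjectivity on homology follows from the section `j`. For injectivity, `sym_homologous`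
replaces a cycle by the image under `j` of its image under `r`, which is a boundary whenever the
latter is. -/
theorem quasiIso_symFunctor_of_retract [CharZero K] {B C : Ch K} {j : B ⟶ C} {r : C ⟶ B}
    (hjr : j ≫ r = 𝟙 B) (h : Homotopy (r ≫ j) (𝟙 C)) : QuasiIso (symFunctor.map r) := by
  have hid : symFunctor.map j ≫ symFunctor.map r = 𝟙 _ := by
    rw [← Functor.map_comp, hjr, CategoryTheory.Functor.map_id]
  rw [quasiIso_iff_elements]
  refine fun i => ⟨fun w hw => ⟨((symFunctor.map j).f i).hom w, ?_, 0, ?_⟩, fun v hv w' hw => ?_⟩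
  · rw [← map_d_apply, hw, map_zero]
  · rw [map_zero, add_zero, ← comp_f_apply, hid]
    rfl
  · have hh := fun i x => homotopy_apply h i x
    have hv' : CCRAlg.d (isPoisson_zero K C) v.1 = 0 := by
      rw [← symFunctor_d_coe (sub_add_cancel i 1), hv]
      rfl
    obtain ⟨b, hb, hab⟩ := sym_homologous hjr (fun i k => (h.hom i k).hom) hh i v.1 v.2 hv'
    let b' : (symFunctor.obj C).X (i + 1) := ⟨b, hb⟩
    have hcomp : (((symFunctor.map (r ≫ j)).f i).hom v) =
        ((symFunctor.map j).f i).hom (((symFunctor.map r).f i).hom v) := by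
      rw [Functor.map_comp]
      rfl
    have hv2 : v = ((symFunctor.map (r ≫ j)).f i).hom v +
        ((symFunctor.obj C).d (i + 1) i).hom b' :=
      Subtype.ext (hab.trans (congrArg₂ (· + ·) rfl (symFunctor_d_coe rfl b').symm))
    refine ⟨((symFunctor.map j).f (i + 1)).hom w' + b', ?_⟩
    rw [map_add, ← map_d_apply, ← hw, ← hcomp]
    exact hv2

/-- Homotopic maps factor through the cylinder of the identity via its two ends. Both ends are
sections of the projection, which the free algebra functor sends to a quasi-isomorphism, so both
induce the same map on homology. No homotopy between `symFunctor.map f` and `symFunctor.map g` has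
to be written down. -/
theorem homologyMap_symFunctor_eq [CharZero K] {V W : Ch K} {f g : V ⟶ W} (h : Homotopy f g)
    (i : ℤ) : HomologicalComplex.homologyMap (symFunctor.map f) i =
      HomologicalComplex.homologyMap (symFunctor.map g) i := by
  have hs : ∀ i (a : V.X i), (f.f i).hom a - (g.f i).hom (((𝟙 V : V ⟶ V).f i).hom a) =
      (W.d (i + 1) i).hom ((h.hom i (i + 1)).hom a) +
        (h.hom (i - 1) i).hom ((V.d i (i - 1)).hom a) := by
    intro i a
    rw [homotopy_apply h i a]
    change _ - (g.f i).hom a = _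
    abel
  let F : cyl (𝟙 V) ⟶ W := cylDesc f g (fun i k => (h.hom i k).hom) hs
  have hf : f = cylιA (𝟙 V) ≫ F := by
    ext i x
    change _ = ((cylDesc f g (fun i k => (h.hom i k).hom) hs).f i).hom (cylInA (𝟙 V) i x)
    rw [cylDesc_apply, cylA_inA, cylB_inA, cylE_inA, map_zero, map_zero, add_zero, add_zero]
  have hg : g = cylιB (𝟙 V) ≫ F := by
    ext i x
    change _ = ((cylDesc f g (fun i k => (h.hom i k).hom) hs).f i).hom (cylInB (𝟙 V) i x)
    rw [cylDesc_apply, cylA_inB, cylB_inB, cylE_inB, map_zero, map_zero, add_zero, zero_add]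
  have hq := quasiIso_symFunctor_of_retract (cylιB_cylπ (𝟙 V)) (cylHomotopy (𝟙 V))
  have key : HomologicalComplex.homologyMap (symFunctor.map (cylιA (𝟙 V))) i =
      HomologicalComplex.homologyMap (symFunctor.map (cylιB (𝟙 V))) i := by
    rw [← cancel_mono (HomologicalComplex.homologyMap (symFunctor.map (cylπ (𝟙 V))) i),
      ← HomologicalComplex.homologyMap_comp, ← HomologicalComplex.homologyMap_comp,
      ← Functor.map_comp, ← Functor.map_comp, cylιA_cylπ, cylιB_cylπ]
  rw [hf, hg, Functor.map_comp, Functor.map_comp, HomologicalComplex.homologyMap_comp,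
    HomologicalComplex.homologyMap_comp, key]

/-- Over a field a quasi-isomorphism has a homotopy inverse, which becomes an inverse on homology.
-/
theorem quasiIso_symFunctor [CharZero K] {V W : Ch K} (f : V ⟶ W) (hf : QuasiIso f) :
    QuasiIso (symFunctor.map f) := by
  obtain ⟨q⟩ := nonempty_quasiInverse f hf
  rw [quasiIso_iff]
  intro i
  rw [quasiIsoAt_iff_isIso_homologyMap]
  refine ⟨HomologicalComplex.homologyMap (symFunctor.map q.inv) i, ?_, ?_⟩
  · rw [← HomologicalComplex.homologyMap_comp, ← Functor.map_comp, homologyMap_symFunctor_eq q.gam,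
      CategoryTheory.Functor.map_id, HomologicalComplex.homologyMap_id]
  · rw [← HomologicalComplex.homologyMap_comp, ← Functor.map_comp, homologyMap_symFunctor_eq q.lam,
      CategoryTheory.Functor.map_id, HomologicalComplex.homologyMap_id]

/-- Quantization preserves weak equivalences. -/
theorem weakEquiv_CCR [CharZero K] {P Q : PoCh K} (f : P ⟶ Q) (hf : QuasiIso (PoCh.Hom.f f)) :
    DGAlg.WeakEquiv ((CCR K).map f) :=
  (quasiIso_CCR_iff f).2 (quasiIso_symFunctor _ hf)

/-! ### The geometry of the spiral -/

namespace Vert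

theorem pos_injective : Function.Injective pos := by
  rintro ⟨n, N⟩ ⟨n', N'⟩ h
  cases N <;> cases N' <;> simp only [pos] at h <;> first
    | (obtain rfl : n = n' := by omega
       rfl)
    | omega

theorem pos_next (v : Vert) : v.next.pos = v.pos + 1 := by
  obtain ⟨n, N⟩ := v
  cases N <;> simp only [pos, next] <;> ring

theorem pos_prev (v : Vert) : v.prev.pos = v.pos - 1 := by
  obtain ⟨n, N⟩ := v
  cases N <;> simp only [pos, prev] <;> ring

theorem pos_shift (n k : ℤ) (N : Obj) : pos (n + k, N) = pos (n, N) + 4 * k := by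
  cases N <;> simp only [pos] <;> ring

end Vert

namespace Edge

theorem pos_src_tgt (a : Edge) :
    a.src.pos = a.tgt.pos + 1 ∨ a.tgt.pos = a.src.pos + 1 := by
  obtain ⟨n, f⟩ := a
  cases f <;>
    simp only [Edge.src, Edge.tgt, Arr.src, Arr.tgt, Arr.winding, Arr.hom, Hom.winding, iplus,
      jplus, iminus, jminus, Vert.pos] <;> omega

/-- The sum of the two positions encodes the midpoint of the edge. For two different edges this
forces both ends of one to lie on the same side of the other. -/
theorem eq_of_pos {a a' : Edge} (h : a.src.pos + a.tgt.pos = a'.src.pos + a'.tgt.pos) :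
    a = a' := by
  obtain ⟨n, f⟩ := a
  obtain ⟨n', f'⟩ := a'
  cases f <;> cases f' <;>
    simp only [Edge.src, Edge.tgt, Arr.src, Arr.tgt, Arr.winding, Arr.hom, Hom.winding, iplus,
      jplus, iminus, jminus, Vert.pos] at h <;> first
    | (obtain rfl : n = n' := by omega
       rfl)
    | omega

theorem shift_src (n k : ℤ) (f : Arr) :
    Edge.src (n + k, f) = ((Edge.src (n, f)).1 + k, (Edge.src (n, f)).2) := by
  simp only [Edge.src]
  congr 1
  ring

/-- The target of the edge is nearer to the vertex than the source. -/
def TgtNear (a : Edge) (v : Vert) : Prop := a.tgt.dist v < a.src.dist v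

/-- The source of the edge is nearer to the vertex than the target. -/
def SrcNear (a : Edge) (v : Vert) : Prop := a.src.dist v < a.tgt.dist v

/-- Ties are impossible, because the two ends of an edge are adjacent on the line. -/
theorem tgtNear_or (a : Edge) (v : Vert) : a.TgtNear v ∨ a.SrcNear v := by
  have := a.pos_src_tgt
  simp only [TgtNear, SrcNear, Vert.dist]
  omega

end Edge

theorem Vert.dist_comm (v w : Vert) : v.dist w = w.dist v := by
  simp only [Vert.dist]
  omega

/-! ### Zig-zags -/

section Zigzag

variable {X : Obj ⥤ Ch K} (D : CoherenceData X)

theorem zigzag_self (v : Vert) : zigzag D v v = 𝟙 _ := by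
  have h : v.dist v = 0 := by simp [Vert.dist]
  rw [zigzag, h, zigzagAux, dif_pos rfl]
  rfl

theorem zigzag_right_first {v w : Vert} (h : v.pos < w.pos) :
    zigzag D v w = stepRight D v ≫ zigzag D v.next w := by
  have e : v.dist w = v.next.dist w + 1 := by
    simp only [Vert.dist, Vert.pos_next]
    omega
  rw [zigzag, e, zigzagAux, if_pos h]
  rfl

theorem zigzag_left_first {v w : Vert} (h : w.pos < v.pos) :
    zigzag D v w = stepLeft D v ≫ zigzag D v.prev w := by
  have e : v.dist w = v.prev.dist w + 1 := by
    simp only [Vert.dist, Vert.pos_prev]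
    omega
  rw [zigzag, e, zigzagAux, if_neg (by omega)]
  rfl

/-- The recursion peels off the first step of a path. Compatibility with arrows at the end of the
path needs the last step to be split off as well. -/
theorem zigzag_right_last {v w : Vert} (h : v.pos ≤ w.pos) :
    zigzag D v w.next = zigzag D v w ≫ stepRight D w := by
  obtain ⟨k, hk⟩ := Int.le.dest h
  induction k generalizing v with
  | zero =>
    obtain rfl : v = w := Vert.pos_injective (by simpa using hk)
    rw [zigzag_right_first D (by rw [Vert.pos_next]; omega), zigzag_self, zigzag_self,
      Category.comp_id, Category.id_comp]
  | succ k ih =>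
    rw [zigzag_right_first D (by rw [Vert.pos_next]; omega), zigzag_right_first D (by omega : v.pos < w.pos),
      ih (by rw [Vert.pos_next]; omega) (by rw [Vert.pos_next]; omega), Category.assoc]

theorem zigzag_left_last {v w : Vert} (h : w.pos ≤ v.pos) :
    zigzag D v w.prev = zigzag D v w ≫ stepLeft D w := by
  obtain ⟨k, hk⟩ := Int.le.dest h
  induction k generalizing v with
  | zero =>
    obtain rfl : w = v := Vert.pos_injective (by simpa using hk)
    rw [zigzag_left_first D (by rw [Vert.pos_prev]; omega), zigzag_self, zigzag_self,
      Category.comp_id, Category.id_comp]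
  | succ k ih =>
    rw [zigzag_left_first D (by rw [Vert.pos_prev]; omega), zigzag_left_first D (by omega : w.pos < v.pos),
      ih (by rw [Vert.pos_prev]; omega) (by rw [Vert.pos_prev]; omega), Category.assoc]

theorem zigzag_congr_left {n n' : ℤ} (h : n = n') (N : Obj) (w : Vert) :
    zigzag D (n, N) w = zigzag D (n', N) w := by
  subst h
  rfl

theorem zigzag_congr_right {n n' : ℤ} (h : n = n') (N : Obj) (w : Vert) :
    zigzag D w (n, N) = zigzag D w (n', N) := by
  subst h
  rfl

/-- This lemma and the next three translate the left and right steps into edges: a path crossing `a`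
uses `X(f)` in the direction of the arrow and the quasi-inverse against it. After this point only
the dichotomy near source or near target matters. -/
theorem zigzag_src_of_tgtNear {a : Edge} {w : Vert} (h : a.TgtNear w) :
    zigzag D a.src w = X.map a.2.hom ≫ zigzag D a.tgt w := by
  obtain ⟨n, f⟩ := a
  have e : n + 0 = n := add_zero n
  cases f
  · refine (zigzag_congr_left D e .Mplus w).trans (zigzag_right_first D ?_)
    simp only [Edge.TgtNear, Vert.dist, Edge.src, Edge.tgt, Arr.src, Arr.tgt, Arr.winding, Arr.hom,
      Hom.winding, iplus] at h
    simp only [Vert.pos] at h ⊢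
    omega
  · refine (zigzag_congr_left D e .Mplus w).trans (zigzag_left_first D ?_)
    simp only [Edge.TgtNear, Vert.dist, Edge.src, Edge.tgt, Arr.src, Arr.tgt, Arr.winding, Arr.hom,
      Hom.winding, jplus] at h
    simp only [Vert.pos] at h ⊢
    omega
  -- The arrow `i₋` is the only one that changes the level: its source sits at level `n + 1`, to the
  -- right of its target.
  · refine (zigzag_left_first D (v := (n + 1, .Mminus)) ?_).trans
      (congrArg (X.map iminus ≫ ·) (zigzag_congr_left D (add_sub_cancel_right n 1) .M w))
    simp only [Edge.TgtNear, Vert.dist, Edge.src, Edge.tgt, Arr.src, Arr.tgt, Arr.winding, Arr.hom,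
      Hom.winding, iminus] at h
    simp only [Vert.pos] at h ⊢
    omega
  · refine (zigzag_congr_left D e .Mminus w).trans (zigzag_right_first D ?_)
    simp only [Edge.TgtNear, Vert.dist, Edge.src, Edge.tgt, Arr.src, Arr.tgt, Arr.winding, Arr.hom,
      Hom.winding, jminus] at h
    simp only [Vert.pos] at h ⊢
    omega

theorem zigzag_tgt_of_srcNear {a : Edge} {w : Vert} (h : a.SrcNear w) :
    zigzag D a.tgt w = (D a.2).inv ≫ zigzag D a.src w := by
  obtain ⟨n, f⟩ := a
  have e : n + 0 = n := add_zero n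
  cases f
  · refine (zigzag_left_first D (v := (n, .M)) ?_).trans
      (congrArg ((D .iplus).inv ≫ ·) (zigzag_congr_left D e.symm .Mplus w))
    simp only [Edge.SrcNear, Vert.dist, Edge.src, Edge.tgt, Arr.src, Arr.tgt, Arr.winding, Arr.hom,
      Hom.winding, iplus] at h
    simp only [Vert.pos] at h ⊢
    omega
  · refine (zigzag_right_first D (v := (n, .Mh)) ?_).trans
      (congrArg ((D .jplus).inv ≫ ·) (zigzag_congr_left D e.symm .Mplus w))
    simp only [Edge.SrcNear, Vert.dist, Edge.src, Edge.tgt, Arr.src, Arr.tgt, Arr.winding, Arr.hom,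
      Hom.winding, jplus] at h
    simp only [Vert.pos] at h ⊢
    omega
  · refine zigzag_right_first D (v := (n, .M)) ?_
    simp only [Edge.SrcNear, Vert.dist, Edge.src, Edge.tgt, Arr.src, Arr.tgt, Arr.winding, Arr.hom,
      Hom.winding, iminus] at h
    simp only [Vert.pos] at h ⊢
    omega
  · refine (zigzag_left_first D (v := (n, .Mh)) ?_).trans
      (congrArg ((D .jminus).inv ≫ ·) (zigzag_congr_left D e.symm .Mminus w))
    simp only [Edge.SrcNear, Vert.dist, Edge.src, Edge.tgt, Arr.src, Arr.tgt, Arr.winding, Arr.hom,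
      Hom.winding, jminus] at h
    simp only [Vert.pos] at h ⊢
    omega

theorem zigzag_to_src_of_tgtNear {a : Edge} {w : Vert} (h : a.TgtNear w) :
    zigzag D w a.src = zigzag D w a.tgt ≫ (D a.2).inv := by
  obtain ⟨n, f⟩ := a
  have e : n + 0 = n := add_zero n
  cases f
  · refine (zigzag_congr_right D e .Mplus w).trans (zigzag_left_last D (w := (n, .M)) ?_)
    simp only [Edge.TgtNear, Vert.dist, Edge.src, Edge.tgt, Arr.src, Arr.tgt, Arr.winding, Arr.hom,
      Hom.winding, iplus] at h
    simp only [Vert.pos] at h ⊢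
    omega
  · refine (zigzag_congr_right D e .Mplus w).trans (zigzag_right_last D (w := (n, .Mh)) ?_)
    simp only [Edge.TgtNear, Vert.dist, Edge.src, Edge.tgt, Arr.src, Arr.tgt, Arr.winding, Arr.hom,
      Hom.winding, jplus] at h
    simp only [Vert.pos] at h ⊢
    omega
  · refine zigzag_right_last D (w := (n, .M)) ?_
    simp only [Edge.TgtNear, Vert.dist, Edge.src, Edge.tgt, Arr.src, Arr.tgt, Arr.winding, Arr.hom,
      Hom.winding, iminus] at h
    simp only [Vert.pos] at h ⊢
    omega
  · refine (zigzag_congr_right D e .Mminus w).trans (zigzag_left_last D (w := (n, .Mh)) ?_)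
    simp only [Edge.TgtNear, Vert.dist, Edge.src, Edge.tgt, Arr.src, Arr.tgt, Arr.winding, Arr.hom,
      Hom.winding, jminus] at h
    simp only [Vert.pos] at h ⊢
    omega

theorem zigzag_to_tgt_of_srcNear {a : Edge} {w : Vert} (h : a.SrcNear w) :
    zigzag D w a.tgt = zigzag D w a.src ≫ X.map a.2.hom := by
  obtain ⟨n, f⟩ := a
  have e : n + 0 = n := add_zero n
  cases f
  · refine (zigzag_right_last D (w := (n, .Mplus)) ?_).trans
      (congrArg (· ≫ X.map iplus) (zigzag_congr_right D e.symm .Mplus w))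
    simp only [Edge.SrcNear, Vert.dist, Edge.src, Edge.tgt, Arr.src, Arr.tgt, Arr.winding, Arr.hom,
      Hom.winding, iplus] at h
    simp only [Vert.pos] at h ⊢
    omega
  · refine (zigzag_left_last D (w := (n, .Mplus)) ?_).trans
      (congrArg (· ≫ X.map jplus) (zigzag_congr_right D e.symm .Mplus w))
    simp only [Edge.SrcNear, Vert.dist, Edge.src, Edge.tgt, Arr.src, Arr.tgt, Arr.winding, Arr.hom,
      Hom.winding, jplus] at h
    simp only [Vert.pos] at h ⊢
    omega
  · refine (zigzag_congr_right D (add_sub_cancel_right n 1).symm .M w).trans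
      (zigzag_left_last D (w := (n + 1, .Mminus)) ?_)
    simp only [Edge.SrcNear, Vert.dist, Edge.src, Edge.tgt, Arr.src, Arr.tgt, Arr.winding, Arr.hom,
      Hom.winding, iminus] at h
    simp only [Vert.pos] at h ⊢
    omega
  · refine (zigzag_right_last D (w := (n, .Mminus)) ?_).trans
      (congrArg (· ≫ X.map jminus) (zigzag_congr_right D e.symm .Mminus w))
    simp only [Edge.SrcNear, Vert.dist, Edge.src, Edge.tgt, Arr.src, Arr.tgt, Arr.winding, Arr.hom,
      Hom.winding, jminus] at h
    simp only [Vert.pos] at h ⊢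
    omega

theorem zigzagAux_congr_left {n n' : ℤ} (h : n = n') (m : ℕ) (N : Obj) (w : Vert) :
    zigzagAux D m (n, N) w = zigzagAux D m (n', N) w := by
  subst h
  rfl

/-- Translation adds `4 * k` to all positions and so preserves every choice of direction. The maps
along the steps do not depend on the level. -/
theorem zigzagAux_shift (m : ℕ) (n k n' : ℤ) (N N' : Obj) :
    zigzagAux D m (n + k, N) (n' + k, N') = zigzagAux D m (n, N) (n', N') := by
  induction m generalizing n N with
  | zero =>
    by_cases h : (n, N) = (n', N')
    · obtain ⟨rfl, rfl⟩ := Prod.mk.inj h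
      rw [zigzagAux, dif_pos rfl, zigzagAux, dif_pos rfl]
    · have h' : ¬ ((n + k, N) = (n' + k, N')) := fun e => h (by
        obtain ⟨e, rfl⟩ := Prod.mk.inj e
        obtain rfl : n = n' := by omega
        rfl)
      rw [zigzagAux, dif_neg h', zigzagAux, dif_neg h]
  | succ m ih =>
    have hp : (Vert.pos (n + k, N) < Vert.pos (n' + k, N')) =
        (Vert.pos (n, N) < Vert.pos (n', N')) := by
      rw [Vert.pos_shift, Vert.pos_shift]
      exact propext (by omega)
    by_cases h : Vert.pos (n, N) < Vert.pos (n', N')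
    · rw [zigzagAux, if_pos (hp ▸ h), zigzagAux, if_pos h]
      cases N
      · exact congrArg ((D .iminus).inv ≫ ·) ((zigzagAux_congr_left D (add_right_comm n k 1) m .Mminus _).trans
          (ih (n + 1) .Mminus))
      · exact congrArg (X.map iplus ≫ ·) (ih n .M)
      · exact congrArg ((D .jplus).inv ≫ ·) (ih n .Mplus)
      · exact congrArg (X.map jminus ≫ ·) (ih n .Mh)
    · rw [zigzagAux, if_neg (hp ▸ h), zigzagAux, if_neg h]
      cases N
      · exact congrArg ((D .iplus).inv ≫ ·) (ih n .Mplus)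
      · exact congrArg (X.map jplus ≫ ·) (ih n .Mh)
      · exact congrArg ((D .jminus).inv ≫ ·) (ih n .Mminus)
      · exact congrArg (X.map iminus ≫ ·) ((zigzagAux_congr_left D (add_sub_right_comm n k 1) m .M _).trans
          (ih (n - 1) .M))

theorem dist_shift (n k n' : ℤ) (N N' : Obj) :
    Vert.dist (n + k, N) (n' + k, N') = Vert.dist (n, N) (n', N') := by
  simp only [Vert.dist, Vert.pos_shift]
  omega

theorem zigzag_shift (n k n' : ℤ) (N N' : Obj) :
    zigzag D (n + k, N) (n' + k, N') = zigzag D (n, N) (n', N') := by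
  rw [zigzag, dist_shift]
  exact zigzagAux_shift D _ n k n' N N'

end Zigzag

/-! ### Boundaries of the zig-zagging homotopies `Γ`, `Λ` and `Ξ`. -/

theorem homotopy_apply' {V W : Ch K} {f g : V ⟶ W} (h : Homotopy f g) {i j k : ℤ}
    (hij : j + 1 = i) (hjk : k + 1 = j) (x : V.X j) :
    (W.d i j).hom ((h.hom j i).hom x) + (h.hom k j).hom ((V.d j k).hom x) =
      (f.f j).hom x - (g.f j).hom x := by
  subst hij
  obtain rfl : k = j - 1 := by omega
  rw [homotopy_apply h j x]
  abel

theorem QuasiInverse.xi_apply {V W : Ch K} {φ : V ⟶ W} (q : QuasiInverse φ) {i j k l : ℤ}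
    (hij : j + 1 = i) (hjk : k + 1 = j) (hkl : l + 1 = k) (x : V.X k) :
    (W.d i j).hom ((q.xi k i).hom x) - (q.xi l j).hom ((V.d k l).hom x) =
      (φ.f j).hom ((q.gam.hom k j).hom x) - (q.lam.hom k j).hom ((φ.f k).hom x) := by
  subst hij hjk
  obtain rfl : l = k - 1 := by omega
  have e := congrArg (fun f => f.hom x) (q.xi_comm k)
  have e1 : ∀ m, m = k + 1 + 1 → (W.d m (k + 1)).hom ((q.xi k m).hom x) =
    (W.d (k + 1 + 1) (k + 1)).hom ((q.xi k (k + 1 + 1)).hom x) := by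
    rintro _ rfl
    rfl
  rw [← e1 (k + 2) (by ring)]
  exact e.symm

section Homotopies

variable {X : Obj ⥤ Ch K} (D : CoherenceData X)

/-- The zig-zagging chain map in degree `i`, from `(n, N)` to `(n', N')`. -/
def zigLin (n : ℤ) (N : Obj) (n' : ℤ) (N' : Obj) (i : ℤ) : (X.obj N).X i →ₗ[K] (X.obj N').X i :=
  ((zigzag D (n, N) (n', N')).f i).hom

/-- The linear map `Λ`. -/
def lamLin (a : Edge) (n : ℤ) (N : Obj) (i j : ℤ) : (X.obj N).X i →ₗ[K] (X.obj a.2.tgt).X j :=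
  (Lam D a (n, N) i j).hom

/-- The linear map `Γ`. -/
def gamLin (n : ℤ) (N : Obj) (a : Edge) (i j : ℤ) : (X.obj a.2.src).X i →ₗ[K] (X.obj N).X j :=
  (Gam D (n, N) a i j).hom

/-- The linear map `Ξ`. -/
def xiLin (a a' : Edge) (i j : ℤ) : (X.obj a'.2.src).X i →ₗ[K] (X.obj a.2.tgt).X j :=
  (Xi D a a' i j).hom

variable (X) in
/-- The linear map `X(f)`. -/
def arrLin (f : Arr) (i : ℤ) : (X.obj f.src).X i →ₗ[K] (X.obj f.tgt).X i :=
  ((X.map f.hom).f i).hom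

/-- The chosen quasi-inverse of `X(f)`, as a linear map. -/
def invLin (f : Arr) (i : ℤ) : (X.obj f.tgt).X i →ₗ[K] (X.obj f.src).X i :=
  ((D f).inv.f i).hom

/-- The differential of `X(N)`, as a linear map. -/
abbrev dLin (N : Obj) (i j : ℤ) : (X.obj N).X i →ₗ[K] (X.obj N).X j := ((X.obj N).d i j).hom

theorem zigLin_self (n : ℤ) (N : Obj) (i : ℤ) (x : (X.obj N).X i) :
    zigLin D n N n N i x = x := by
  rw [zigLin, zigzag_self]
  rfl

theorem zigLin_d (n : ℤ) (N : Obj) (n' : ℤ) (N' : Obj) (i j : ℤ) (x : (X.obj N).X i) :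
    zigLin D n N n' N' j (dLin N i j x) = dLin N' i j (zigLin D n N n' N' i x) :=
  map_d_apply _ _ _ _

theorem arrLin_d (f : Arr) (i j : ℤ) (x : (X.obj f.src).X i) :
    arrLin X f j (dLin f.src i j x) = dLin f.tgt i j (arrLin X f i x) :=
  map_d_apply _ _ _ _

variable {a : Edge} {n : ℤ} {N : Obj}

theorem zigLin_src (h : a.TgtNear (n, N)) (i : ℤ) (x : (X.obj a.2.src).X i) :
    zigLin D (a.1 + a.2.winding) a.2.src n N i x =
      zigLin D a.1 a.2.tgt n N i (arrLin X a.2 i x) :=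
  congrArg (fun φ : X.obj a.2.src ⟶ X.obj N => (φ.f i).hom x) (zigzag_src_of_tgtNear D h)

theorem zigLin_tgt (h : a.SrcNear (n, N)) (i : ℤ) (x : (X.obj a.2.tgt).X i) :
    zigLin D a.1 a.2.tgt n N i x =
      zigLin D (a.1 + a.2.winding) a.2.src n N i (invLin D a.2 i x) :=
  congrArg (fun φ : X.obj a.2.tgt ⟶ X.obj N => (φ.f i).hom x) (zigzag_tgt_of_srcNear D h)

theorem zigLin_to_src (h : a.TgtNear (n, N)) (i : ℤ) (x : (X.obj N).X i) :
    zigLin D n N (a.1 + a.2.winding) a.2.src i x =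
      invLin D a.2 i (zigLin D n N a.1 a.2.tgt i x) :=
  congrArg (fun φ : X.obj N ⟶ X.obj a.2.src => (φ.f i).hom x) (zigzag_to_src_of_tgtNear D h)

theorem zigLin_to_tgt (h : a.SrcNear (n, N)) (i : ℤ) (x : (X.obj N).X i) :
    zigLin D n N a.1 a.2.tgt i x =
      arrLin X a.2 i (zigLin D n N (a.1 + a.2.winding) a.2.src i x) :=
  congrArg (fun φ : X.obj N ⟶ X.obj a.2.tgt => (φ.f i).hom x) (zigzag_to_tgt_of_srcNear D h)

theorem gamLin_of_tgtNear (h : a.TgtNear (n, N)) (i j : ℤ) : gamLin D n N a i j = 0 := by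
  have e : Gam D (n, N) a i j = 0 := if_pos h
  rw [gamLin, e]
  rfl

theorem gamLin_of_srcNear (h : a.SrcNear (n, N)) (i j : ℤ) (x : (X.obj a.2.src).X i) :
    gamLin D n N a i j x =
      zigLin D (a.1 + a.2.winding) a.2.src n N j (((D a.2).gam.hom i j).hom x) := by
  have e : Gam D (n, N) a i j = (D a.2).gam.hom i j ≫ (zigzag D a.src (n, N)).f j :=
    if_neg (not_lt.2 (le_of_lt h))
  rw [gamLin, e]
  rfl

theorem lamLin_of_srcNear (h : a.SrcNear (n, N)) (i j : ℤ) : lamLin D a n N i j = 0 := by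
  rw [lamLin, Lam, if_pos (by rwa [Vert.dist_comm, Vert.dist_comm (n, N)])]
  rfl

theorem lamLin_of_tgtNear (h : a.TgtNear (n, N)) (i j : ℤ) (x : (X.obj N).X i) :
    lamLin D a n N i j x = ((D a.2).lam.hom i j).hom (zigLin D n N a.1 a.2.tgt i x) := by
  rw [lamLin, Lam, if_neg (by
    rw [Vert.dist_comm, Vert.dist_comm (n, N)]
    exact not_lt.2 (le_of_lt h))]
  rfl

theorem xiLin_self (a : Edge) (i j : ℤ) (x : (X.obj a.2.src).X i) :
    xiLin D a a i j x = ((D a.2).xi i j).hom x := by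
  rw [xiLin, Xi, dif_pos rfl, eqToHom_refl, Category.id_comp]

theorem xiLin_facing {a' : Edge} (h : a' ≠ a) (h1 : a'.SrcNear a.tgt)
    (h2 : a.TgtNear a'.src) {i j k : ℤ} (hj : i + 1 = j) (x : (X.obj a'.2.src).X i) :
    xiLin D a a' i k x = ((D a.2).lam.hom j k).hom
      (zigLin D (a'.1 + a'.2.winding) a'.2.src a.1 a.2.tgt j (((D a'.2).gam.hom i j).hom x)) := by
  subst hj
  have e : Xi D a a' i k = (D a'.2).gam.hom i (i + 1) ≫ (zigzag D a'.src a.tgt).f (i + 1) ≫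
      (D a.2).lam.hom (i + 1) k := by
    rw [Xi, dif_neg h, if_pos ⟨h1, by rwa [a'.src.dist_comm, a'.src.dist_comm]⟩]
  rw [xiLin, e]
  rfl

theorem xiLin_eq_zero {a' : Edge} (h : a' ≠ a) (h1 : a'.TgtNear a.tgt ∨ a.SrcNear a'.src)
    (i j : ℤ) : xiLin D a a' i j = 0 := by
  have e : Xi D a a' i j = 0 := by
    rw [Xi, dif_neg h, if_neg]
    simp only [Edge.SrcNear, Edge.TgtNear, Vert.dist] at *
    omega
  rw [xiLin, e]
  rfl

variable (a n N)

/-- If the arrow points towards the vertex, the path from its source passes through it and both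
sides vanish. Otherwise the path from its target goes back through the quasi-inverse, and the
difference is `Z (f⁻¹ f - 1) = Z ∂γ`. -/
theorem gamLin_d {i j k : ℤ} (hij : j + 1 = i) (hjk : k + 1 = j) (x : (X.obj a.2.src).X j) :
    dLin N i j (gamLin D n N a j i x) + gamLin D n N a k j (dLin a.2.src j k x) =
      zigLin D a.1 a.2.tgt n N j (arrLin X a.2 j x) -
        zigLin D (a.1 + a.2.winding) a.2.src n N j x := by
  rcases a.tgtNear_or (n, N) with h | h
  · rw [gamLin_of_tgtNear D h, gamLin_of_tgtNear D h, zigLin_src D h, LinearMap.zero_apply,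
      LinearMap.zero_apply, map_zero, sub_self, add_zero]
  · have := homotopy_apply' (D a.2).gam hij hjk x
    rw [gamLin_of_srcNear D h, gamLin_of_srcNear D h, zigLin_tgt D h, ← map_sub, ← zigLin_d,
      ← map_add]
    exact congrArg _ this

/-- The counterpart of `gamLin_d` for paths that arrive at the edge: the only nonzero case is `(f
f⁻¹ - 1) Z = (∂λ) Z`. -/
theorem lamLin_d {i j k : ℤ} (hij : j + 1 = i) (hjk : k + 1 = j) (x : (X.obj N).X j) :
    dLin a.2.tgt i j (lamLin D a n N j i x) + lamLin D a n N k j (dLin N j k x) =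
      arrLin X a.2 j (zigLin D n N (a.1 + a.2.winding) a.2.src j x) -
        zigLin D n N a.1 a.2.tgt j x := by
  rcases a.tgtNear_or (n, N) with h | h
  · have := homotopy_apply' (D a.2).lam hij hjk (zigLin D n N a.1 a.2.tgt j x)
    rw [lamLin_of_tgtNear D h, lamLin_of_tgtNear D h, zigLin_to_src D h, zigLin_d]
    exact this
  · rw [lamLin_of_srcNear D h, lamLin_of_srcNear D h, zigLin_to_tgt D h, LinearMap.zero_apply,
      LinearMap.zero_apply, map_zero, sub_self, add_zero]

/-- On the diagonal this is the 2-homotopy equation of the coherence data. For distinct edges there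
are four relative orientations: if `s f'` and `t f` face each other, it is the Leibniz rule for `λ Z
γ`; in the other three `Ξ = 0`, and the terms on the right vanish or cancel in pairs. -/
theorem xiLin_d (a' : Edge) {i j k l : ℤ} (hij : j + 1 = i) (hjk : k + 1 = j) (hkl : l + 1 = k)
    (x : (X.obj a'.2.src).X k) :
    dLin a.2.tgt i j (xiLin D a a' k i x) - xiLin D a a' l j (dLin a'.2.src k l x) =
      arrLin X a.2 j (gamLin D (a.1 + a.2.winding) a.2.src a' k j x) -
        gamLin D a.1 a.2.tgt a' k j x +
        lamLin D a (a'.1 + a'.2.winding) a'.2.src k j x -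
        lamLin D a a'.1 a'.2.tgt k j (arrLin X a'.2 k x) := by
  have ha := a.pos_src_tgt
  have ha' := a'.pos_src_tgt
  by_cases h : a' = a
  · subst h
    have h1 : a'.TgtNear a'.tgt := by
      simp only [Edge.TgtNear, Vert.dist]
      omega
    have h2 : a'.SrcNear a'.src := by
      simp only [Edge.SrcNear, Vert.dist]
      omega
    change a'.TgtNear (a'.1, a'.2.tgt) at h1
    change a'.SrcNear (a'.1 + a'.2.winding, a'.2.src) at h2
    rw [gamLin_of_tgtNear D h1, lamLin_of_srcNear D h2, gamLin_of_srcNear D h2,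
      lamLin_of_tgtNear D h1, xiLin_self, xiLin_self, zigLin_self, zigLin_self,
      LinearMap.zero_apply, sub_zero, add_zero]
    exact (D a'.2).xi_apply hij hjk hkl x
  -- With distinct midpoints, whichever end of one edge is nearer to one end of the other edge is
  -- also nearer to its other end; `omega` uses this for every `h2` and `h4` below.
  have hne : ¬ (a'.src.pos + a'.tgt.pos = a.src.pos + a.tgt.pos) := fun e => h (Edge.eq_of_pos e)
  rcases a.tgtNear_or a'.src with h1 | h1
  · have h2 : a.TgtNear (a'.1, a'.2.tgt) := by
      change a.TgtNear a'.tgt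
      simp only [Edge.TgtNear, Vert.dist] at *
      omega
    have h1' : a.TgtNear (a'.1 + a'.2.winding, a'.2.src) := h1
    rcases a'.tgtNear_or a.tgt with h3 | h3
    · have h4 : a'.TgtNear (a.1 + a.2.winding, a.2.src) := by
        change a'.TgtNear a.src
        simp only [Edge.TgtNear, Vert.dist] at *
        omega
      have h3' : a'.TgtNear (a.1, a.2.tgt) := h3
      rw [gamLin_of_tgtNear D h3', gamLin_of_tgtNear D h4, lamLin_of_tgtNear D h1',
        lamLin_of_tgtNear D h2, zigLin_src D h3', xiLin_eq_zero D h (Or.inl h3),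
        xiLin_eq_zero D h (Or.inl h3)]
      simp
    · have h4 : a'.SrcNear (a.1 + a.2.winding, a.2.src) := by
        change a'.SrcNear a.src
        simp only [Edge.TgtNear, Edge.SrcNear, Vert.dist] at *
        omega
      have h3' : a'.SrcNear (a.1, a.2.tgt) := h3
      rw [gamLin_of_srcNear D h3', gamLin_of_srcNear D h4, lamLin_of_tgtNear D h1',
        lamLin_of_tgtNear D h2, zigLin_tgt D h3', xiLin_facing D h h3 h1 hjk,
        xiLin_facing D h h3 h1 hkl, zigLin_to_src D h1']
      -- The two halves of the Leibniz rule: `e1` is `(∂λ) Z γ` and `e2` is `λ Z (∂γ)`. The sign of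
      -- the middle term `λ d Z γ` differs between them, so it cancels.
      have e1 := homotopy_apply' (D a.2).lam hij hjk
        (zigLin D (a'.1 + a'.2.winding) a'.2.src a.1 a.2.tgt j (((D a'.2).gam.hom k j).hom x))
      have e2 := congrArg (fun y => ((D a.2).lam.hom k j).hom
          (zigLin D (a'.1 + a'.2.winding) a'.2.src a.1 a.2.tgt k y))
        (homotopy_apply' (D a'.2).gam hjk hkl x)
      simp only [map_add, map_sub] at e2
      rw [← zigLin_d] at e1
      change _ = arrLin X a.2 j (invLin D a.2 j _) -
        zigLin D _ _ _ _ j (((D a'.2).gam.hom k j).hom x) at e1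
      change _ = ((D a.2).lam.hom k j).hom (zigLin D _ _ _ _ k (invLin D a'.2 k
        (arrLin X a'.2 k x))) - ((D a.2).lam.hom k j).hom (zigLin D _ _ _ _ k x) at e2
      rw [← eq_sub_iff_add_eq] at e1 e2
      rw [e1, e2]
      abel
  · have h2 : a.SrcNear (a'.1, a'.2.tgt) := by
      change a.SrcNear a'.tgt
      simp only [Edge.SrcNear, Vert.dist] at *
      omega
    have h1' : a.SrcNear (a'.1 + a'.2.winding, a'.2.src) := h1
    rw [lamLin_of_srcNear D h1', lamLin_of_srcNear D h2, xiLin_eq_zero D h (Or.inr h1),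
      xiLin_eq_zero D h (Or.inr h1)]
    rcases a'.tgtNear_or a.tgt with h3 | h3
    · have h4 : a'.TgtNear (a.1 + a.2.winding, a.2.src) := by
        change a'.TgtNear a.src
        simp only [Edge.TgtNear, Edge.SrcNear, Vert.dist] at *
        omega
      have h3' : a'.TgtNear (a.1, a.2.tgt) := h3
      rw [gamLin_of_tgtNear D h3', gamLin_of_tgtNear D h4]
      simp
    · have h4 : a'.SrcNear (a.1 + a.2.winding, a.2.src) := by
        change a'.SrcNear a.src
        simp only [Edge.SrcNear, Vert.dist] at *
        omega
      have h3' : a'.SrcNear (a.1, a.2.tgt) := h3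
      rw [gamLin_of_srcNear D h3', gamLin_of_srcNear D h4, zigLin_to_tgt D h1']
      simp

end Homotopies

/-! ### Skew-symmetrization of pairings -/

/-- The graded antisymmetrization of a pairing. -/
def skew {V : Ch K} (σ : Pairing V) : Pairing V := fun i j =>
  (1 / 2 : K) • (σ i j - (-1 : K) ^ (i * j) • (σ j i).flip)

theorem skew_apply {V : Ch K} (σ : Pairing V) (i j : ℤ) (x : V.X i) (y : V.X j) :
    skew σ i j x y = (1 / 2 : K) * (σ i j x y - (-1 : K) ^ (i * j) * σ j i y x) := rfl

/-- Swapping the arguments of a chain map `V ⊗ V → K` with the Koszul sign gives a chain map again,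
so closedness only has to be proved before antisymmetrizing. -/
theorem isPoisson_skew {V : Ch K} {σ : Pairing V} (hz : ∀ i j : ℤ, i + j ≠ 0 → σ i j = 0)
    (hd : ∀ (i j : ℤ) (x : V.X i) (y : V.X j),
      σ (i - 1) j ((V.d i (i - 1)).hom x) y +
        (-1 : K) ^ i * σ i (j - 1) x ((V.d j (j - 1)).hom y) = 0) :
    IsPoisson (skew σ) where
  degree_zero i j h := by
    rw [skew, hz i j h, hz j i (by rwa [add_comm])]
    ext x y
    simp
  antisymm i j x y := by
    rw [skew_apply, skew_apply, mul_comm j i]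
    have := CCRAlg.neg_one_zpow_mul_self (K := K) (i * j)
    linear_combination (-(1 / 2 : K) * σ i j x y) * this
  chain_map i j x y := by
    rw [skew_apply, skew_apply]
    have h1 := hd i j x y
    have h2 := hd j i y x
    have e0 := CCRAlg.neg_one_zpow_mul_self (K := K) j
    have e1 : (-1 : K) ^ ((i - 1) * j) = (-1 : K) ^ (i * j) * (-1 : K) ^ j := by
      rw [← zpow_add₀ (by simp)]
      exact CCRAlg.neg_one_zpow_congr ⟨-j, by ring⟩
    have e2 : (-1 : K) ^ i * (-1 : K) ^ (i * (j - 1)) = (-1 : K) ^ (i * j) := by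
      rw [← zpow_add₀ (by simp)]
      congr 1
      ring
    rw [e1]
    linear_combination (1 / 2 : K) * h1 - (1 / 2 : K) * (-1 : K) ^ (i * j) * h2 -
      (1 / 2 : K) * σ (j - 1) i ((V.d j (j - 1)).hom y) x * e2

/-! ### The projections of `𝕃L_!(X)` and the Poisson structure -/

section Projections

variable {X : Obj ⥤ Ch K} (D : CoherenceData X)

/-- The projection of `𝕃L_!(X)` to `X(N)`, sending the elements over all vertices and edges to the
vertex `(n, N)` along the zig-zags. -/
def vertProj (n : ℤ) (N : Obj) (i : ℤ) : LLX X i →ₗ[K] (X.obj N).X i :=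
  descLL (fun v => zigLin D v.1 v.2 n N i)
    (fun a => (-1 : K) ^ i • gamLin D n N a (i - 1) i)

/-- The homotopy between the projections at both ends of an edge. -/
def edgeProj (a : Edge) (i j : ℤ) : LLX X i →ₗ[K] (X.obj a.2.tgt).X j :=
  descLL (fun v => lamLin D a v.1 v.2 i j) (fun a' => (-1 : K) ^ i • xiLin D a a' (i - 1) j)

theorem vertProj_inVert (n : ℤ) (N : Obj) (i n' : ℤ) (N' : Obj) (x : (X.obj N').X i) :
    vertProj D n N i (inVert X i n' N' x) = zigLin D n' N' n N i x :=
  descLL_inVert _ _ _ _ _ _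

theorem vertProj_inEdge (n : ℤ) (N : Obj) (i n' : ℤ) (f : Arr) (x : (X.obj f.src).X (i - 1)) :
    vertProj D n N i (inEdge X i n' f x) = (-1 : K) ^ i • gamLin D n N (n', f) (i - 1) i x :=
  descLL_inEdge _ _ _ _ _ _

theorem edgeProj_inVert (a : Edge) (i j n' : ℤ) (N' : Obj) (x : (X.obj N').X i) :
    edgeProj D a i j (inVert X i n' N' x) = lamLin D a n' N' i j x :=
  descLL_inVert _ _ _ _ _ _

theorem edgeProj_inEdge (a : Edge) (i j n' : ℤ) (f : Arr) (x : (X.obj f.src).X (i - 1)) :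
    edgeProj D a i j (inEdge X i n' f x) = (-1 : K) ^ i • xiLin D a (n', f) (i - 1) j x :=
  descLL_inEdge _ _ _ _ _ _

variable (X) in
theorem dLL_inVert (i j n : ℤ) (N : Obj) (x : (X.obj N).X i) :
    dLL X i j (inVert X i n N x) = inVert X j n N (dLin N i j x) :=
  descLL_inVert _ _ _ _ _ _

variable (X) in
theorem dLL_inEdge (i n : ℤ) (f : Arr) (x : (X.obj f.src).X (i - 1)) :
    dLL X i (i - 1) (inEdge X i n f x) =
      (-1 : K) ^ (i - 1) • (inVert X (i - 1) (n + f.winding) f.src x -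
        inVert X (i - 1) n f.tgt (arrLin X f (i - 1) x)) +
      inEdge X (i - 1) n f (dLin f.src (i - 1) (i - 1 - 1) x) := by
  refine (descLL_inEdge _ _ _ _ _ _).trans ?_
  rw [LinearMap.add_apply, deltaLL, idOfEq_self]
  rfl

theorem neg_one_zpow_pred (i : ℤ) : (-1 : K) ^ (i - 1) = -(-1 : K) ^ i := by
  rw [zpow_sub_one₀ (by simp)]
  simp

/-- The projection is a chain map: on an edge, the vertical part of the differential contributes the
difference of the two zig-zags, which `gamLin_d` shows to be the boundary of `Γ`. -/
theorem vertProj_d (n : ℤ) (N : Obj) (i : ℤ) (ω : LLX X i) :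
    vertProj D n N (i - 1) (dLL X i (i - 1) ω) = dLin N i (i - 1) (vertProj D n N i ω) := by
  suffices h : vertProj D n N (i - 1) ∘ₗ dLL X i (i - 1) = dLin N i (i - 1) ∘ₗ vertProj D n N i from
    LinearMap.congr_fun h ω
  apply LLX_hom_ext
  · intro n' N' x
    rw [LinearMap.comp_apply, LinearMap.comp_apply, dLL_inVert, vertProj_inVert, vertProj_inVert,
      zigLin_d]
  · intro n' f x
    have h := gamLin_d D (n', f) n N (sub_add_cancel i 1) (sub_add_cancel (i - 1) 1) x
    rw [LinearMap.comp_apply, LinearMap.comp_apply, dLL_inEdge, map_add, map_smul, map_sub,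
      vertProj_inVert, vertProj_inVert, vertProj_inEdge, vertProj_inEdge, map_smul,
      eq_sub_of_add_eq h, neg_one_zpow_pred]
    module

/-- `edgeProj` is a homotopy between `X(f)` after the projection at the source and the projection at
the target. It is `lamLin_d` on vertices and `xiLin_d` on edges. -/
theorem edgeProj_d (a : Edge) (i : ℤ) (ω : LLX X i) :
    arrLin X a.2 i (vertProj D (a.1 + a.2.winding) a.2.src i ω) - vertProj D a.1 a.2.tgt i ω =
      dLin a.2.tgt (i + 1) i (edgeProj D a i (i + 1) ω) +
        edgeProj D a (i - 1) i (dLL X i (i - 1) ω) := by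
  suffices h : arrLin X a.2 i ∘ₗ vertProj D (a.1 + a.2.winding) a.2.src i -
      vertProj D a.1 a.2.tgt i = dLin a.2.tgt (i + 1) i ∘ₗ edgeProj D a i (i + 1) +
        edgeProj D a (i - 1) i ∘ₗ dLL X i (i - 1) from LinearMap.congr_fun h ω
  apply LLX_hom_ext
  · intro n' N' x
    simp only [LinearMap.sub_apply, LinearMap.add_apply, LinearMap.comp_apply]
    rw [dLL_inVert, vertProj_inVert, vertProj_inVert, edgeProj_inVert, edgeProj_inVert,
      lamLin_d D a n' N' rfl (sub_add_cancel i 1)]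
  · intro n' f x
    have h := xiLin_d D a (n', f) rfl (sub_add_cancel i 1) (sub_add_cancel (i - 1) 1) x
    simp only [LinearMap.sub_apply, LinearMap.add_apply, LinearMap.comp_apply]
    rw [dLL_inEdge, map_add, map_smul, map_sub, edgeProj_inVert, edgeProj_inVert, edgeProj_inEdge,
      edgeProj_inEdge, vertProj_inEdge, vertProj_inEdge, map_smul, map_smul, eq_add_of_sub_eq h,
      neg_one_zpow_pred]
    module

variable (τ : ∀ N, Pairing (X.obj N))

/-- The pairing whose antisymmetrization is `τ_𝕃`. -/
def pairLin (i j : ℤ) : LLX X i →ₗ[K] LLX X j →ₗ[K] K :=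
  descLL (fun v => (τ v.2 i j).compl₂ (vertProj D v.1 v.2 j))
    (fun a => (τ a.2.tgt (i - 1) (j + 1)).compl₁₂ (arrLin X a.2 (i - 1)) (edgeProj D a j (j + 1)))

theorem pairLin_inVert (i j n : ℤ) (N : Obj) (x : (X.obj N).X i) (ω : LLX X j) :
    pairLin D τ i j (inVert X i n N x) ω = τ N i j x (vertProj D n N j ω) :=
  LinearMap.congr_fun (descLL_inVert _ _ _ _ _ _) ω

theorem pairLin_inEdge {i j k : ℤ} (hk : j + 1 = k) (n : ℤ) (f : Arr)
    (x : (X.obj f.src).X (i - 1)) (ω : LLX X j) :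
    pairLin D τ i j (inEdge X i n f x) ω =
      τ f.tgt (i - 1) k (arrLin X f (i - 1) x) (edgeProj D (n, f) j k ω) := by
  subst hk
  exact LinearMap.congr_fun (descLL_inEdge _ _ _ _ _ _) ω

variable {τ}

theorem pairLin_degree_zero (hτ : ∀ N, IsPoisson (τ N)) (i j : ℤ) (h : i + j ≠ 0) :
    pairLin D τ i j = 0 := by
  apply LLX_hom_ext
  · intro n N x
    apply LinearMap.ext
    intro ω
    rw [pairLin_inVert, (hτ N).degree_zero i j h]
    rfl
  · intro n f x
    apply LinearMap.ext
    intro ω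
    rw [pairLin_inEdge D τ rfl, (hτ f.tgt).degree_zero (i - 1) (j + 1) (by omega)]
    rfl

theorem IsPoisson.chain_map' {V : Ch K} {κ : Pairing V} (hκ : IsPoisson κ) {i i' j j' : ℤ}
    (hi : i' + 1 = i) (hj : j' + 1 = j) (x : V.X i) (y : V.X j) :
    κ i' j ((V.d i i').hom x) y + (-1 : K) ^ i * κ i j' x ((V.d j j').hom y) = 0 := by
  obtain rfl : i' = i - 1 := by omega
  obtain rfl : j' = j - 1 := by omega
  exact hκ.chain_map i j x y

/-- A family of Poisson structures on the values of `X` that is compatible with the non-identity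
morphisms. -/
structure PoissonFamily (τ : ∀ N, Pairing (X.obj N)) : Prop where
  isPoisson : ∀ N, IsPoisson (τ N)
  natural : ∀ (f : Arr) (i j : ℤ) (x : (X.obj f.src).X i) (y : (X.obj f.src).X j),
    τ f.tgt i j (arrLin X f i x) (arrLin X f j y) = τ f.src i j x y

/-- Over a vertex this holds because `vertProj` is a chain map and `τ` is closed. Over an edge, the
vertical differential produces `τ(x, p_s ω') - τ(X(f) x, p_t ω')`; invariance of `τ` rewrites the
first term as `τ(X(f) x, X(f) p_s ω')`, and `edgeProj_d` cancels the difference. -/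
theorem pairLin_d (hτ : PoissonFamily τ) (i j : ℤ) (ω : LLX X i) (ω' : LLX X j) :
    pairLin D τ (i - 1) j (dLL X i (i - 1) ω) ω' +
      (-1 : K) ^ i * pairLin D τ i (j - 1) ω (dLL X j (j - 1) ω') = 0 := by
  suffices h : (pairLin D τ (i - 1) j).comp (dLL X i (i - 1)) +
      (-1 : K) ^ i • (pairLin D τ i (j - 1)).compl₂ (dLL X j (j - 1)) = 0 from
    LinearMap.congr_fun (LinearMap.congr_fun h ω) ω'
  apply LLX_hom_ext
  · intro n N x
    apply LinearMap.ext
    intro ω'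
    change pairLin D τ (i - 1) j (dLL X i (i - 1) _) ω' +
      (-1 : K) ^ i * pairLin D τ i (j - 1) _ (dLL X j (j - 1) ω') = 0
    rw [dLL_inVert, pairLin_inVert, pairLin_inVert, vertProj_d]
    exact (hτ.isPoisson N).chain_map i j x _
  · intro n f x
    apply LinearMap.ext
    intro ω'
    change pairLin D τ (i - 1) j (dLL X i (i - 1) _) ω' +
      (-1 : K) ^ i * pairLin D τ i (j - 1) _ (dLL X j (j - 1) ω') = 0
    have h2 := congrArg (τ f.tgt (i - 1) j (arrLin X f (i - 1) x)) (edgeProj_d D (n, f) j ω')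
    have h3 := (hτ.isPoisson f.tgt).chain_map' (sub_add_cancel (i - 1) 1) (rfl : j + 1 = j + 1)
      (arrLin X f (i - 1) x) (edgeProj D (n, f) j (j + 1) ω')
    have h4 := arrLin_d f (i - 1) (i - 1 - 1) x
    rw [map_sub, map_add, hτ.natural f] at h2
    rw [dLL_inEdge, map_add, map_smul, map_sub, LinearMap.add_apply, LinearMap.smul_apply,
      LinearMap.sub_apply, pairLin_inVert, pairLin_inVert, pairLin_inEdge D τ rfl,
      pairLin_inEdge D τ (sub_add_cancel j 1), h4, smul_eq_mul]
    rw [neg_one_zpow_pred] at h3 ⊢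
    linear_combination h3 - (-1 : K) ^ i * h2

theorem isPoisson_skew_pairLin (hτ : PoissonFamily τ) :
    IsPoisson (V := LLobj X) (skew (V := LLobj X) (pairLin D τ)) :=
  isPoisson_skew (V := LLobj X) (pairLin_degree_zero D hτ.isPoisson) (pairLin_d D hτ)

/-! ### The structure `τ_𝕃` as an antisymmetrization. -/

theorem tauLLX_inVert_inVert (i j n n' : ℤ) (N N' : Obj) (x : (X.obj N).X i)
    (y : (X.obj N').X j) :
    tauLLX D τ i j (inVert X i n N x) (inVert X j n' N' y) =
      1 / 2 * (τ N i j x (zigLin D n' N' n N j y) + τ N' i j (zigLin D n N n' N' i x) y) := by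
  rw [tauLLX, descLL_inVert, LinearMap.flip_apply, descLL_inVert]
  rfl

theorem tauLLX_inVert_inEdge (i j n n' : ℤ) (N : Obj) (f' : Arr) (x : (X.obj N).X i)
    (y : (X.obj f'.src).X (j - 1)) :
    tauLLX D τ i j (inVert X i n N x) (inEdge X j n' f' y) =
      (-1) ^ i / 2 * (τ N i j x (gamLin D n N (n', f') (j - 1) j y) +
        (-1) ^ (j - 1) * τ f'.tgt (i + 1) (j - 1) (lamLin D (n', f') n N i (i + 1) x)
          (arrLin X f' (j - 1) y)) := by
  rw [tauLLX, descLL_inVert, LinearMap.flip_apply, descLL_inEdge]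
  rfl

theorem tauLLX_inEdge_inVert (i j n n' : ℤ) (f : Arr) (N' : Obj) (x : (X.obj f.src).X (i - 1))
    (y : (X.obj N').X j) :
    tauLLX D τ i j (inEdge X i n f x) (inVert X j n' N' y) =
      1 / 2 * (τ f.tgt (i - 1) (j + 1) (arrLin X f (i - 1) x) (lamLin D (n, f) n' N' j (j + 1) y) +
        (-1) ^ j * τ N' i j (gamLin D n' N' (n, f) (i - 1) i x) y) := by
  rw [tauLLX, descLL_inEdge, LinearMap.flip_apply, descLL_inVert]
  rfl

theorem tauLLX_inEdge_inEdge (i j n n' : ℤ) (f f' : Arr) (x : (X.obj f.src).X (i - 1))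
    (y : (X.obj f'.src).X (j - 1)) :
    tauLLX D τ i j (inEdge X i n f x) (inEdge X j n' f' y) =
      (-1) ^ (i - 1 + 1) / 2 * (τ f.tgt (i - 1) (j + 1) (arrLin X f (i - 1) x)
          (xiLin D (n, f) (n', f') (j - 1) (j + 1) y) -
        τ f'.tgt (i + 1) (j - 1) (xiLin D (n', f') (n, f) (i - 1) (i + 1) x)
          (arrLin X f' (j - 1) y)) := by
  rw [tauLLX, descLL_inEdge, LinearMap.flip_apply, descLL_inEdge]
  rfl

/-- In each of the four formulas for `τ_𝕃` one summand is `pairLin`, and the other is `pairLin` with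
its arguments exchanged, rewritten by the antisymmetry of `τ`. -/
theorem tauLLX_eq_skew (hτ : ∀ N, IsPoisson (τ N)) (i j : ℤ) :
    tauLLX D τ i j = skew (V := LLobj X) (pairLin D τ) i j := by
  suffices h : tauLLX D τ i j =
      (1 / 2 : K) • (pairLin D τ i j - (-1 : K) ^ (i * j) • (pairLin D τ j i).flip) from h
  have hs : ∀ (k l : ℤ), k + l ≠ 0 → ∀ (N : Obj) (x y), τ N k l x y = 0 := by
    intro k l h N x y
    rw [(hτ N).degree_zero k l h]
    rfl
  have e1 : i + j = 0 → (-1 : K) ^ i = (-1 : K) ^ j := fun h =>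
    CCRAlg.neg_one_zpow_congr ⟨i, by omega⟩
  have e0 := CCRAlg.neg_one_zpow_mul_self (K := K) (i * j)
  have e2 : (-1 : K) ^ ((i + 1) * (j - 1)) = -(-1 : K) ^ (i * j) * (-1 : K) ^ i * (-1 : K) ^ j := by
    rw [← neg_one_zpow_pred, ← zpow_add₀ (by simp), ← zpow_add₀ (by simp)]
    exact CCRAlg.neg_one_zpow_congr ⟨-i, by ring⟩
  have e3 := CCRAlg.neg_one_zpow_mul_self (K := K) i
  have e4 := CCRAlg.neg_one_zpow_mul_self (K := K) j
  apply LLX_hom_ext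
  · intro n N x
    apply LLX_hom_ext
    · intro n' N' y
      rw [tauLLX_inVert_inVert]
      change _ = (1 / 2 : K) * (pairLin D τ i j _ _ - (-1 : K) ^ (i * j) * pairLin D τ j i _ _)
      rw [pairLin_inVert, pairLin_inVert, vertProj_inVert, vertProj_inVert, (hτ N').antisymm i j]
      ring
    · intro n' f' y
      rw [tauLLX_inVert_inEdge]
      change _ = (1 / 2 : K) * (pairLin D τ i j _ _ - (-1 : K) ^ (i * j) * pairLin D τ j i _ _)
      rw [pairLin_inVert, pairLin_inEdge D τ rfl, vertProj_inEdge, edgeProj_inVert, map_smul,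
        (hτ f'.tgt).antisymm (i + 1) (j - 1), e2, neg_one_zpow_pred, smul_eq_mul]
      -- The explicit signs agree only when `i` and `j` have the same parity. Away from total degree
      -- zero all terms vanish.
      by_cases h : i + j = 0
      · rw [e1 h]
        linear_combination (-(1 / 2 : K) * (-1 : K) ^ (i * j) *
          τ f'.tgt (j - 1) (i + 1) (arrLin X f' (j - 1) y) (lamLin D (n', f') n N i (i + 1) x) *
          ((-1 : K) ^ j * (-1 : K) ^ j + 1)) * e4
      · rw [hs i j h, hs (j - 1) (i + 1) (by omega)]
        ring
  · intro n f x
    apply LLX_hom_ext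
    · intro n' N' y
      rw [tauLLX_inEdge_inVert]
      change _ = (1 / 2 : K) * (pairLin D τ i j _ _ - (-1 : K) ^ (i * j) * pairLin D τ j i _ _)
      rw [pairLin_inVert, pairLin_inEdge D τ rfl, vertProj_inEdge, edgeProj_inVert, map_smul,
        (hτ N').antisymm i j, smul_eq_mul]
      by_cases h : i + j = 0
      · rw [e1 h]
        ring
      · rw [hs j i (by omega), hs (i - 1) (j + 1) (by omega)]
        ring
    · intro n' f' y
      rw [tauLLX_inEdge_inEdge]
      change _ = (1 / 2 : K) * (pairLin D τ i j _ _ - (-1 : K) ^ (i * j) * pairLin D τ j i _ _)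
      rw [pairLin_inEdge D τ rfl, pairLin_inEdge D τ rfl, edgeProj_inEdge, edgeProj_inEdge,
        map_smul, map_smul, (hτ f'.tgt).antisymm (i + 1) (j - 1), e2, smul_eq_mul, smul_eq_mul,
        sub_add_cancel]
      by_cases h : i + j = 0
      · rw [e1 h]
        linear_combination (-(1 / 2 : K) * (-1 : K) ^ (i * j) * (-1 : K) ^ j *
          τ f'.tgt (j - 1) (i + 1) (arrLin X f' (j - 1) y)
            (xiLin D (n', f') (n, f) (i - 1) (i + 1) x)) * e4
      · rw [hs (j - 1) (i + 1) (by omega), hs (i - 1) (j + 1) (by omega)]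
        ring

/-! ### Invariance under translations of the spiral. -/

theorem tgtNear_shift (n k m : ℤ) (N : Obj) (f : Arr) :
    Edge.TgtNear (m + k, f) (n + k, N) ↔ Edge.TgtNear (m, f) (n, N) := by
  simp only [Edge.TgtNear, Edge.shift_src, dist_shift, Edge.tgt]

theorem srcNear_shift (n k m : ℤ) (N : Obj) (f : Arr) :
    Edge.SrcNear (m + k, f) (n + k, N) ↔ Edge.SrcNear (m, f) (n, N) := by
  simp only [Edge.SrcNear, Edge.shift_src, dist_shift, Edge.tgt]

theorem zigLin_shift (n k n' : ℤ) (N N' : Obj) (i : ℤ) :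
    zigLin D (n + k) N (n' + k) N' i = zigLin D n N n' N' i := by
  rw [zigLin, zigzag_shift]
  rfl

theorem gamLin_shift (n k m : ℤ) (N : Obj) (f : Arr) (i j : ℤ) :
    gamLin D (n + k) N (m + k, f) i j = gamLin D n N (m, f) i j := by
  rcases Edge.tgtNear_or (m, f) (n, N) with h | h
  · rw [gamLin_of_tgtNear D h, gamLin_of_tgtNear D ((tgtNear_shift n k m N f).2 h)]
  · apply LinearMap.ext
    intro x
    rw [gamLin_of_srcNear D h, gamLin_of_srcNear D ((srcNear_shift n k m N f).2 h),
      add_right_comm m k, zigLin_shift]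

theorem lamLin_shift (n k m : ℤ) (N : Obj) (f : Arr) (i j : ℤ) :
    lamLin D (m + k, f) (n + k) N i j = lamLin D (m, f) n N i j := by
  rcases Edge.tgtNear_or (m, f) (n, N) with h | h
  · apply LinearMap.ext
    intro x
    rw [lamLin_of_tgtNear D h, lamLin_of_tgtNear D ((tgtNear_shift n k m N f).2 h), zigLin_shift]
  · rw [lamLin_of_srcNear D h, lamLin_of_srcNear D ((srcNear_shift n k m N f).2 h)]

theorem xiLin_shift (m k m' : ℤ) (f f' : Arr) (i j : ℤ) :
    xiLin D (m + k, f) (m' + k, f') i j = xiLin D (m, f) (m', f') i j := by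
  have hn : Edge.TgtNear (m, f) (Edge.src (m', f')) ↔
      Edge.TgtNear (m + k, f) (Edge.src (m' + k, f')) := by
    rw [Edge.shift_src, tgtNear_shift]
  have hs : Edge.SrcNear (m, f) (Edge.src (m', f')) ↔
      Edge.SrcNear (m + k, f) (Edge.src (m' + k, f')) := by
    rw [Edge.shift_src, srcNear_shift]
  have hn' : Edge.TgtNear (m', f') (Edge.tgt (m, f)) ↔
      Edge.TgtNear (m' + k, f') (Edge.tgt (m + k, f)) :=
    (tgtNear_shift m k m' f.tgt f').symm
  have hs' : Edge.SrcNear (m', f') (Edge.tgt (m, f)) ↔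
      Edge.SrcNear (m' + k, f') (Edge.tgt (m + k, f)) :=
    (srcNear_shift m k m' f.tgt f').symm
  by_cases h : (m', f') = (m, f)
  · obtain ⟨rfl, rfl⟩ := Prod.mk.inj h
    apply LinearMap.ext
    intro x
    rw [xiLin_self, xiLin_self]
  have h' : (m' + k, f') ≠ (m + k, f) := fun e => h (by
    obtain ⟨e, rfl⟩ := Prod.mk.inj e
    obtain rfl : m' = m := by omega
    rfl)
  rcases Edge.tgtNear_or (m, f) (Edge.src (m', f')) with h1 | h1
  · rcases Edge.tgtNear_or (m', f') (Edge.tgt (m, f)) with h2 | h2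
    · rw [xiLin_eq_zero D h (Or.inl h2), xiLin_eq_zero D h' (Or.inl (hn'.1 h2))]
    · apply LinearMap.ext
      intro x
      rw [xiLin_facing D h h2 h1 rfl, xiLin_facing D h' (hs'.1 h2) (hn.1 h1) rfl,
        add_right_comm m' k, zigLin_shift]
  · rw [xiLin_eq_zero D h (Or.inr h1), xiLin_eq_zero D h' (Or.inr (hs.1 h1))]

variable (X) in
theorem shiftLL_inVert (k m n : ℤ) (N : Obj) (x : (X.obj N).X m) :
    shiftLL X k m (inVert X m n N x) = inVert X m (n + k) N x :=
  descLL_inVert _ _ _ _ _ _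

variable (X) in
theorem shiftLL_inEdge (k m n : ℤ) (f : Arr) (x : (X.obj f.src).X (m - 1)) :
    shiftLL X k m (inEdge X m n f x) = inEdge X m (n + k) f x :=
  descLL_inEdge _ _ _ _ _ _

theorem vertProj_shift (n k : ℤ) (N : Obj) (i : ℤ) (ω : LLX X i) :
    vertProj D (n + k) N i (shiftLL X k i ω) = vertProj D n N i ω := by
  suffices h : vertProj D (n + k) N i ∘ₗ shiftLL X k i = vertProj D n N i from
    LinearMap.congr_fun h ω
  apply LLX_hom_ext
  · intro n' N' x
    rw [LinearMap.comp_apply, shiftLL_inVert, vertProj_inVert, vertProj_inVert, zigLin_shift]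
  · intro n' f x
    rw [LinearMap.comp_apply, shiftLL_inEdge, vertProj_inEdge, vertProj_inEdge, gamLin_shift]

theorem edgeProj_shift (n k : ℤ) (f : Arr) (i j : ℤ) (ω : LLX X i) :
    edgeProj D (n + k, f) i j (shiftLL X k i ω) = edgeProj D (n, f) i j ω := by
  suffices h : edgeProj D (n + k, f) i j ∘ₗ shiftLL X k i = edgeProj D (n, f) i j from
    LinearMap.congr_fun h ω
  apply LLX_hom_ext
  · intro n' N' x
    rw [LinearMap.comp_apply, shiftLL_inVert, edgeProj_inVert, edgeProj_inVert, lamLin_shift]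
  · intro n' f' x
    rw [LinearMap.comp_apply, shiftLL_inEdge, edgeProj_inEdge, edgeProj_inEdge, xiLin_shift]

theorem pairLin_shift (k i j : ℤ) (ω : LLX X i) (ω' : LLX X j) :
    pairLin D τ i j (shiftLL X k i ω) (shiftLL X k j ω') = pairLin D τ i j ω ω' := by
  suffices h : (pairLin D τ i j).compl₁₂ (shiftLL X k i) (shiftLL X k j) = pairLin D τ i j from
    LinearMap.congr_fun (LinearMap.congr_fun h ω) ω'
  apply LLX_hom_ext
  · intro n N x
    apply LinearMap.ext
    intro ω'
    rw [LinearMap.compl₁₂_apply, shiftLL_inVert, pairLin_inVert, pairLin_inVert, vertProj_shift]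
  · intro n f x
    apply LinearMap.ext
    intro ω'
    rw [LinearMap.compl₁₂_apply, shiftLL_inEdge, pairLin_inEdge D τ rfl, pairLin_inEdge D τ rfl,
      edgeProj_shift]

theorem skew_pairLin_shift (k i j : ℤ) (ω : LLX X i) (ω' : LLX X j) :
    skew (V := LLobj X) (pairLin D τ) i j (shiftLL X k i ω) (shiftLL X k j ω') =
      skew (V := LLobj X) (pairLin D τ) i j ω ω' :=
  congrArg₂ (fun a b => (1 / 2 : K) * (a - (-1 : K) ^ (i * j) * b))
    (pairLin_shift D k i j ω ω') (pairLin_shift D k j i ω' ω)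

end Projections

theorem poissonFamily (L : Obj ⥤ PoCh K) :
    PoissonFamily (X := observables L) (fun N => (L.obj N).τ) where
  isPoisson N := (L.obj N).isPoisson
  natural f := (L.map f.hom).compat

theorem tauL_eq_skew (L : Obj ⥤ PoCh K) (D : CoherenceData (observables L)) (p : BZ) :
    tauL L D p = skew (V := LLobj (observables L)) (pairLin D fun N => (L.obj N).τ) := by
  funext i j
  exact tauLLX_eq_skew D (poissonFamily L).isPoisson i j

theorem isPoissonOn_tauL (L : Obj ⥤ PoCh K) (D : CoherenceData (observables L)) :
    IsPoissonOn (LL (observables L)) (tauL L D) where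
  isPoisson p := by
    rw [tauL_eq_skew]
    exact isPoisson_skew_pairLin D (poissonFamily L)
  natural {p q} k i j x y := by
    rw [tauL_eq_skew, tauL_eq_skew]
    exact skew_pairLin_shift D (τ := fun N => (L.obj N).τ)
      (Multiplicative.toAdd (k : Multiplicative ℤ)) i j x y

/-! ### The inclusion of a vertex is a quasi-isomorphism -/

section Inclusion

variable (X : Obj ⥤ Ch K)

/-- The chain map `x ↦ (n, N, x)`. -/
def inVertHom (n : ℤ) (N : Obj) : X.obj N ⟶ LLobj X where
  f i := ModuleCat.ofHom (inVert X i n N)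
  comm' i j _ := by
    ext x
    exact dLL_inVert X i j n N x

/-- The component over a vertex. -/
def vertComp (v : Vert) (i : ℤ) : LLX X i →ₗ[K] (X.obj v.2).X i :=
  DirectSum.component K Vert (fun v => (X.obj v.2).X i) v ∘ₗ LinearMap.fst K _ _

/-- The component over an edge. -/
def edgeComp (a : Edge) (i : ℤ) : LLX X i →ₗ[K] (X.obj a.2.src).X (i - 1) :=
  DirectSum.component K Edge (fun a => (X.obj a.2.src).X (i - 1)) a ∘ₗ LinearMap.snd K _ _

theorem vertComp_inVert_self (v : Vert) (i : ℤ) (x : (X.obj v.2).X i) :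
    vertComp X v i (inVert X i v.1 v.2 x) = x :=
  DirectSum.component.lof_self K (M := fun v : Vert => (X.obj v.2).X i) v x

theorem vertComp_inVert_of_ne {v : Vert} {n : ℤ} {N : Obj} (h : (n, N) ≠ v) (i : ℤ)
    (x : (X.obj N).X i) : vertComp X v i (inVert X i n N x) = 0 :=
  DirectSum.of_eq_of_ne (β := fun v : Vert => (X.obj v.2).X i) (n, N) v x h.symm

theorem edgeComp_inVert (a : Edge) (i n : ℤ) (N : Obj) (x : (X.obj N).X i) :
    edgeComp X a i (inVert X i n N x) = 0 :=
  map_zero (DirectSum.component K Edge (fun a => (X.obj a.2.src).X (i - 1)) a)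

theorem edgeComp_inEdge_self (a : Edge) (i : ℤ) (x : (X.obj a.2.src).X (i - 1)) :
    edgeComp X a i (inEdge X i a.1 a.2 x) = x :=
  DirectSum.component.lof_self K (M := fun a : Edge => (X.obj a.2.src).X (i - 1)) a x

theorem edgeComp_inEdge_of_ne {a : Edge} {n : ℤ} {f : Arr} (h : (n, f) ≠ a) (i : ℤ)
    (x : (X.obj f.src).X (i - 1)) : edgeComp X a i (inEdge X i n f x) = 0 :=
  DirectSum.of_eq_of_ne (β := fun a : Edge => (X.obj a.2.src).X (i - 1)) (n, f) a x h.symm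

theorem edgeComp_deltaLL (a : Edge) (i j n : ℤ) (f : Arr) (x : (X.obj f.src).X (i - 1)) :
    edgeComp X a j (deltaLL X i j n f x) = 0 := by
  rw [deltaLL, LinearMap.smul_apply, map_smul, LinearMap.sub_apply, map_sub]
  refine (congrArg _ (congrArg₂ (· - ·) (edgeComp_inVert X a j _ _ _)
    (edgeComp_inVert X a j _ _ _))).trans ?_
  rw [sub_self, smul_zero]

/-- The vertical differential lands in the vertices, so projecting to an edge is compatible with the
internal differentials. -/
theorem edgeComp_d (a : Edge) (i j : ℤ) (ω : LLX X i) :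
    edgeComp X a j (dLL X i j ω) = dLin a.2.src (i - 1) (j - 1) (edgeComp X a i ω) := by
  suffices h : edgeComp X a j ∘ₗ dLL X i j = dLin a.2.src (i - 1) (j - 1) ∘ₗ edgeComp X a i from
    LinearMap.congr_fun h ω
  apply LLX_hom_ext
  · intro n N x
    rw [LinearMap.comp_apply, LinearMap.comp_apply, dLL_inVert, edgeComp_inVert, edgeComp_inVert,
      map_zero]
  · intro n f x
    rw [LinearMap.comp_apply, LinearMap.comp_apply, dLL, descLL_inEdge, LinearMap.add_apply,
      map_add, edgeComp_deltaLL, zero_add, LinearMap.comp_apply]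
    by_cases h : (n, f) = a
    · subst h
      exact (edgeComp_inEdge_self X (n, f) j _).trans
        (congrArg _ (edgeComp_inEdge_self X (n, f) i x).symm)
    · exact (edgeComp_inEdge_of_ne X h j _).trans
        ((congrArg _ (edgeComp_inEdge_of_ne X h i x)).trans (map_zero _)).symm

variable {X} (D : CoherenceData X)

/-- The projection to the vertex `(n, N)`, restricted to the part of the spiral on the right of
`(n, N)`. -/
def halfProj (n : ℤ) (N : Obj) (i : ℤ) : LLX X i →ₗ[K] (X.obj N).X i :=
  descLL (fun v => if Vert.pos (n, N) ≤ v.pos then zigLin D v.1 v.2 n N i else 0)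
    (fun a => if Vert.pos (n, N) ≤ a.src.pos ∧ Vert.pos (n, N) ≤ a.tgt.pos then
      (-1 : K) ^ i • gamLin D n N a (i - 1) i else 0)

theorem halfProj_inVert_of_le {n n' : ℤ} {N N' : Obj} (h : Vert.pos (n, N) ≤ Vert.pos (n', N'))
    (i : ℤ) (x : (X.obj N').X i) :
    halfProj D n N i (inVert X i n' N' x) = zigLin D n' N' n N i x := by
  rw [halfProj, descLL_inVert, if_pos h]

theorem halfProj_inVert_of_lt {n n' : ℤ} {N N' : Obj} (h : Vert.pos (n', N') < Vert.pos (n, N))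
    (i : ℤ) (x : (X.obj N').X i) : halfProj D n N i (inVert X i n' N' x) = 0 := by
  rw [halfProj, descLL_inVert, if_neg (not_le.2 h), LinearMap.zero_apply]

theorem halfProj_inEdge_of_le {n n' : ℤ} {N : Obj} {f : Arr}
    (h : Vert.pos (n, N) ≤ (Edge.src (n', f)).pos) (h' : Vert.pos (n, N) ≤ (Edge.tgt (n', f)).pos)
    (i : ℤ) (x : (X.obj f.src).X (i - 1)) :
    halfProj D n N i (inEdge X i n' f x) = (-1 : K) ^ i • gamLin D n N (n', f) (i - 1) i x := by
  rw [halfProj, descLL_inEdge, if_pos ⟨h, h'⟩, LinearMap.smul_apply]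

theorem halfProj_inEdge_of_lt {n n' : ℤ} {N : Obj} {f : Arr}
    (h : (Edge.src (n', f)).pos < Vert.pos (n, N) ∨ (Edge.tgt (n', f)).pos < Vert.pos (n, N))
    (i : ℤ) (x : (X.obj f.src).X (i - 1)) :
    halfProj D n N i (inEdge X i n' f x) = 0 := by
  rw [halfProj, descLL_inEdge, if_neg (by omega), LinearMap.zero_apply]

theorem halfProj_d_inVert (n n' : ℤ) (N N' : Obj) (i : ℤ) (x : (X.obj N').X i) :
    halfProj D n N (i - 1) (dLL X i (i - 1) (inVert X i n' N' x)) =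
      dLin N i (i - 1) (halfProj D n N i (inVert X i n' N' x)) := by
  rw [dLL_inVert]
  rcases le_or_gt (Vert.pos (n, N)) (Vert.pos (n', N')) with h | h
  · rw [halfProj_inVert_of_le D h, halfProj_inVert_of_le D h, zigLin_d]
  · rw [halfProj_inVert_of_lt D h, halfProj_inVert_of_lt D h, map_zero]

theorem halfProj_d_inEdge {n n' : ℤ} {N : Obj} {f : Arr}
    (h : Vert.pos (n, N) ≤ (Edge.src (n', f)).pos ↔ Vert.pos (n, N) ≤ (Edge.tgt (n', f)).pos)
    (i : ℤ) (x : (X.obj f.src).X (i - 1)) :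
    halfProj D n N (i - 1) (dLL X i (i - 1) (inEdge X i n' f x)) =
      dLin N i (i - 1) (halfProj D n N i (inEdge X i n' f x)) := by
  rw [dLL_inEdge, map_add, map_smul, map_sub]
  rcases le_or_gt (Vert.pos (n, N)) (Edge.src (n', f)).pos with h1 | h1
  · have h2 := h.1 h1
    have h3 := gamLin_d D (n', f) n N (sub_add_cancel i 1) (sub_add_cancel (i - 1) 1) x
    have h1' : Vert.pos (n, N) ≤ Vert.pos (n' + f.winding, f.src) := h1
    have h2' : Vert.pos (n, N) ≤ Vert.pos (n', f.tgt) := h2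
    rw [halfProj_inEdge_of_le D h1 h2, halfProj_inEdge_of_le D h1 h2, halfProj_inVert_of_le D h1',
      halfProj_inVert_of_le D h2', map_smul, eq_sub_of_add_eq h3, neg_one_zpow_pred]
    module
  · have h2 : (Edge.tgt (n', f)).pos < Vert.pos (n, N) := by omega
    have h1' : Vert.pos (n' + f.winding, f.src) < Vert.pos (n, N) := h1
    have h2' : Vert.pos (n', f.tgt) < Vert.pos (n, N) := h2
    rw [halfProj_inEdge_of_lt D (Or.inl h1), halfProj_inEdge_of_lt D (Or.inl h1),
      halfProj_inVert_of_lt D h1', halfProj_inVert_of_lt D h2']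
    simp

/-- Cutting the spiral at `a` drops the edge and keeps the end at which the half-line starts. Every
other edge lies wholly inside or wholly outside, so the only failure to be a chain map is the
component over `a`. -/
theorem halfProj_d_of_src (a : Edge) (h : a.src.pos = a.tgt.pos + 1) (i : ℤ) (ω : LLX X i) :
    halfProj D (a.1 + a.2.winding) a.2.src (i - 1) (dLL X i (i - 1) ω) =
      dLin a.2.src i (i - 1) (halfProj D (a.1 + a.2.winding) a.2.src i ω) +
        (-1 : K) ^ (i - 1) • edgeComp X a i ω := by
  suffices h : halfProj D (a.1 + a.2.winding) a.2.src (i - 1) ∘ₗ dLL X i (i - 1) =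
      dLin a.2.src i (i - 1) ∘ₗ halfProj D (a.1 + a.2.winding) a.2.src i +
        (-1 : K) ^ (i - 1) • edgeComp X a i from LinearMap.congr_fun h ω
  have hu : Vert.pos (a.1 + a.2.winding, a.2.src) = a.src.pos := rfl
  apply LLX_hom_ext
  · intro n' N' x
    simp only [LinearMap.comp_apply, LinearMap.add_apply, LinearMap.smul_apply]
    rw [halfProj_d_inVert, edgeComp_inVert, smul_zero, add_zero]
  · intro n' f x
    simp only [LinearMap.comp_apply, LinearMap.add_apply, LinearMap.smul_apply]
    by_cases hf : (n', f) = a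
    · subst hf
      have h1 : Vert.pos (n' + f.winding, f.src) ≤ Vert.pos (n' + f.winding, f.src) := le_rfl
      have h2 : Vert.pos (n', f.tgt) < Vert.pos (n' + f.winding, f.src) := by
        change (Edge.tgt (n', f)).pos < (Edge.src (n', f)).pos
        omega
      rw [edgeComp_inEdge_self X (n', f), halfProj_inEdge_of_lt D (Or.inr h2), map_zero, zero_add,
        dLL_inEdge, map_add, map_smul, map_sub, halfProj_inVert_of_le D h1,
        halfProj_inVert_of_lt D h2, halfProj_inEdge_of_lt D (Or.inr h2), zigLin_self, sub_zero,
        add_zero]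
    · rw [edgeComp_inEdge_of_ne X hf, smul_zero, add_zero]
      apply halfProj_d_inEdge
      rw [hu]
      have h1 := Edge.pos_src_tgt (n', f)
      have h2 : ¬ ((Edge.src (n', f)).pos + (Edge.tgt (n', f)).pos = a.src.pos + a.tgt.pos) :=
        fun e => hf (Edge.eq_of_pos e)
      omega

/-- If the arrow points to the right, the half-line starts at its target, so the defect is the image
of the edge component under `X(f)`. -/
theorem halfProj_d_of_tgt (a : Edge) (h : a.tgt.pos = a.src.pos + 1) (i : ℤ) (ω : LLX X i) :
    halfProj D a.1 a.2.tgt (i - 1) (dLL X i (i - 1) ω) =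
      dLin a.2.tgt i (i - 1) (halfProj D a.1 a.2.tgt i ω) -
        (-1 : K) ^ (i - 1) • arrLin X a.2 (i - 1) (edgeComp X a i ω) := by
  suffices h : halfProj D a.1 a.2.tgt (i - 1) ∘ₗ dLL X i (i - 1) =
      dLin a.2.tgt i (i - 1) ∘ₗ halfProj D a.1 a.2.tgt i -
        (-1 : K) ^ (i - 1) • arrLin X a.2 (i - 1) ∘ₗ edgeComp X a i from LinearMap.congr_fun h ω
  have hu : Vert.pos (a.1, a.2.tgt) = a.tgt.pos := rfl
  apply LLX_hom_ext
  · intro n' N' x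
    simp only [LinearMap.comp_apply, LinearMap.sub_apply, LinearMap.smul_apply]
    rw [halfProj_d_inVert, edgeComp_inVert, map_zero, smul_zero, sub_zero]
  · intro n' f x
    simp only [LinearMap.comp_apply, LinearMap.sub_apply, LinearMap.smul_apply]
    by_cases hf : (n', f) = a
    · subst hf
      have h1 : Vert.pos (n', f.tgt) ≤ Vert.pos (n', f.tgt) := le_rfl
      have h2 : Vert.pos (n' + f.winding, f.src) < Vert.pos (n', f.tgt) := by
        change (Edge.src (n', f)).pos < (Edge.tgt (n', f)).pos
        omega
      rw [edgeComp_inEdge_self X (n', f), halfProj_inEdge_of_lt D (Or.inl h2), map_zero, zero_sub,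
        dLL_inEdge, map_add, map_smul, map_sub, halfProj_inVert_of_le D h1,
        halfProj_inVert_of_lt D h2, halfProj_inEdge_of_lt D (Or.inl h2), zigLin_self, zero_sub,
        add_zero, smul_neg]
    · rw [edgeComp_inEdge_of_ne X hf, map_zero, smul_zero, sub_zero]
      apply halfProj_d_inEdge
      rw [hu]
      have h1 := Edge.pos_src_tgt (n', f)
      have h2 : ¬ ((Edge.src (n', f)).pos + (Edge.tgt (n', f)).pos = a.src.pos + a.tgt.pos) :=
        fun e => hf (Edge.eq_of_pos e)
      omega

/-- The components over the edges of a cycle are boundaries. -/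
theorem exists_edgeComp_boundary (D : CoherenceData X) (hX : HoTimeSliceCh X) (a : Edge) (i : ℤ) (ω : LLX X i)
    (hω : dLL X i (i - 1) ω = 0) :
    ∃ z : (X.obj a.2.src).X i, edgeComp X a i ω = dLin a.2.src i (i - 1) z := by
  have e := CCRAlg.neg_one_zpow_mul_self (K := K) (i - 1)
  rcases a.pos_src_tgt with h | h
  · have h1 := halfProj_d_of_src D a h i ω
    rw [hω, map_zero] at h1
    refine ⟨-(-1 : K) ^ (i - 1) • halfProj D (a.1 + a.2.winding) a.2.src i ω, ?_⟩
    rw [map_smul, eq_neg_of_add_eq_zero_left h1.symm, smul_neg, neg_smul, neg_neg, smul_smul, e,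
      one_smul]
  · have h1 := halfProj_d_of_tgt D a h i ω
    rw [hω, map_zero] at h1
    -- Here the cut only shows that `X(f)` of the component is a boundary; injectivity of `X(f)` on
    -- homology transfers this to the component.
    refine exists_boundary_of_quasiIso (hX a.2.hom) (sub_add_cancel i 1)
      (sub_add_cancel (i - 1) 1) (edgeComp X a i ω) ?_
      ((-1 : K) ^ (i - 1) • halfProj D a.1 a.2.tgt i ω) ?_
    · have h2 := edgeComp_d X a i (i - 1) ω
      rw [hω, map_zero] at h2
      exact h2.symm
    · change arrLin X a.2 (i - 1) _ = dLin a.2.tgt i (i - 1) _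
      rw [map_smul, sub_eq_zero.1 h1.symm, smul_smul, e, one_smul]

/-- Every cycle over `v` is homologous to a cycle over `w`. -/
def Homologous (X : Obj ⥤ Ch K) (v w : Vert) : Prop :=
  ∀ (i : ℤ) (x : (X.obj v.2).X i), dLin v.2 i (i - 1) x = 0 →
    ∃ y : (X.obj w.2).X i, dLin w.2 i (i - 1) y = 0 ∧
      ∃ ζ : LLX X (i + 1), inVert X i v.1 v.2 x = inVert X i w.1 w.2 y + dLL X (i + 1) i ζ

theorem Homologous.refl (v : Vert) : Homologous X v v := fun i x hx =>
  ⟨x, hx, 0, by rw [map_zero, add_zero]⟩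

theorem Homologous.trans {v w z : Vert} (h : Homologous X v w) (h' : Homologous X w z) :
    Homologous X v z := fun i x hx => by
  obtain ⟨y, hy, ζ, e⟩ := h i x hx
  obtain ⟨y', hy', ζ', e'⟩ := h' i y hy
  exact ⟨y', hy', ζ + ζ', by rw [e, e', map_add]; abel⟩

/-- The boundary of an element over an edge that is a cycle. -/
theorem dLL_inEdge_cycle {i j : ℤ} (hij : j + 1 = i) (a : Edge)
    (x : (X.obj a.2.src).X j) (hx : dLin a.2.src j (j - 1) x = 0) :
    ∃ ζ : LLX X i, inVert X j a.src.1 a.2.src x =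
      inVert X j a.1 a.2.tgt (arrLin X a.2 j x) + dLL X i j ζ := by
  obtain rfl : j = i - 1 := by omega
  refine ⟨(-1 : K) ^ (i - 1) • inEdge X i a.1 a.2 x, ?_⟩
  rw [map_smul, dLL_inEdge, hx, map_zero, add_zero, smul_smul, CCRAlg.neg_one_zpow_mul_self,
    one_smul]
  exact (add_sub_cancel _ _).symm

theorem homologous_src_tgt (a : Edge) : Homologous X a.src a.tgt := fun i x hx => by
  obtain ⟨ζ, h⟩ := dLL_inEdge_cycle rfl a x hx
  refine ⟨arrLin X a.2 i x, ?_, ζ, h⟩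
  exact (arrLin_d a.2 i (i - 1) x).symm.trans ((congrArg _ hx).trans (map_zero _))

/-- Moving a cycle against the arrow requires a preimage up to a boundary, which the
quasi-isomorphism provides. -/
theorem homologous_tgt_src (hX : HoTimeSliceCh X) (a : Edge) : Homologous X a.tgt a.src :=
  fun i x hx => by
    obtain ⟨y, hy, z, h⟩ := exists_cycle_of_quasiIso (hX a.2.hom) rfl (sub_add_cancel i 1) x hx
    obtain ⟨ζ, hζ⟩ := dLL_inEdge_cycle rfl a y hy
    refine ⟨y, hy, inVert X (i + 1) a.1 a.2.tgt z - ζ, ?_⟩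
    rw [map_sub, dLL_inVert]
    refine (congrArg (inVert X i a.1 a.2.tgt) h).trans ?_
    rw [map_add]
    refine Eq.symm ((congrArg₂ (· + ·) hζ rfl).trans ?_)
    change _ + _ + (_ - _) = inVert X i a.1 a.2.tgt (arrLin X a.2 i y) + _
    abel

theorem homologous_next (hX : HoTimeSliceCh X) (v : Vert) :
    Homologous X v v.next ∧ Homologous X v.next v := by
  obtain ⟨n, N⟩ := v
  have e : ∀ f : Arr, f.winding = 0 → Edge.src (n, f) = (n, f.src) := fun f h =>
    Prod.ext (by simp [Edge.src, h]) rfl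
  cases N
  · exact ⟨homologous_tgt_src hX (n, .iminus), homologous_src_tgt (n, .iminus)⟩
  · have := e .iplus rfl
    have h1 := homologous_src_tgt (X := X) (n, .iplus)
    have h2 := homologous_tgt_src hX (n, .iplus)
    rw [this] at h1 h2
    exact ⟨h1, h2⟩
  · have := e .jplus rfl
    have h1 := homologous_src_tgt (X := X) (n, .jplus)
    have h2 := homologous_tgt_src hX (n, .jplus)
    rw [this] at h1 h2
    exact ⟨h2, h1⟩
  · have := e .jminus rfl
    have h1 := homologous_src_tgt (X := X) (n, .jminus)
    have h2 := homologous_tgt_src hX (n, .jminus)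
    rw [this] at h1 h2
    exact ⟨h1, h2⟩

theorem homologous_of_le (hX : HoTimeSliceCh X) {v w : Vert} (h : v.pos ≤ w.pos) :
    Homologous X v w ∧ Homologous X w v := by
  obtain ⟨k, hk⟩ := Int.le.dest h
  induction k generalizing v with
  | zero =>
    obtain rfl : v = w := Vert.pos_injective (by simpa using hk)
    exact ⟨.refl v, .refl v⟩
  | succ k ih =>
    have h1 := homologous_next hX v
    have h2 := ih (v := v.next) (by rw [Vert.pos_next]; omega) (by rw [Vert.pos_next]; omega)
    exact ⟨h1.1.trans h2.1, h2.2.trans h1.2⟩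

theorem homologous (hX : HoTimeSliceCh X) (v w : Vert) : Homologous X v w := by
  rcases le_total v.pos w.pos with h | h
  · exact (homologous_of_le hX h).1
  · exact (homologous_of_le hX h).2

variable (X) in
theorem vertComp_d_of_snd_eq_zero (v : Vert) (i j : ℤ) (ω : LLX X i) (h : ω.2 = 0) :
    vertComp X v j (dLL X i j ω) = dLin v.2 i j (vertComp X v i ω) := by
  obtain ⟨y, e⟩ := ω
  obtain rfl : e = 0 := h
  suffices h : vertComp X v j ∘ₗ dLL X i j ∘ₗ LinearMap.inl K _ _ =
      dLin v.2 i j ∘ₗ vertComp X v i ∘ₗ LinearMap.inl K _ _ from LinearMap.congr_fun h y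
  apply DirectSum.linearMap_ext
  rintro ⟨n, N⟩
  ext x
  change vertComp X v j (dLL X i j (inVert X i n N x)) =
    dLin v.2 i j (vertComp X v i (inVert X i n N x))
  rw [dLL_inVert]
  by_cases h : (n, N) = v
  · subst h
    exact (vertComp_inVert_self X (n, N) j _).trans
      (congrArg _ (vertComp_inVert_self X (n, N) i x).symm)
  · rw [vertComp_inVert_of_ne X h, vertComp_inVert_of_ne X h, map_zero]

theorem vertProj_d' (n : ℤ) (N : Obj) {i j : ℤ} (h : j + 1 = i) (ω : LLX X i) :
    vertProj D n N j (dLL X i j ω) = dLin N i j (vertProj D n N i ω) := by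
  obtain rfl : j = i - 1 := by omega
  exact vertProj_d D n N i ω

variable (X) in
theorem sum_inVert_vertComp (i : ℤ) [∀ (v : Vert) (x : (X.obj v.2).X i), Decidable (x ≠ 0)]
    (ω : LLX X i) (h : ω.2 = 0) :
    ∑ v ∈ ω.1.support, inVert X i v.1 v.2 (vertComp X v i ω) = ω := by
  refine Prod.ext ?_ ?_
  · rw [Prod.fst_sum]
    exact DirectSum.sum_support_of ω.1
  · rw [Prod.snd_sum, h]
    exact Finset.sum_eq_zero fun _ _ => rfl

/-- Injectivity on homology comes from the retraction `vertProj`. For surjectivity, a cycle is first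
made free of edge components; its vertex components are then cycles, finitely many, and each can be
moved along the spiral to `(n, N)`. -/
theorem quasiIso_inVertHom (D : CoherenceData X) (hX : HoTimeSliceCh X) (n : ℤ) (N : Obj) :
    QuasiIso (inVertHom X n N) := by
  classical
  rw [quasiIso_iff_elements]
  intro i
  constructor
  · intro ω hω
    choose z hz using fun a => exists_edgeComp_boundary D hX a i ω hω
    let ω' : LLX X i := ω
    -- Restricting to the support makes the sum finite. Nothing is lost, as the edge component to be
    -- cancelled is zero elsewhere.
    let ζ : LLX X (i + 1) := ∑ a ∈ ω'.2.support,
      inEdge X (i + 1) a.1 a.2 ((idOfEq _ i (i + 1 - 1)).hom (z a))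
    have h2 : (ω' - dLL X (i + 1) i ζ).2 = 0 := by
      refine DirectSum.ext_component K fun a => ?_
      change edgeComp X a i (ω' - dLL X (i + 1) i ζ) = edgeComp X a i 0
      rw [map_zero, map_sub, sub_eq_zero, edgeComp_d, map_sum, map_sum,
        Finset.sum_eq_single a]
      · rw [edgeComp_inEdge_self X a]
        exact (hz a).trans (d_idOfEq _ (by ring) _ _).symm
      · intro b _ hb
        rw [edgeComp_inEdge_of_ne X (a := a) (n := b.1) (f := b.2) hb, map_zero]
      · intro ha
        have h0 : edgeComp X a i ω' = 0 := DFinsupp.notMem_support_iff.1 ha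
        rw [edgeComp_inEdge_self X a]
        exact ((d_idOfEq _ (by ring) _ _).trans (hz a).symm).trans h0
    have h3 : dLL X i (i - 1) (ω' - dLL X (i + 1) i ζ) = 0 := by
      rw [map_sub]
      have := d_d_apply (LLobj X) (i + 1) i (i - 1) ζ
      exact (congrArg₂ (· - ·) hω this).trans (sub_zero _)
    suffices h : ∃ y : (X.obj N).X i, dLin N i (i - 1) y = 0 ∧ ∃ ξ : LLX X (i + 1),
        ω' - dLL X (i + 1) i ζ = inVert X i n N y + dLL X (i + 1) i ξ by
      obtain ⟨y, hy, ξ, e⟩ := h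
      refine ⟨y, hy, (ξ + ζ : LLX X (i + 1)), ?_⟩
      change ω' = inVert X i n N y + dLL X (i + 1) i (ξ + ζ)
      rw [map_add, ← add_assoc, ← e, sub_add_cancel]
    rw [← sum_inVert_vertComp X i _ h2]
    refine Finset.sum_induction _ (fun θ : LLX X i => ∃ y : (X.obj N).X i,
      dLin N i (i - 1) y = 0 ∧ ∃ ξ : LLX X (i + 1), θ = inVert X i n N y + dLL X (i + 1) i ξ)
      ?_ ?_ ?_
    · rintro _ _ ⟨y, hy, ξ, rfl⟩ ⟨y', hy', ξ', rfl⟩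
      refine ⟨y + y', by rw [map_add, hy, hy', add_zero], ξ + ξ', ?_⟩
      rw [map_add, map_add]
      abel
    · exact ⟨0, map_zero _, 0, by rw [map_zero, map_zero, add_zero]⟩
    · intro v _
      refine homologous hX v (n, N) i _ ?_
      rw [← vertComp_d_of_snd_eq_zero X v i (i - 1) _ h2, h3, map_zero]
  · intro x _ ζ hζ
    have h1 : inVert X i n N x = dLL X (i + 1) i ζ := hζ
    have h2 := congrArg (vertProj D n N i) h1
    rw [vertProj_inVert, zigLin_self] at h2
    exact ⟨_, h2.trans (vertProj_d' D n N rfl ζ)⟩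

end Inclusion

/-! ### Closed pairings -/

section Pairings

variable {V W U : Ch K}

/-- The pairing is a chain map `V ⊗ V → K`. -/
structure IsClosedPairing (σ : Pairing V) : Prop where
  degree_zero : ∀ i j : ℤ, i + j ≠ 0 → σ i j = 0
  chain_map : ∀ (i j : ℤ) (x : V.X i) (y : V.X j),
    σ (i - 1) j ((V.d i (i - 1)).hom x) y + (-1 : K) ^ i * σ i (j - 1) x ((V.d j (j - 1)).hom y) = 0

theorem IsPoisson.isClosedPairing {σ : Pairing V} (h : IsPoisson σ) : IsClosedPairing σ :=
  ⟨h.degree_zero, h.chain_map⟩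

theorem IsClosedPairing.isPoisson {σ : Pairing V} (h : IsClosedPairing σ) : IsPoisson (skew σ) :=
  isPoisson_skew h.degree_zero h.chain_map

theorem IsPoisson.skew_eq [CharZero K] {σ : Pairing V} (h : IsPoisson σ) : skew σ = σ := by
  funext i j
  refine LinearMap.ext fun x => LinearMap.ext fun y => ?_
  rw [skew_apply, h.antisymm i j x y]
  field_simp
  ring

/-- The pullback of a pairing along a chain map. -/
def pull (f : V ⟶ W) (σ : Pairing W) : Pairing V := fun i j =>
  (σ i j).compl₁₂ (f.f i).hom (f.f j).hom

theorem pull_apply (f : V ⟶ W) (σ : Pairing W) (i j : ℤ) (x : V.X i) (y : V.X j) :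
    pull f σ i j x y = σ i j ((f.f i).hom x) ((f.f j).hom y) := rfl

theorem pull_skew (f : V ⟶ W) (σ : Pairing W) : pull f (skew σ) = skew (pull f σ) := rfl

theorem skew_natural (f : V ⟶ W) {σ : Pairing V} {σ' : Pairing W}
    (h : ∀ i j x y, σ' i j ((f.f i).hom x) ((f.f j).hom y) = σ i j x y) (i j : ℤ) (x : V.X i)
    (y : V.X j) : skew σ' i j ((f.f i).hom x) ((f.f j).hom y) = skew σ i j x y := by
  rw [skew_apply, skew_apply, h, h]

theorem IsClosedPairing.pull {σ : Pairing W} (h : IsClosedPairing σ) (f : V ⟶ W) :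
    IsClosedPairing (pull f σ) where
  degree_zero i j hij := by
    refine LinearMap.ext fun x => LinearMap.ext fun y => ?_
    rw [pull_apply, h.degree_zero i j hij]
    rfl
  chain_map i j x y := by
    rw [pull_apply, pull_apply, map_d_apply, map_d_apply]
    exact h.chain_map i j _ _

theorem IsPoisson.pull {σ : Pairing W} (h : IsPoisson σ) (f : V ⟶ W) : IsPoisson (pull f σ) where
  degree_zero := (h.isClosedPairing.pull f).degree_zero
  antisymm i j _ _ := h.antisymm i j _ _
  chain_map := (h.isClosedPairing.pull f).chain_map

/-- The boundary of a pairing. -/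
def dPairing (R : Pairing V) : Pairing V := fun i j =>
  (R (i - 1) j).comp (V.d i (i - 1)).hom + (-1 : K) ^ i • (R i (j - 1)).compl₂ (V.d j (j - 1)).hom

theorem dPairing_apply (R : Pairing V) (i j : ℤ) (x : V.X i) (y : V.X j) :
    dPairing R i j x y = R (i - 1) j ((V.d i (i - 1)).hom x) y +
      (-1 : K) ^ i * R i (j - 1) x ((V.d j (j - 1)).hom y) := rfl

theorem isClosedPairing_dPairing {R : Pairing V} (hR : ∀ i j : ℤ, i + j ≠ -1 → R i j = 0) :
    IsClosedPairing (dPairing R) where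
  degree_zero i j hij := by
    refine LinearMap.ext fun x => LinearMap.ext fun y => ?_
    rw [dPairing_apply, hR (i - 1) j (by omega), hR i (j - 1) (by omega)]
    simp
  chain_map i j x y := by
    rw [dPairing_apply, dPairing_apply, d_d_apply, d_d_apply, map_zero, map_zero,
      LinearMap.zero_apply, neg_one_zpow_pred]
    ring

theorem IsClosedPairing.sub {σ σ' : Pairing V} (h : IsClosedPairing σ) (h' : IsClosedPairing σ') :
    IsClosedPairing (σ - σ') where
  degree_zero i j hij := by
    rw [Pi.sub_apply, Pi.sub_apply, h.degree_zero i j hij, h'.degree_zero i j hij]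
    exact sub_zero (0 : V.X i →ₗ[K] V.X j →ₗ[K] K)
  chain_map i j x y := by
    simp only [Pi.sub_apply, LinearMap.sub_apply]
    linear_combination h.chain_map i j x y - h'.chain_map i j x y

end Pairings

/-! ### Weak equivalences from quasi-isomorphisms of Poisson complexes -/

theorem weakEquivTo_CCR [CharZero K] {F G : Obj ⥤ PoCh K} (φ : F ⟶ G)
    (h : ∀ N, QuasiIso (PoCh.Hom.f (φ.app N))) : WeakEquivTo (F ⋙ CCR K) (G ⋙ CCR K) :=
  ⟨Functor.whiskerRight φ (CCR K), fun N => weakEquiv_CCR (φ.app N) (h N)⟩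

/-- A natural transformation that is compatible with Poisson structures. -/
def poissonNatTrans {Y Y' : Obj ⥤ Ch K} {τ : ∀ N, Pairing (Y.obj N)} {τ' : ∀ N, Pairing (Y'.obj N)}
    (h : IsPoissonOn Y τ) (h' : IsPoissonOn Y' τ') (φ : Y ⟶ Y')
    (hφ : ∀ N, pull (φ.app N) (τ' N) = τ N) : h.toPoCh ⟶ h'.toPoCh where
  app N := ⟨φ.app N, fun i j x y =>
    LinearMap.congr_fun (LinearMap.congr_fun (congrFun (congrFun (hφ N) i) j) x) y⟩
  naturality _ _ f := PoCh.Hom.ext (φ.naturality f)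

/-! ### Interpolation between homotopic Poisson structures on a mapping cylinder. -/

section CylinderPairing

variable {Q B : Obj ⥤ Ch K} (u : Q ⟶ B) (σ : ∀ N, Pairing (B.obj N)) (R : ∀ N, Pairing (Q.obj N))

/-- The inclusion of the source of the mapping cylinder. -/
def cylFunctorιA : Q ⟶ cylFunctor u where
  app N := cylιA (u.app N)
  naturality N N' f := by
    ext i x
    change cylInA (u.app N') i (((Q.map f).f i).hom x) =
      ((cylMap (Q.map f) (B.map f) (u.naturality f)).f i).hom (cylInA (u.app N) i x)
    rw [cylMap_apply, cylA_inA, cylB_inA, cylE_inA]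
    simp

/-- The inclusion of the target of the mapping cylinder. -/
def cylFunctorιB : B ⟶ cylFunctor u where
  app N := cylιB (u.app N)
  naturality N N' f := by
    ext i x
    change cylInB (u.app N') i (((B.map f).f i).hom x) =
      ((cylMap (Q.map f) (B.map f) (u.naturality f)).f i).hom (cylInB (u.app N) i x)
    rw [cylMap_apply, cylA_inB, cylB_inB, cylE_inB]
    simp

/-- The pullback of a family of pairings to the source of the mapping cylinder. -/
def cylR (N : Obj) : Pairing (cyl (u.app N)) := fun i j =>
  (R N i j).compl₁₂ (cylA (u.app N) i) (cylA (u.app N) j)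

/-- A pairing on the mapping cylinder, restricting to `σ` on the target and to
`u^* σ - ∂R` on the source. -/
def cylPairing (N : Obj) : Pairing (cyl (u.app N)) :=
  pull (cylπ (u.app N)) (σ N) - dPairing (cylR u R N)

theorem cylPairing_apply (N : Obj) (i j : ℤ) (x : (cyl (u.app N)).X i) (y : (cyl (u.app N)).X j) :
    cylPairing u σ R N i j x y =
      σ N i j (((cylπ (u.app N)).f i).hom x) (((cylπ (u.app N)).f j).hom y) -
        (R N (i - 1) j (cylA _ _ (((cyl (u.app N)).d i (i - 1)).hom x)) (cylA _ _ y) +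
          (-1 : K) ^ i * R N i (j - 1) (cylA _ _ x)
            (cylA _ _ (((cyl (u.app N)).d j (j - 1)).hom y))) := rfl

variable {u σ R}

theorem isClosedPairing_cylPairing (hσ : ∀ N, IsClosedPairing (σ N))
    (hR : ∀ (N : Obj) (i j : ℤ), i + j ≠ -1 → R N i j = 0) (N : Obj) :
    IsClosedPairing (cylPairing u σ R N) := by
  refine ((hσ N).pull _).sub (isClosedPairing_dPairing fun i j h => ?_)
  rw [cylR, hR N i j h]
  rfl

theorem cylPairing_natural {N N' : Obj} (f : N ⟶ N')
    (hσ : pull (B.map f) (σ N') = σ N) (hR : ∀ i j x y, R N' i j (((Q.map f).f i).hom x)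
      (((Q.map f).f j).hom y) = R N i j x y) (i j : ℤ) (x : (cyl (u.app N)).X i)
    (y : (cyl (u.app N)).X j) : cylPairing u σ R N' i j
      (((cylMap (Q.map f) (B.map f) (u.naturality f)).f i).hom x)
      (((cylMap (Q.map f) (B.map f) (u.naturality f)).f j).hom y) = cylPairing u σ R N i j x y := by
  have hA : ∀ i (x : (cyl (u.app N)).X i), cylA (u.app N') i
      (((cylMap (Q.map f) (B.map f) (u.naturality f)).f i).hom x) =
        ((Q.map f).f i).hom (cylA (u.app N) i x) := by
    intro i x
    rw [cylMap_apply, map_add, map_add, cylA_inA, cylA_inB, cylA_inE, add_zero, add_zero]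
  have hπ : ∀ i (x : (cyl (u.app N)).X i),
      ((cylπ (u.app N')).f i).hom
        (((cylMap (Q.map f) (B.map f) (u.naturality f)).f i).hom x) =
          ((B.map f).f i).hom (((cylπ (u.app N)).f i).hom x) := by
    intro i x
    have hn : ((u.app N').f i).hom (((Q.map f).f i).hom (cylA (u.app N) i x)) =
        ((B.map f).f i).hom (((u.app N).f i).hom (cylA (u.app N) i x)) :=
      congrArg (fun φ => (φ.f i).hom (cylA (u.app N) i x)) (u.naturality f)
    rw [cylπ_apply, cylπ_apply, map_add, hA, hn, cylMap_apply, map_add, map_add, cylB_inA,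
      cylB_inB, cylB_inE, add_zero, zero_add]
  rw [cylPairing_apply, hπ, hπ, ← map_d_apply, ← map_d_apply, hA, hA, hA, hA, hR, hR,
    cylPairing_apply, ← hσ]
  rfl

theorem pull_cylιA_cylPairing (N : Obj) :
    pull (cylιA (u.app N)) (cylPairing u σ R N) = pull (u.app N) (σ N) - dPairing (R N) := by
  funext i j
  refine LinearMap.ext fun x => LinearMap.ext fun y => ?_
  rw [pull_apply]
  refine (cylPairing_apply u σ R N i j (cylInA (u.app N) i x) (cylInA (u.app N) j y)).trans ?_
  rw [cylπ_apply, cylπ_apply, cylA_d, cylA_d, cylA_inA, cylA_inA, cylB_inA, cylB_inA, cylE_inA,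
    cylE_inA, add_zero, add_zero, add_zero, add_zero]
  rfl

theorem pull_cylιB_cylPairing (N : Obj) :
    pull (cylιB (u.app N)) (cylPairing u σ R N) = σ N := by
  funext i j
  refine LinearMap.ext fun x => LinearMap.ext fun y => ?_
  rw [pull_apply]
  refine (cylPairing_apply u σ R N i j (cylInB (u.app N) i x) (cylInB (u.app N) j y)).trans ?_
  rw [cylπ_apply, cylπ_apply, cylA_d, cylA_d, cylA_inB, cylA_inB, cylB_inB, cylB_inB, cylE_inB,
    cylE_inB, map_zero, map_zero, map_zero, map_zero]
  simp

/-- Poisson structures that correspond to each other under a natural quasi-isomorphism up to an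
exact term have weakly equivalent quantizations. -/
theorem zigzagEquiv_of_homotopy [CharZero K] {τQ : ∀ N, Pairing (Q.obj N)}
    {τB : ∀ N, Pairing (B.obj N)} (hQ : IsPoissonOn Q τQ) (hB : IsPoissonOn B τB)
    (hu : ∀ N, QuasiIso (u.app N)) (hσ : ∀ N, IsClosedPairing (σ N))
    (hσn : ∀ {N N' : Obj} (f : N ⟶ N'), pull (B.map f) (σ N') = σ N)
    (hσB : ∀ N, τB N = skew (σ N))
    (hR : ∀ (N : Obj) (i j : ℤ), i + j ≠ -1 → R N i j = 0)
    (hRn : ∀ {N N' : Obj} (f : N ⟶ N') (i j x y), R N' i j (((Q.map f).f i).hom x)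
      (((Q.map f).f j).hom y) = R N i j x y)
    (hσQ : ∀ N, pull (u.app N) (σ N) = τQ N + dPairing (R N)) :
    ZigzagEquiv (hQ.toPoCh ⋙ CCR K) (hB.toPoCh ⋙ CCR K) := by
  -- Neither `σ` nor `R` is assumed antisymmetric, so antisymmetrization is applied once, on the
  -- whole cylinder. It commutes with restriction to the ends and leaves `τQ` unchanged.
  have hc : IsPoissonOn (cylFunctor u) (fun N => skew (cylPairing u σ R N)) :=
    { isPoisson := fun N => (isClosedPairing_cylPairing hσ hR N).isPoisson
      natural := fun {N N'} f i j x y => by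
        exact skew_natural (cylMap (Q.map f) (B.map f) (u.naturality f))
          (cylPairing_natural f (hσn f) (hRn f)) i j x y }
  have hA : ∀ N, pull (cylιA (u.app N)) (skew (cylPairing u σ R N)) = τQ N := fun N => by
    have e : τQ N + dPairing (R N) - dPairing (R N) = τQ N := by
      funext i j
      refine LinearMap.ext fun x => LinearMap.ext fun y => ?_
      exact add_sub_cancel_right (τQ N i j x y) (dPairing (R N) i j x y)
    rw [pull_skew, pull_cylιA_cylPairing, hσQ N, e, (hQ.isPoisson N).skew_eq]
  have hB' : ∀ N, pull (cylιB (u.app N)) (skew (cylPairing u σ R N)) = τB N := fun N => by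
    rw [pull_skew, pull_cylιB_cylPairing, hσB N]
  let φ : hQ.toPoCh ⟶ hc.toPoCh := poissonNatTrans hQ hc (cylFunctorιA u) hA
  let ψ : hB.toPoCh ⟶ hc.toPoCh := poissonNatTrans hB hc (cylFunctorιB u) hB'
  -- The two ends include as `Q → cyl u ← B`. The second inclusion is always a quasi-isomorphism,
  -- the first because `u` is.
  refine .trans _ _ _ (.rel _ _ (weakEquivTo_CCR φ fun N => ?_))
    (.symm _ _ (.rel _ _ (weakEquivTo_CCR ψ fun N => ?_)))
  · have := hu N
    exact quasiIso_cylιA (u.app N)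
  · exact quasiIso_cylιB (u.app N)

end CylinderPairing

/-! ### Functors and natural transformations on `C` -/

theorem objHom_induction {P : ∀ {N N' : Obj}, (N ⟶ N') → Prop} (hid : ∀ N, P (𝟙 N))
    (harr : ∀ f : Arr, P f.hom) {N N' : Obj} (f : N ⟶ N') : P f := by
  change Hom N N' at f
  cases f
  · exact hid N
  · exact harr .iplus
  · exact harr .jplus
  · exact harr .iminus
  · exact harr .jminus

section ObjFunctor

variable {C : Type*} [Category C]

/-- The action on morphisms of a functor given by its values on the non-identity morphisms. -/
def Hom.lift {F : Obj → C} (m : ∀ f : Arr, F f.src ⟶ F f.tgt) :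
    {N N' : Obj} → Hom N N' → (F N ⟶ F N')
  | _, _, .id _ => 𝟙 _
  | _, _, .iplus => m .iplus
  | _, _, .jplus => m .jplus
  | _, _, .iminus => m .iminus
  | _, _, .jminus => m .jminus

/-- The functor on `C` given by its values on objects and on non-identity morphisms. -/
def objFunctor (F : Obj → C) (m : ∀ f : Arr, F f.src ⟶ F f.tgt) : Obj ⥤ C where
  obj := F
  map f := Hom.lift m f
  map_id _ := rfl
  map_comp {N N' N''} f g := by
    change Hom N N' at f
    change Hom N' N'' at g
    cases f
    · exact (Category.id_comp _).symm
    all_goals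
      cases g
      exact (Category.comp_id _).symm

/-- A natural transformation given by naturality squares for the non-identity morphisms. -/
def objNatTrans {F G : Obj ⥤ C} (φ : ∀ N, F.obj N ⟶ G.obj N)
    (h : ∀ f : Arr, F.map f.hom ≫ φ f.tgt = φ f.src ≫ G.map f.hom) : F ⟶ G where
  app := φ
  naturality _ _ f := objHom_induction
    (P := fun {N N'} f => F.map f ≫ φ N' = φ N ≫ G.map f) (fun N => by simp) h f

end ObjFunctor

/-! ### Double mapping cylinders -/

section CylDesc

variable {A B W : Ch K} {f : A ⟶ B} (α : A ⟶ W) (β : B ⟶ W) (s : ∀ i j, A.X i →ₗ[K] W.X j)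
  (hs : ∀ i (a : A.X i), (α.f i).hom a - (β.f i).hom ((f.f i).hom a) =
    (W.d (i + 1) i).hom (s i (i + 1) a) + s (i - 1) i ((A.d i (i - 1)).hom a))

theorem cylιA_cylDesc : cylιA f ≫ cylDesc α β s hs = α := by
  ext i x
  change ((cylDesc α β s hs).f i).hom (cylInA f i x) = _
  rw [cylDesc_apply, cylA_inA, cylB_inA, cylE_inA, map_zero, map_zero, add_zero, add_zero]

theorem cylιB_cylDesc : cylιB f ≫ cylDesc α β s hs = β := by
  ext i x
  change ((cylDesc α β s hs).f i).hom (cylInB f i x) = _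
  rw [cylDesc_apply, cylA_inB, cylB_inB, cylE_inB, map_zero, map_zero, add_zero, zero_add]

end CylDesc

section DoubleCylinder

variable {A A' B W : Ch K} (φ : A ⟶ B) (φ' : A' ⟶ B)

/-- The mapping cylinder of two maps with the same target. -/
abbrev doubleCyl : Ch K := cyl (prodDesc φ φ')

/-- The inclusion of the first source. -/
def doubleCylInl : A ⟶ doubleCyl φ φ' := prodInl A A' ≫ cylιA (prodDesc φ φ')

/-- The inclusion of the second source. -/
def doubleCylInr : A' ⟶ doubleCyl φ φ' := prodInr A A' ≫ cylιA (prodDesc φ φ')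

/-- `IsHtpy α β s` says that `α - β = ds + sd`. -/
def IsHtpy (α β : A ⟶ W) (s : ∀ i j, A.X i →ₗ[K] W.X j) : Prop :=
  ∀ i (a : A.X i), (α.f i).hom a - (β.f i).hom a =
    (W.d (i + 1) i).hom (s i (i + 1) a) + s (i - 1) i ((A.d i (i - 1)).hom a)

/-- The sum of two homotopies. -/
def coprodHtpy (s : ∀ i j, A.X i →ₗ[K] W.X j) (s' : ∀ i j, A'.X i →ₗ[K] W.X j) (i j : ℤ) :
    (prodCh A A').X i →ₗ[K] W.X j := LinearMap.coprod (s i j) (s' i j)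

variable {φ φ'}

theorem isHtpy_coprod {α : A ⟶ W} {α' : A' ⟶ W} {β : B ⟶ W} {s : ∀ i j, A.X i →ₗ[K] W.X j}
    {s' : ∀ i j, A'.X i →ₗ[K] W.X j} (hs : IsHtpy α (φ ≫ β) s) (hs' : IsHtpy α' (φ' ≫ β) s') :
    ∀ i (a : (prodCh A A').X i), ((prodDesc α α').f i).hom a -
      (β.f i).hom (((prodDesc φ φ').f i).hom a) =
        (W.d (i + 1) i).hom (coprodHtpy s s' i (i + 1) a) +
          coprodHtpy s s' (i - 1) i (((prodCh A A').d i (i - 1)).hom a) := by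
  rintro i ⟨a, a'⟩
  have h := hs i a
  have h' := hs' i a'
  rw [comp_f_apply] at h h'
  change (α.f i).hom a + (α'.f i).hom a' - (β.f i).hom ((φ.f i).hom a + (φ'.f i).hom a') =
    (W.d (i + 1) i).hom (s i (i + 1) a + s' i (i + 1) a') +
      (s (i - 1) i ((A.d i (i - 1)).hom a) + s' (i - 1) i ((A'.d i (i - 1)).hom a'))
  rw [map_add, map_add, add_add_add_comm, ← h, ← h']
  abel

/-- The map out of a double mapping cylinder given by two homotopies. -/
def doubleCylDesc {α : A ⟶ W} {α' : A' ⟶ W} {β : B ⟶ W} {s : ∀ i j, A.X i →ₗ[K] W.X j}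
    {s' : ∀ i j, A'.X i →ₗ[K] W.X j} (hs : IsHtpy α (φ ≫ β) s) (hs' : IsHtpy α' (φ' ≫ β) s') :
    doubleCyl φ φ' ⟶ W :=
  cylDesc (prodDesc α α') β (coprodHtpy s s') (isHtpy_coprod hs hs')

section

variable {α : A ⟶ W} {α' : A' ⟶ W} {β : B ⟶ W} {s : ∀ i j, A.X i →ₗ[K] W.X j}
  {s' : ∀ i j, A'.X i →ₗ[K] W.X j} (hs : IsHtpy α (φ ≫ β) s) (hs' : IsHtpy α' (φ' ≫ β) s')

theorem doubleCylDesc_apply (i : ℤ) (x : (doubleCyl φ φ').X i) :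
    ((doubleCylDesc hs hs').f i).hom x =
      (α.f i).hom (cylA (prodDesc φ φ') i x).1 + (α'.f i).hom (cylA (prodDesc φ φ') i x).2 +
        (β.f i).hom (cylB (prodDesc φ φ') i x) +
        (s (i - 1) i (cylE (prodDesc φ φ') i (i - 1) x).1 +
          s' (i - 1) i (cylE (prodDesc φ φ') i (i - 1) x).2) := rfl

theorem proj_doubleCylDesc (P : ∀ i, W.X i →ₗ[K] B.X i)
    (hα : ∀ i x, P i ((α.f i).hom x) = (φ.f i).hom x)
    (hα' : ∀ i x, P i ((α'.f i).hom x) = (φ'.f i).hom x) (hβ : ∀ i x, P i ((β.f i).hom x) = x)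
    (h : ∀ i j x, P j (s i j x) = 0) (h' : ∀ i j x, P j (s' i j x) = 0) (i : ℤ)
    (x : (doubleCyl φ φ').X i) :
    P i (((doubleCylDesc hs hs').f i).hom x) = ((cylπ (prodDesc φ φ')).f i).hom x := by
  rw [doubleCylDesc_apply, cylπ_apply, map_add, map_add, map_add, map_add, hα, hα', hβ, h, h',
    add_zero, add_zero]
  rfl

theorem doubleCylInl_desc : doubleCylInl φ φ' ≫ doubleCylDesc hs hs' = α := by
  rw [doubleCylInl, Category.assoc, doubleCylDesc, cylιA_cylDesc]
  ext i x
  change (α.f i).hom x + (α'.f i).hom 0 = _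
  rw [map_zero, add_zero]

theorem doubleCylInr_desc : doubleCylInr φ φ' ≫ doubleCylDesc hs hs' = α' := by
  rw [doubleCylInr, Category.assoc, doubleCylDesc, cylιA_cylDesc]
  ext i x
  change (α.f i).hom 0 + (α'.f i).hom x = _
  rw [map_zero, zero_add]

theorem cylιB_doubleCylDesc : cylιB (prodDesc φ φ') ≫ doubleCylDesc hs hs' = β :=
  cylιB_cylDesc _ _ _ _

theorem doubleCylInl_π : doubleCylInl φ φ' ≫ cylπ (prodDesc φ φ') = φ := by
  rw [doubleCylInl, Category.assoc, cylιA_cylπ]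
  ext i x
  change (φ.f i).hom x + (φ'.f i).hom 0 = _
  rw [map_zero, add_zero]

theorem doubleCylInr_π : doubleCylInr φ φ' ≫ cylπ (prodDesc φ φ') = φ' := by
  rw [doubleCylInr, Category.assoc, cylιA_cylπ]
  ext i x
  change (φ.f i).hom 0 + (φ'.f i).hom x = _
  rw [map_zero, zero_add]

theorem quasiIso_doubleCylDesc (h : QuasiIso β) : QuasiIso (doubleCylDesc hs hs') := by
  have := quasiIso_cylιB (prodDesc φ φ')
  have : QuasiIso (cylιB (prodDesc φ φ') ≫ doubleCylDesc hs hs') := by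
    rwa [cylιB_doubleCylDesc]
  exact quasiIso_of_comp_left (cylιB (prodDesc φ φ')) (doubleCylDesc hs hs')

theorem IsClosedPairing.chain_map' {V : Ch K} {κ : Pairing V} (hκ : IsClosedPairing κ)
    {i i' j j' : ℤ} (hi : i' + 1 = i) (hj : j' + 1 = j) (x : V.X i) (y : V.X j) :
    κ i' j ((V.d i i').hom x) y + (-1 : K) ^ i * κ i j' x ((V.d j j').hom y) = 0 := by
  obtain rfl : i' = i - 1 := by omega
  obtain rfl : j' = j - 1 := by omega
  exact hκ.chain_map i j x y

/-- The primitive of the difference of two pairings on a double mapping cylinder. -/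
def doubleCylR (σ : Pairing W) : Pairing (doubleCyl φ φ') := fun i j =>
  (σ (i + 1) j).compl₁₂ (coprodHtpy s s' i (i + 1) ∘ₗ cylA (prodDesc φ φ') i)
    ((doubleCylDesc hs hs').f j).hom

theorem doubleCylR_apply (σ : Pairing W) {i j k : ℤ} (hk : i + 1 = k)
    (x : (doubleCyl φ φ').X i) (y : (doubleCyl φ φ').X j) : doubleCylR hs hs' σ i j x y =
      σ k j (coprodHtpy s s' i k (cylA (prodDesc φ φ') i x))
        (((doubleCylDesc hs hs').f j).hom y) := by
  subst hk
  rfl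

theorem doubleCylR_eq_zero {σ : Pairing W} (hσ : IsClosedPairing σ) (i j : ℤ) (h : i + j ≠ -1) :
    doubleCylR hs hs' σ i j = 0 := by
  rw [doubleCylR, hσ.degree_zero (i + 1) j (by omega)]
  rfl

/-- On the cylinder, the map to `W` differs from `β` after the projection by `ds + sd`, where `s` is
evaluated on the component in the sources. Paired with `β`, the pairing `σ` reduces to `τ` through
`P`; closedness of `σ` turns the remaining `σ(ds + sd, -)` into the boundary of `doubleCylR`. -/
theorem pull_doubleCylDesc {σ : Pairing W} (hσ : IsClosedPairing σ) (τ : Pairing B)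
    (P : ∀ i, W.X i →ₗ[K] B.X i) (hβ : ∀ i j x w, σ i j ((β.f i).hom x) w = τ i j x (P j w))
    (hP : ∀ i x, P i (((doubleCylDesc hs hs').f i).hom x) =
      ((cylπ (prodDesc φ φ')).f i).hom x) :
    pull (doubleCylDesc hs hs') σ =
      pull (cylπ (prodDesc φ φ')) τ + dPairing (doubleCylR hs hs' σ) := by
  funext i j
  refine LinearMap.ext fun x => LinearMap.ext fun y => ?_
  change pull (doubleCylDesc hs hs') σ i j x y = pull (cylπ (prodDesc φ φ')) τ i j x y +
    dPairing (doubleCylR hs hs' σ) i j x y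
  rw [pull_apply, pull_apply, dPairing_apply, doubleCylR_apply hs hs' σ (sub_add_cancel i 1),
    doubleCylR_apply hs hs' σ rfl, map_d_apply, ← hP j y, ← hβ, cylA_d, cylπ_apply]
  have h1 := isHtpy_coprod hs hs' i (cylA (prodDesc φ φ') i x)
  have h2 := hσ.chain_map' rfl (sub_add_cancel j 1)
    (coprodHtpy s s' i (i + 1) (cylA (prodDesc φ φ') i x)) (((doubleCylDesc hs hs').f j).hom y)
  have h3 : ((doubleCylDesc hs hs').f i).hom x =
      ((prodDesc α α').f i).hom (cylA (prodDesc φ φ') i x) +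
        (β.f i).hom (cylB (prodDesc φ φ') i x) +
          coprodHtpy s s' (i - 1) i (cylE (prodDesc φ φ') i (i - 1) x) :=
    cylDesc_apply _ _ _ (isHtpy_coprod hs hs') i x
  have h4 : (-1 : K) ^ (i + 1) = -(-1 : K) ^ i := by
    rw [zpow_add_one₀ (by simp)]
    ring
  rw [h3, eq_add_of_sub_eq h1]
  rw [h4] at h2
  simp only [map_add, LinearMap.add_apply]
  linear_combination h2

/-- Vanishing on the two source ends makes the primitive natural, because the primitive chosen at
`M₊` and `M₋` is zero. -/
theorem doubleCylR_inl (σ : Pairing W) (h : ∀ i j k x y, σ k j (s i k x) ((α.f j).hom y) = 0)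
    (i j : ℤ) (x : A.X i) (y : A.X j) : doubleCylR hs hs' σ i j
      (((doubleCylInl φ φ').f i).hom x) (((doubleCylInl φ φ').f j).hom y) = 0 := by
  rw [doubleCylR_apply hs hs' σ rfl, ← comp_f_apply, doubleCylInl_desc, ← h i j (i + 1) x y]
  refine congrArg (fun z => σ (i + 1) j z ((α.f j).hom y)) ?_
  change s i (i + 1) x + s' i (i + 1) 0 = _
  rw [map_zero, add_zero]

theorem doubleCylR_inr (σ : Pairing W) (h : ∀ i j k x y, σ k j (s' i k x) ((α'.f j).hom y) = 0)
    (i j : ℤ) (x : A'.X i) (y : A'.X j) : doubleCylR hs hs' σ i j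
      (((doubleCylInr φ φ').f i).hom x) (((doubleCylInr φ φ').f j).hom y) = 0 := by
  rw [doubleCylR_apply hs hs' σ rfl, ← comp_f_apply, doubleCylInr_desc, ← h i j (i + 1) x y]
  refine congrArg (fun z => σ (i + 1) j z ((α'.f j).hom y)) ?_
  change s i (i + 1) 0 + s' i (i + 1) x = _
  rw [map_zero, zero_add]

end

end DoubleCylinder

/-! ### The resolution of a functor on `C` -/

section Resolution

variable (X : Obj ⥤ Ch K)

/-- The chain homotopy between the inclusions of the two ends of the edge `(n, f)`. -/
def edgeHtpy (n : ℤ) (f : Arr) (i j : ℤ) : (X.obj f.src).X i →ₗ[K] LLX X j :=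
  (-1 : K) ^ i • inEdge X j n f ∘ₗ (idOfEq (X.obj f.src) i (j - 1)).hom

theorem deltaLL_apply (i j n : ℤ) (f : Arr) (x : (X.obj f.src).X (i - 1)) :
    deltaLL X i j n f x = (-1 : K) ^ (i - 1) •
      (inVert X j (n + f.winding) f.src ((idOfEq (X.obj f.src) (i - 1) j).hom x) -
        inVert X j n f.tgt (arrLin X f j ((idOfEq (X.obj f.src) (i - 1) j).hom x))) := rfl

/-- The vertical differential of an edge is the difference of its ends, so each arrow of `C`
supplies exactly the homotopy needed to map a double cylinder into `𝕃L_!(X)`. -/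
theorem isHtpy_edgeHtpy (n : ℤ) (f : Arr) :
    IsHtpy (inVertHom X (n + f.winding) f.src) (X.map f.hom ≫ inVertHom X n f.tgt)
      (edgeHtpy X n f) := by
  intro i x
  change inVert X i (n + f.winding) f.src x - inVert X i n f.tgt (arrLin X f i x) =
    dLL X (i + 1) i ((-1 : K) ^ i • inEdge X (i + 1) n f
      ((idOfEq (X.obj f.src) i (i + 1 - 1)).hom x)) +
      (-1 : K) ^ (i - 1) • inEdge X i n f ((idOfEq (X.obj f.src) (i - 1) (i - 1)).hom
        (dLin f.src i (i - 1) x))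
  have e : i = i + 1 - 1 := by ring
  have h : dLL X (i + 1) i (inEdge X (i + 1) n f
      ((idOfEq (X.obj f.src) i (i + 1 - 1)).hom x)) =
        (-1 : K) ^ i • (inVert X i (n + f.winding) f.src x -
          inVert X i n f.tgt (arrLin X f i x)) + inEdge X i n f (dLin f.src i (i - 1) x) := by
    rw [dLL, descLL_inEdge, LinearMap.add_apply, LinearMap.comp_apply, d_idOfEq _ e, deltaLL_apply,
      idOfEq_idOfEq _ e e.symm, idOfEq_self, add_sub_cancel_right]
    rfl
  rw [map_smul, h, idOfEq_self, neg_one_zpow_pred, smul_add, smul_smul,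
    CCRAlg.neg_one_zpow_mul_self, one_smul, neg_smul]
  exact (add_neg_cancel_right _ _).symm

/-- The homotopy pushout of the two maps into `X(M)` and of the two maps into `X(M_h)`. -/
def resolutionObj : Obj → Ch K
  | .M => doubleCyl (X.map iplus) (X.map iminus)
  | .Mh => doubleCyl (X.map jplus) (X.map jminus)
  | .Mplus => X.obj .Mplus
  | .Mminus => X.obj .Mminus

/-- The resolution of `X` by mapping cylinders. -/
def resolution : Obj ⥤ Ch K := objFunctor (resolutionObj X) fun f => match f with
  | .iplus => doubleCylInl (X.map RCE.iplus) (X.map RCE.iminus)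
  | .jplus => doubleCylInl (X.map RCE.jplus) (X.map RCE.jminus)
  | .iminus => doubleCylInr (X.map RCE.iplus) (X.map RCE.iminus)
  | .jminus => doubleCylInr (X.map RCE.jplus) (X.map RCE.jminus)

/-- The projection of the resolution. -/
def resolutionπ : resolution X ⟶ X :=
  objNatTrans (F := resolution X) (G := X) (fun N => match N with
    | .M => cylπ (prodDesc (X.map iplus) (X.map iminus))
    | .Mh => cylπ (prodDesc (X.map jplus) (X.map jminus))
    | .Mplus => 𝟙 (X.obj .Mplus)
    | .Mminus => 𝟙 (X.obj .Mminus))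
    (fun f => match f with
      | .iplus => doubleCylInl_π.trans (Category.id_comp _).symm
      | .jplus => doubleCylInl_π.trans (Category.id_comp _).symm
      | .iminus => doubleCylInr_π.trans (Category.id_comp _).symm
      | .jminus => doubleCylInr_π.trans (Category.id_comp _).symm)

theorem quasiIso_resolutionπ (N : Obj) : QuasiIso ((resolutionπ X).app N) := by
  cases N
  · exact quasiIso_cylπ (prodDesc (X.map iplus) (X.map iminus))
  · exact inferInstanceAs (QuasiIso (𝟙 (X.obj .Mplus)))
  · exact quasiIso_cylπ (prodDesc (X.map jplus) (X.map jminus))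
  · exact inferInstanceAs (QuasiIso (𝟙 (X.obj .Mminus)))

/-- The component at `M` of the comparison map from the resolution to `𝕃L_!(X)`. -/
def comparisonM : doubleCyl (X.map iplus) (X.map iminus) ⟶ LLobj X :=
  doubleCylDesc (isHtpy_edgeHtpy X 0 .iplus) (isHtpy_edgeHtpy X 0 .iminus)

/-- The component at `M_h` of the comparison map from the resolution to `𝕃L_!(X)`. -/
def comparisonMh : doubleCyl (X.map jplus) (X.map jminus) ⟶ LLobj X :=
  doubleCylDesc (isHtpy_edgeHtpy X 0 .jplus) (isHtpy_edgeHtpy X 0 .jminus)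

theorem inVertHom_LLmap (n k : ℤ) (N : Obj) :
    inVertHom X n N ≫ LLmap X k = inVertHom X (n + k) N := by
  ext i x
  exact shiftLL_inVert X k i n N x

/-- The comparison map from the resolution to `𝕃L_!(X)`. -/
def comparison : resolution X ⟶ locFunctor ⋙ LL X :=
  objNatTrans (F := resolution X) (G := locFunctor ⋙ LL X) (fun N => match N with
    | .M => comparisonM X
    | .Mh => comparisonMh X
    | .Mplus => inVertHom X 0 .Mplus
    | .Mminus => inVertHom X 0 .Mminus)
    (fun f => match f with
      | .iplus => (doubleCylInl_desc (isHtpy_edgeHtpy X 0 .iplus)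
          (isHtpy_edgeHtpy X 0 .iminus)).trans (inVertHom_LLmap X 0 0 .Mplus).symm
      | .jplus => (doubleCylInl_desc (isHtpy_edgeHtpy X 0 .jplus)
          (isHtpy_edgeHtpy X 0 .jminus)).trans (inVertHom_LLmap X 0 0 .Mplus).symm
      -- The edge `(0, i₋)` starts at `(1, M₋)`, while the component at `M₋` uses the vertex `(0,
      -- M₋)`; the action of `L(i₋) = 1` accounts for the difference.
      | .iminus => (doubleCylInr_desc (isHtpy_edgeHtpy X 0 .iplus)
          (isHtpy_edgeHtpy X 0 .iminus)).trans (inVertHom_LLmap X 0 1 .Mminus).symm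
      | .jminus => (doubleCylInr_desc (isHtpy_edgeHtpy X 0 .jplus)
          (isHtpy_edgeHtpy X 0 .jminus)).trans (inVertHom_LLmap X 0 0 .Mminus).symm)

variable {X}

/-- A double cylinder is equivalent to its target, so every case reduces to the inclusion of a
single vertex. -/
theorem quasiIso_comparison (D : CoherenceData X) (hX : HoTimeSliceCh X) (N : Obj) :
    QuasiIso ((comparison X).app N) := by
  cases N
  · exact quasiIso_doubleCylDesc (isHtpy_edgeHtpy X 0 .iplus) (isHtpy_edgeHtpy X 0 .iminus)
      (quasiIso_inVertHom D hX 0 .M)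
  · exact quasiIso_inVertHom D hX 0 .Mplus
  · exact quasiIso_doubleCylDesc (isHtpy_edgeHtpy X 0 .jplus) (isHtpy_edgeHtpy X 0 .jminus)
      (quasiIso_inVertHom D hX 0 .Mh)
  · exact quasiIso_inVertHom D hX 0 .Mminus

variable (D : CoherenceData X)

theorem srcNear_src (a : Edge) : a.SrcNear (a.1 + a.2.winding, a.2.src) := by
  have := a.pos_src_tgt
  change a.SrcNear a.src
  simp only [Edge.SrcNear, Vert.dist]
  omega

theorem tgtNear_tgt (a : Edge) : a.TgtNear (a.1, a.2.tgt) := by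
  have := a.pos_src_tgt
  change a.TgtNear a.tgt
  simp only [Edge.TgtNear, Vert.dist]
  omega

theorem zigLin_edge (a : Edge) (i : ℤ) (x : (X.obj a.2.src).X i) :
    zigLin D (a.1 + a.2.winding) a.2.src a.1 a.2.tgt i x = arrLin X a.2 i x := by
  rw [zigLin_to_tgt D (srcNear_src a), zigLin_self]

theorem vertProj_edgeHtpy (n : ℤ) (f : Arr) (i j : ℤ) (x : (X.obj f.src).X i) :
    vertProj D n f.tgt j (edgeHtpy X n f i j x) = 0 := by
  have h : gamLin D n f.tgt (n, f) (j - 1) j = 0 := gamLin_of_tgtNear D (tgtNear_tgt (n, f)) _ _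
  rw [edgeHtpy, LinearMap.smul_apply, map_smul, LinearMap.comp_apply, vertProj_inEdge, h]
  simp

/-- `Λ` of an edge vanishes at its own source, the source being the nearer end. This is the
vanishing that makes `resolutionR` natural. -/
theorem pairLin_edgeHtpy_inVert (τ : ∀ N, Pairing (X.obj N)) (n : ℤ) (f : Arr) (i j k : ℤ)
    (x : (X.obj f.src).X i) (y : (X.obj f.src).X j) :
    pairLin D τ k j (edgeHtpy X n f i k x) (inVert X j (n + f.winding) f.src y) = 0 := by
  have h : lamLin D (n, f) (n + f.winding) f.src j (j + 1) = 0 :=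
    lamLin_of_srcNear D (srcNear_src (n, f)) _ _
  rw [edgeHtpy, LinearMap.smul_apply, map_smul, LinearMap.smul_apply, LinearMap.comp_apply,
    pairLin_inEdge D τ rfl, edgeProj_inVert, h]
  simp

theorem vertProj_comparisonM (i : ℤ) (x : (doubleCyl (X.map iplus) (X.map iminus)).X i) :
    vertProj D 0 .M i (((comparisonM X).f i).hom x) =
      ((cylπ (prodDesc (X.map iplus) (X.map iminus))).f i).hom x :=
  proj_doubleCylDesc (isHtpy_edgeHtpy X 0 .iplus) (isHtpy_edgeHtpy X 0 .iminus) (vertProj D 0 .M)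
    (fun i x => (vertProj_inVert D 0 .M i 0 .Mplus x).trans (zigLin_edge D (0, .iplus) i x))
    (fun i x => (vertProj_inVert D 0 .M i 1 .Mminus x).trans (zigLin_edge D (0, .iminus) i x))
    (fun i x => (vertProj_inVert D 0 .M i 0 .M x).trans (zigLin_self D 0 .M i x))
    (fun i j x => vertProj_edgeHtpy D 0 .iplus i j x) (fun i j x => vertProj_edgeHtpy D 0 .iminus i j x)
    i x

theorem vertProj_comparisonMh (i : ℤ) (x : (doubleCyl (X.map jplus) (X.map jminus)).X i) :
    vertProj D 0 .Mh i (((comparisonMh X).f i).hom x) =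
      ((cylπ (prodDesc (X.map jplus) (X.map jminus))).f i).hom x :=
  proj_doubleCylDesc (isHtpy_edgeHtpy X 0 .jplus) (isHtpy_edgeHtpy X 0 .jminus) (vertProj D 0 .Mh)
    (fun i x => (vertProj_inVert D 0 .Mh i 0 .Mplus x).trans (zigLin_edge D (0, .jplus) i x))
    (fun i x => (vertProj_inVert D 0 .Mh i 0 .Mminus x).trans (zigLin_edge D (0, .jminus) i x))
    (fun i x => (vertProj_inVert D 0 .Mh i 0 .Mh x).trans (zigLin_self D 0 .Mh i x))
    (fun i j x => vertProj_edgeHtpy D 0 .jplus i j x) (fun i j x => vertProj_edgeHtpy D 0 .jminus i j x)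
    i x

variable (τ : ∀ N, Pairing (X.obj N))

/-- The primitive of the difference of the Poisson structures on the resolution. -/
def resolutionR : ∀ N, Pairing ((resolution X).obj N)
  | .M => doubleCylR (isHtpy_edgeHtpy X 0 .iplus) (isHtpy_edgeHtpy X 0 .iminus)
      (W := LLobj X) (pairLin D τ)
  | .Mh => doubleCylR (isHtpy_edgeHtpy X 0 .jplus) (isHtpy_edgeHtpy X 0 .jminus)
      (W := LLobj X) (pairLin D τ)
  | .Mplus => 0
  | .Mminus => 0

variable {τ}

theorem isClosedPairing_pairLin (hτ : PoissonFamily τ) :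
    IsClosedPairing (V := LLobj X) (pairLin D τ) :=
  ⟨pairLin_degree_zero D hτ.isPoisson, pairLin_d D hτ⟩

theorem resolutionR_eq_zero (hτ : PoissonFamily τ) (N : Obj) (i j : ℤ) (h : i + j ≠ -1) :
    resolutionR D τ N i j = 0 := by
  cases N
  · exact doubleCylR_eq_zero _ _ (isClosedPairing_pairLin D hτ) i j h
  · rfl
  · exact doubleCylR_eq_zero _ _ (isClosedPairing_pairLin D hτ) i j h
  · rfl

variable (τ) in
theorem resolutionR_natural {N N' : Obj} (f : N ⟶ N') (i j : ℤ) (x : ((resolution X).obj N).X i)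
    (y : ((resolution X).obj N).X j) : resolutionR D τ N' i j
      ((((resolution X).map f).f i).hom x) ((((resolution X).map f).f j).hom y) =
        resolutionR D τ N i j x y := by
  refine objHom_induction (P := fun {N N'} f => ∀ (x : ((resolution X).obj N).X i)
    (y : ((resolution X).obj N).X j), resolutionR D τ N' i j
      ((((resolution X).map f).f i).hom x) ((((resolution X).map f).f j).hom y) =
        resolutionR D τ N i j x y) (fun N x y => ?_) (fun f x y => ?_) f x y
  · rfl
  · cases f
    · exact doubleCylR_inl _ _ _ (fun i j k x y => pairLin_edgeHtpy_inVert D τ 0 .iplus i j k x y)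
        i j x y
    · exact doubleCylR_inl _ _ _ (fun i j k x y => pairLin_edgeHtpy_inVert D τ 0 .jplus i j k x y)
        i j x y
    · exact doubleCylR_inr _ _ _ (fun i j k x y => pairLin_edgeHtpy_inVert D τ 0 .iminus i j k x y)
        i j x y
    · exact doubleCylR_inr _ _ _ (fun i j k x y => pairLin_edgeHtpy_inVert D τ 0 .jminus i j k x y)
        i j x y

theorem pull_inVertHom (n : ℤ) (N : Obj) :
    pull (inVertHom X n N) (W := LLobj X) (pairLin D τ) = τ N := by
  funext i j
  refine LinearMap.ext fun x => LinearMap.ext fun y => ?_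
  refine (pairLin_inVert D τ i j n N x _).trans ?_
  refine congrArg (τ N i j x) ?_
  exact (vertProj_inVert D n N j n N y).trans (zigLin_self D n N j y)

theorem add_dPairing_zero {V : Ch K} (κ : Pairing V) : κ + dPairing 0 = κ := by
  funext i j
  refine LinearMap.ext fun x => LinearMap.ext fun y => ?_
  change κ i j x y + (0 + (-1 : K) ^ i * 0) = κ i j x y
  rw [mul_zero, add_zero, add_zero]

/-- At `M₊` and `M₋` the two structures agree strictly. At `M` and `M_h` they agree up to the
boundary produced by the edge homotopies, since `vertProj` followed after the comparison map is the
projection of the cylinder. -/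
theorem pull_comparison (hτ : PoissonFamily τ) (N : Obj) :
    pull (W := LLobj X) ((comparison X).app N) (pairLin D τ) =
      pull ((resolutionπ X).app N) (τ N) + dPairing (resolutionR D τ N) := by
  cases N
  · exact pull_doubleCylDesc (isHtpy_edgeHtpy X 0 .iplus) (isHtpy_edgeHtpy X 0 .iminus)
      (isClosedPairing_pairLin D hτ) (τ .M) (vertProj D 0 .M)
      (fun i j x w => pairLin_inVert D τ i j 0 .M x w) (vertProj_comparisonM D)
  · exact (pull_inVertHom D 0 .Mplus).trans (add_dPairing_zero (τ .Mplus)).symm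
  · exact pull_doubleCylDesc (isHtpy_edgeHtpy X 0 .jplus) (isHtpy_edgeHtpy X 0 .jminus)
      (isClosedPairing_pairLin D hτ) (τ .Mh) (vertProj D 0 .Mh)
      (fun i j x w => pairLin_inVert D τ i j 0 .Mh x w) (vertProj_comparisonMh D)
  · exact (pull_inVertHom D 0 .Mminus).trans (add_dPairing_zero (τ .Mminus)).symm

end Resolution

/-! ### The zig-zag of weak equivalences and the relative Cauchy evolution. -/

section Comparison

variable (L : Obj ⥤ PoCh K) (D : CoherenceData (observables L))

theorem isPoissonOn_resolution : IsPoissonOn (resolution (observables L))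
    (fun N => pull ((resolutionπ (observables L)).app N) (L.obj N).τ) where
  isPoisson N := (L.obj N).isPoisson.pull ((resolutionπ (observables L)).app N)
  natural {N N'} f i j x y := by
    have h : ∀ (k : ℤ) (z : ((resolution (observables L)).obj N).X k),
        (((resolutionπ (observables L)).app N').f k).hom
          ((((resolution (observables L)).map f).f k).hom z) =
        (((L.map f).f).f k).hom ((((resolutionπ (observables L)).app N).f k).hom z) :=
      fun k z => congrArg (fun g : (resolution (observables L)).obj N ⟶ (observables L).obj N' =>
        (g.f k).hom z) ((resolutionπ (observables L)).naturality f)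
    refine (congrArg₂ (fun a b => (L.obj N').τ i j a b) (h i x) (h j y)).trans ?_
    exact (L.map f).compat i j _ _

/-- The resolution of `(𝔏, τ)` as a Poisson chain complex maps to `(𝔏, τ)`. -/
def poissonResolutionπ : (isPoissonOn_resolution L).toPoCh ⟶ L where
  app N := ⟨(resolutionπ (observables L)).app N, fun _ _ _ _ => rfl⟩
  naturality _ _ f := PoCh.Hom.ext ((resolutionπ (observables L)).naturality f)

variable {L D}

theorem isPoissonOn_comp_locFunctor (h : IsPoissonOn (LL (observables L)) (tauL L D)) :
    IsPoissonOn (locFunctor ⋙ LL (observables L)) (fun N => tauL L D (locFunctor.obj N)) where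
  isPoisson N := h.isPoisson (locFunctor.obj N)
  natural f := h.natural (locFunctor.map f)

/-- The interpolation is carried out with the closed pairing `pairLin` in place of `τ_𝕃`: it is
natural by translation invariance, and its antisymmetrization is `τ_𝕃`. -/
theorem zigzagEquiv_resolution [CharZero K] (hL : HoTimeSliceCh (observables L))
    (h : IsPoissonOn (LL (observables L)) (tauL L D)) :
    ZigzagEquiv ((isPoissonOn_resolution L).toPoCh ⋙ CCR K) (strictTheory h) := by
  let σ : ∀ N, Pairing ((locFunctor ⋙ LL (observables L)).obj N) :=
    fun _ => pairLin D fun N => (L.obj N).τ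
  have hσ : ∀ N, IsClosedPairing (σ N) := fun _ => isClosedPairing_pairLin D (poissonFamily L)
  have hσn : ∀ {N N' : Obj} (f : N ⟶ N'),
      pull ((locFunctor ⋙ LL (observables L)).map f) (σ N') = σ N := fun {_ _} f => by
    funext i j
    refine LinearMap.ext fun x => LinearMap.ext fun y => ?_
    exact pairLin_shift D (τ := fun N => (L.obj N).τ) (Hom.winding f) i j x y
  have hσB : ∀ N, tauL L D (locFunctor.obj N) = skew (σ N) := fun N =>
    tauL_eq_skew L D (locFunctor.obj N)
  have hσQ : ∀ N, pull ((comparison (observables L)).app N) (σ N) =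
      pull ((resolutionπ (observables L)).app N) (L.obj N).τ +
        dPairing (resolutionR D (fun N => (L.obj N).τ) N) := pull_comparison D (poissonFamily L)
  exact zigzagEquiv_of_homotopy (isPoissonOn_resolution L) (isPoissonOn_comp_locFunctor h)
    (quasiIso_comparison D hL) hσ hσn hσB (resolutionR_eq_zero D (poissonFamily L))
    (resolutionR_natural D (fun N => (L.obj N).τ)) hσQ

theorem zigzagEquiv_strictTheory [CharZero K] (hL : HoTimeSliceCh (observables L))
    (h : IsPoissonOn (LL (observables L)) (tauL L D)) :
    ZigzagEquiv (theory L) (strictTheory h) :=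
  .trans _ _ _
    (.symm _ _ (.rel _ _ (weakEquivTo_CCR (poissonResolutionπ L)
      (quasiIso_resolutionπ (observables L)))))
    (zigzagEquiv_resolution hL h)

theorem hoTimeSlice_theory [CharZero K] (hL : HoTimeSliceCh (observables L)) :
    HoTimeSlice (theory L) :=
  fun _ _ f => weakEquiv_CCR (L.map f) (hL f)

instance isIso_BZ_mor (k : ℤ) : IsIso (BZ.mor k) :=
  ⟨BZ.mor (-k), congrArg Multiplicative.ofAdd (neg_add_cancel k),
    congrArg Multiplicative.ofAdd (add_neg_cancel k)⟩

theorem strictTimeSlice_strictTheory (h : IsPoissonOn (LL (observables L)) (tauL L D)) :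
    StrictTimeSlice (strictTheory h) := fun _ _ f =>
  inferInstanceAs (IsIso ((localTheory h).map (BZ.mor (Hom.winding f))))

/-- The arrows `i₊`, `j₊` and `j₋` have winding `0` and act as identities, so the composite is the
image of `i₋`. -/
theorem relCauchyEvolution_strictTheory (h : IsPoissonOn (LL (observables L)) (tauL L D))
    (hst : StrictTimeSlice (strictTheory h)) :
    (relCauchyEvolution (strictTheory h) hst).hom = (localTheory h).map (BZ.mor 1) := by
  have e0 : (localTheory h).map (BZ.mor 0) = 𝟙 _ := (localTheory h).map_id _
  have := hst iplus
  have := hst jminus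
  have hp : (strictTheory h).map iplus = 𝟙 _ := e0
  have hjp : (strictTheory h).map jplus = 𝟙 _ := e0
  have hjm : (strictTheory h).map jminus = 𝟙 _ := e0
  have hip : inv ((strictTheory h).map iplus) = 𝟙 _ :=
    IsIso.inv_eq_of_hom_inv_id ((Category.comp_id _).trans hp)
  have hijm : inv ((strictTheory h).map jminus) = 𝟙 _ :=
    IsIso.inv_eq_of_hom_inv_id ((Category.comp_id _).trans hjm)
  change inv ((strictTheory h).map iplus) ≫ (strictTheory h).map jplus ≫
    inv ((strictTheory h).map jminus) ≫ (strictTheory h).map iminus = _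
  refine (congrArg₂ (· ≫ ·) hip (congrArg₂ (· ≫ ·) hjp (congrArg (· ≫ _) hijm))).trans ?_
  exact (Category.id_comp _).trans ((Category.id_comp _).trans (Category.id_comp _))

end Comparison

end RCE

end

theorem theorem5p3 {K : Type u} [Field K] [CharZero K] (L : RCE.Obj ⥤ RCE.PoCh K)
    (hL : RCE.HoTimeSliceCh (RCE.observables L)) :
    Nonempty (RCE.CoherenceData (RCE.observables L)) ∧
      ∀ D : RCE.CoherenceData (RCE.observables L),
        ∃ h : RCE.IsPoissonOn (RCE.LL (RCE.observables L)) (RCE.tauL L D),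
          RCE.HoTimeSlice (RCE.theory L) ∧
          RCE.ZigzagEquiv (RCE.theory L) (RCE.strictTheory h) ∧
          ∃ hst : RCE.StrictTimeSlice (RCE.strictTheory h),
            (RCE.relCauchyEvolution (RCE.strictTheory h) hst).hom =
              (RCE.localTheory h).map (RCE.BZ.mor 1) :=
  ⟨RCE.nonempty_coherenceData hL, fun D =>
    have h := RCE.isPoissonOn_tauL L D
    ⟨h, RCE.hoTimeSlice_theory hL, RCE.zigzagEquiv_strictTheory hL h,
      RCE.strictTimeSlice_strictTheory h, RCE.relCauchyEvolution_strictTheory h _⟩⟩
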